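/- \textbf{Theorem (The cubic tensor: $n=1$).} \emph{Model.} Let $L\ge 1$, $d_1,\dots,d_L\ge 1$, $p=\prod_k d_k$, $m_k=p/d_k$, $m_{\min}=\min_k m_k$, $d_{\max}=\max_k d_k$. Let $\Psi_k\in\mathbb R^{d_k\times d_k}$ be such that the Kronecker sum $$\Omega_0=\Psi_1\oplus\dots\oplus\Psi_L=\sum_{k=1}^L I_{d_1}\otimes\dots\otimes I_{d_{k-1}}\otimes\Psi_k\otimes I_{d_{k+1}}\otimes\dots\otimes I_{d_L}$$ is symmetric positive definite, and put $\Sigma_0=\Omega_0^{-1}$. One random tensor is observed, with vectorization $x=\Sigma_0^{1/2}Z\in\mathbb R^p$, where $Z$ has independent entries with $\mathbb E Z_j=0$, $\mathbb E Z_j^2=1$ and $\|Z_j\|_{\psi_2}=\inf\{t>0:\mathbb E\exp(Z_j^2/t^2)\le 2\}\le C_0$. Let $\hat S=xx^T$. For penalties $\rho_k$, the TeraLasso estimator $\hat\Omega$ is a minimizer of $$-\log\det\Omega+\langle\hat S,\Omega\rangle+\sum_{k=1}^L m_k\rho_k\sum_{i\ne j}|B_{k,ij}|$$ over all positive definite $\Omega=B_1\oplus\dots\oplus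 B_L$ with $B_k\in\mathbb R^{d_k\times d_k}$ (and an arbitrary matrix on outcomes where no minimizer exists). Let $s_k=|\{(i,j):i\ne j,\ \Psi_{k,ij}\ne 0\}|$ and $s=\sum_k m_ks_k$; let $\|\cdot\|_2$, $\|\cdot\|_F$ be the operator and Frobenius norms, $\phi_{\min},\phi_{\max}$ the extreme eigenvalues, and $\kappa(\Sigma_0)=\phi_{\max}(\Sigma_0)/\phi_{\min}(\Sigma_0)$. \emph{Assumptions.} \begin{itemize} \item[(A1)] $m_{\min}\ge\log p$, and $\rho_k=\delta_k/\varepsilon_k$ with $\varepsilon_0\le\varepsilon_k<1$ and $c_\delta\|\Sigma_0\|_2\sqrt{\log p/m_k}\le\delta_k\le C_\delta\|\Sigma_0\|_2\sqrt{\log p/m_k}$ for all $k$. \item[(A2)] $0<\underline k\le\phi_{\min}(\Omega_0)$ and $\phi_{\max}(\Omega_0)\le\overline k<\infty$. \item[(A3)] $m_{\min}^2\ge C^2(L+1)\kappa(\Sigma_0)^4(s\log p+Lp)$. \end{itemize} \emph{Claim.} For every $C_0>0$ there is $c_\delta>0$ such that for all $C_\delta\ge c_\delta$ and $\varepsilon_0\in(0,1)$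 there is $C>0$ for which the following holds. Consider any family of such models (with the common bound $C_0$, while $L$, the $d_k$, the $\Psi_k$, $\underline k,\overline k$, the law of $Z$ and the probability space may all vary) along which $p\to\infty$ and which satisfies (A1), (A2), (A3). Suppose that, with constants uniform over the family and over $k$, $d_k=O(m_k)$ for all $k$ and $m_1\asymp\dots\asymp m_L$. Then, as $p\to\infty$, $$\frac{\|\hat\Omega-\Omega_0\|_F}{\kappa(\Sigma_0)\|\Omega_0\|_2}=O_P\Big(\big(\textstyle\sum_k s_k\log p+L\,d_{\max}\big)^{1/2}\Big),$$ $$\frac{\|\hat\Omega-\Omega_0\|_2}{\kappa(\Sigma_0)\|\Omega_0\|_2}=O_P\Big(\big(L\textstyle\sum_k s_k\log p+L^2d_{\max}\big)^{1/2}/m_{\min}^{1/2}\Big).$$ If in addition, with uniform constants, $d_1\asymp\dots\asymp d_L$ and $d_k=\Omega\big(\frac{\log p}{L}\sum_j s_j\big)$ for all $k$, then $$\frac{\|\hat\Omega-\Omega_0\|_2}{\|\Omega_0\|_2}\vee\frac{\|\hat\Omega-\Omega_0\|_F}{\|\Omega_0\|_F}=O_P\big(L\,\kappa(\Sigma_0)\,p^{1/L-1/2}\big).$$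 Here $X=O_P(a)$ along the family means: for every $\eta>0$ there is $M$ such that $\mathbb P(|X|>Ma)\le\eta$ for all members that are far enough along the family. -/

import Mathlib

open MeasureTheory ProbabilityTheory Filter
open scoped ENNReal

universe u v

noncomputable section

namespace TeraLasso

/-! ### Matrix quantities -/

section MatrixQuantities

variable {n : Type*} [Fintype n] [DecidableEq n]

/-- Smallest eigenvalue of a symmetric matrix. -/
def phiMin (A : Matrix n n ℝ) : ℝ := sInf (spectrum ℝ A)

/-- Largest eigenvalue of a symmetric matrix. -/
def phiMax (A : Matrix n n ℝ) : ℝ := sSup (spectrum ℝ A)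

/-- Condition number of a symmetric positive definite matrix. -/
def condNum (A : Matrix n n ℝ) : ℝ := phiMax A / phiMin A

/-- Operator norm with respect to the Euclidean norm. -/
def opNorm (A : Matrix n n ℝ) : ℝ := ‖Matrix.toEuclideanCLM (n := n) (𝕜 := ℝ) A‖

/-- Frobenius norm. -/
def frobNorm (A : Matrix n n ℝ) : ℝ := Real.sqrt (∑ i, ∑ j, A i j ^ 2)

/-- The off-diagonal `ℓ₁` norm `∑_{i ≠ j} |A i j|`. -/
def offOne (A : Matrix n n ℝ) : ℝ := ∑ i, ∑ j, if i = j then 0 else |A i j|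

/-- The number of nonzero off-diagonal entries. -/
def offSupportCard (A : Matrix n n ℝ) : ℕ :=
  (Finset.univ.filter fun e : n × n => e.1 ≠ e.2 ∧ A e.1 e.2 ≠ 0).card

open scoped MatrixOrder in
/-- The positive semidefinite square root of a positive semidefinite matrix. -/
def matSqrt (A : Matrix n n ℝ) : Matrix n n ℝ := CFC.sqrt A

end MatrixQuantities

/-! ### Tensor indices and Kronecker sums -/

/-- Positions of a tensor of format `d 0 × ⋯ × d (L - 1)`.  Vectorized tensors are functions on this
type, and `p × p` matrices, `p = ∏ k, d k`, are matrices indexed by it. -/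
abbrev Idx {L : ℕ} (d : Fin L → ℕ) : Type := ∀ k, Fin (d k)

/-- Tuples of square matrices of sizes `d k × d k`. -/
abbrev Factors {L : ℕ} (d : Fin L → ℕ) : Type := ∀ k, Matrix (Fin (d k)) (Fin (d k)) ℝ

section Kron

variable {L : ℕ} {d : Fin L → ℕ}

/-- The Kronecker product `A 0 ⊗ ⋯ ⊗ A (L - 1)`. -/
def kronProd (A : Factors d) : Matrix (Idx d) (Idx d) ℝ :=
  Matrix.of fun i j => ∏ k, A k (i k) (j k)

/-- The Kronecker sum `∑ k, I ⊗ ⋯ ⊗ I ⊗ B k ⊗ I ⊗ ⋯ ⊗ I`. -/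
def kronSum (B : Factors d) : Matrix (Idx d) (Idx d) ℝ :=
  ∑ k, kronProd (Function.update (fun _ => 1) k (B k))

/-- `m k`, the product of all `d i` with `i ≠ k`. -/
def coDim (d : Fin L → ℕ) (k : Fin L) : ℕ := ∏ i ∈ Finset.univ.erase k, d i

/-- The penalized negative log-likelihood
`-log |Ω| + ⟨S, Ω⟩ + ∑ k, m k * ρ k * |B k|_{1,off}` at `Ω = kronSum B`.
The off-diagonal entries of the factors are determined by `Ω`, so this is a function of `Ω`. -/
def objective (S : Matrix (Idx d) (Idx d) ℝ) (ρ : Fin L → ℝ) (B : Factors d) : ℝ :=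
  -Real.log (kronSum B).det + (S.transpose * kronSum B).trace
    + ∑ k, (coDim d k : ℝ) * ρ k * offOne (B k)

/-- `A` minimizes the objective over the positive definite Kronecker sums. -/
def IsTeraLasso (S : Matrix (Idx d) (Idx d) ℝ) (ρ : Fin L → ℝ)
    (A : Matrix (Idx d) (Idx d) ℝ) : Prop :=
  A.PosDef ∧ ∃ B : Factors d, A = kronSum B ∧
    ∀ B' : Factors d, (kronSum B').PosDef → objective S ρ B ≤ objective S ρ B'

end Kron

/-! ### Probability -/

/-- The sub-gaussian norm `inf {t > 0 : E exp (Z² / t²) ≤ 2}`, equal to `∞` if there is no such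
`t`. -/
def psi2Norm {S : Type*} [MeasurableSpace S] (P : Measure S) (Z : S → ℝ) : ℝ≥0∞ :=
  ⨅ (t : ℝ) (_ : 0 < t) (_ : ∫⁻ ω, ENNReal.ofReal (Real.exp (Z ω ^ 2 / t ^ 2)) ∂P ≤ 2),
    ENNReal.ofReal t

/-- `X = O_P(a)` along the filter `l`, for random variables `X i` that may live on different
probability spaces. -/
def IsBigOP {ι : Type*} (l : Filter ι) {S : ι → Type*} [∀ i, MeasurableSpace (S i)]
    (P : ∀ i, Measure (S i)) (X : ∀ i, S i → ℝ) (a : ι → ℝ) : Prop :=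
  ∀ η : ℝ, 0 < η → ∃ M : ℝ, 0 < M ∧
    ∀ᶠ i in l, P i {ω | M * a i < |X i ω|} ≤ ENNReal.ofReal η

/-- One observation of a sub-gaussian random tensor whose precision matrix is the Kronecker sum of
the matrices `Ψ k`, built from independent standardized variables `Z j` with sub-gaussian norms at
most `C₀`. -/
structure TensorModel (C₀ : ℝ) where
  /-- number of modes -/
  L : ℕ
  /-- dimensions of the modes -/
  d : Fin L → ℕ
  d_pos : ∀ k, 0 < d k
  Ψ : Factors d
  posDef : (kronSum Ψ).PosDef
  /-- sample space -/
  S : Type u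
  [mS : MeasurableSpace S]
  P : Measure S
  [isProb : IsProbabilityMeasure P]
  Z : Idx d → S → ℝ
  measurable_Z : ∀ j, Measurable (Z j)
  indep_Z : iIndepFun Z P
  mean_Z : ∀ j, ∫ ω, Z j ω ∂P = 0
  var_Z : ∀ j, ∫ ω, Z j ω ^ 2 ∂P = 1
  psi2_Z : ∀ j, psi2Norm P (Z j) ≤ ENNReal.ofReal C₀

attribute [instance] TensorModel.mS TensorModel.isProb

namespace TensorModel

variable {C₀ : ℝ} (T : TensorModel.{u} C₀)

/-- The precision matrix `Omega0 = Ψ 0 ⊕ ⋯ ⊕ Ψ (L - 1)`. -/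
def Omega0 : Matrix (Idx T.d) (Idx T.d) ℝ := kronSum T.Ψ

/-- The covariance matrix. -/
def Sigma0 : Matrix (Idx T.d) (Idx T.d) ℝ := T.Omega0⁻¹

/-- The (vectorized) observed tensor `Sigma0^{1/2} Z`. -/
def X (ω : T.S) : Idx T.d → ℝ := (matSqrt T.Sigma0).mulVec fun j => T.Z j ω

/-- The sample covariance `vec(X) vec(X)ᵀ` of the single observation. -/
def Shat (ω : T.S) : Matrix (Idx T.d) (Idx T.d) ℝ := Matrix.vecMulVec (T.X ω) (T.X ω)

/-- The total dimension. -/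
def p : ℕ := ∏ k, T.d k

/-- `m k = p / d k`. -/
def m (k : Fin T.L) : ℕ := coDim T.d k

def mMin : ℕ := ⨅ k, T.m k

def dMax : ℕ := ⨆ k, T.d k

/-- The number `s k` of nonzero off-diagonal entries of `Ψ k`. -/
def s (k : Fin T.L) : ℕ := offSupportCard (T.Ψ k)

/-- `∑ k, s k`. -/
def sSum : ℕ := ∑ k, T.s k

/-- `s = ∑ k, m k * s k`. -/
def sTot : ℕ := ∑ k, T.m k * T.s k

/-- Assumption (A1) with sample size one: `min m k ≥ log p`,
`cδ ≤ δ k / (‖Sigma0‖ (log p / m k)^{1/2}) ≤ Cδ`, and `ρ k = δ k / ε k` with `ε₀ ≤ ε k < 1`. -/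
def A1 (cδ Cδ ε₀ : ℝ) (δ ε ρ : Fin T.L → ℝ) : Prop :=
  Real.log T.p ≤ T.mMin ∧
  ∀ k, cδ * (opNorm T.Sigma0 * Real.sqrt (Real.log T.p / T.m k)) ≤ δ k ∧
    δ k ≤ Cδ * (opNorm T.Sigma0 * Real.sqrt (Real.log T.p / T.m k)) ∧
    ε₀ ≤ ε k ∧ ε k < 1 ∧ ρ k = δ k / ε k

/-- Assumption (A2): eigenvalue bounds. -/
def A2 (klow kup : ℝ) : Prop :=
  0 < klow ∧ klow ≤ phiMin T.Omega0 ∧ phiMax T.Omega0 ≤ kup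

/-- Assumption (A3) with sample size one. -/
def A3 (C : ℝ) : Prop :=
  C ^ 2 * (T.L + 1) * condNum T.Sigma0 ^ 4 * (T.sTot * Real.log T.p + T.L * T.p)
    ≤ (T.mMin : ℝ) ^ 2

end TensorModel

end TeraLasso

end

/-! The objective is convex along segments from Ω₀, so it is enough to find a radius r such that it
exceeds its value at Ω₀ on the Frobenius sphere of radius r around Ω₀ inside the space of Kronecker
sums. Minimizers then exist and all lie within r.

Deterministic part. Let f(M) = ⟨Ŝ − Σ₀, M⟩ (`score`). The negative log-determinant exceeds its
linearization by ‖M‖_F²/(4‖Ω₀‖²) when ‖Σ₀‖‖M‖ ≤ 1/5 (`posDef_add_and_logDet_bound`). On the event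
`ScoreBound`, f is of size α on unit diagonal directions, and on off-diagonal directions it is
dominated by the penalty, so f plus the change of penalty is at least −(α + 2β√(∑ s_k))‖M‖_F
(`ScoreBound.score_add_penalty_ge`). The quadratic gain beats the linear loss at a radius r of order
κ‖Ω₀‖(∑ s_k log p + L d_max)^{1/2}.

Kronecker structure replaces replication. Separating the trace and centring the factors makes the
modes orthogonal, and mode k carries weight m_k in the squared Frobenius norm. Hence ‖M‖² ≤
(L+1)‖M‖_F²/m_min for every Kronecker sum (`opNorm_kronSum_sq_le`). With (A3) this makes the sphere
small in operator norm, it keeps the quadratic forms below in their sub-gaussian range, and it turns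
the Frobenius rate into the spectral one.

Probabilistic part. f(M) is a centred quadratic form in Z. A Hanson–Wright inequality
(`measure_quadForm_ge_le`), proved by decoupling and Gaussian linearization, is combined with a
union bound over the off-diagonal units and with a lattice net for the diagonal directions, which
have only ∑ d_k + 1 parameters. The event fails with probability at most 4/p.

In the balanced case d_max is of order p^{1/L}. Ω₀ is itself a Kronecker sum, so the norm comparison
also bounds ‖Ω₀‖ by ‖Ω₀‖_F and gives the relative Frobenius rate. -/

noncomputable section

namespace TeraLasso

/-! ### Scalar exponential bounds -/

/-- Against a centred law the linear term integrates to zero, which leaves an exponential moment of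
the square. -/
lemma exp_le_add_exp_sq (x : ℝ) : Real.exp x ≤ x + Real.exp (x ^ 2) := by
  rcases le_or_gt |x| 1 with h | h
  · have h1 := abs_le.1 (Real.abs_exp_sub_one_sub_id_le h)
    have h2 := Real.add_one_le_exp (x ^ 2)
    linarith [h1.2]
  · rcases lt_abs.1 h with h | h
    · have : Real.exp x ≤ Real.exp (x ^ 2) := Real.exp_le_exp.2 (by nlinarith)
      linarith
    · have h1 : Real.exp x ≤ 1 := Real.exp_le_one_iff.2 (by linarith)
      have h2 := Real.add_one_le_exp (x ^ 2)
      nlinarith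

/-- The second-order counterpart for centred squares: the explicit factor x² makes the resulting
bound quadratic in the multiplier. -/
lemma exp_le_quadratic (x : ℝ) : Real.exp x ≤ 1 + x + x ^ 2 * Real.exp |x| := by
  have h0 : 1 ≤ Real.exp |x| := Real.one_le_exp (abs_nonneg x)
  have h4 : x ^ 2 ≤ x ^ 2 * Real.exp |x| := le_mul_of_one_le_right (sq_nonneg x) h0
  rcases le_or_gt |x| 1 with h | h
  · have h1 := abs_le.1 (Real.abs_exp_sub_one_sub_id_le h)
    linarith [h1.2]
  · rcases lt_abs.1 h with h | h
    · rw [abs_of_pos (by linarith)]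
      have : Real.exp x ≤ x ^ 2 * Real.exp x :=
        le_mul_of_one_le_left (Real.exp_pos x).le (by nlinarith)
      linarith
    · have h1 : Real.exp x ≤ 1 := Real.exp_le_one_iff.2 (by linarith)
      nlinarith

/-- The chord of the exponential from 0 to y. It scales a moment bound at one exponent down to
smaller exponents with a gain proportional to θ. -/
lemma exp_mul_le_of_le_one {θ : ℝ} (h0 : 0 ≤ θ) (h1 : θ ≤ 1) (y : ℝ) :
    Real.exp (θ * y) ≤ 1 + θ * (Real.exp y - 1) := by
  have := convexOn_exp.2 (Set.mem_univ y) (Set.mem_univ 0) h0 (sub_nonneg.2 h1) (by ring)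
  simp only [smul_eq_mul, mul_zero, add_zero, Real.exp_zero, mul_one] at this
  linarith

lemma lintegral_ofReal_le_of_le {S : Type*} [MeasurableSpace S] {P : Measure S} {f g : S → ℝ}
    {r : ℝ} (hf : ∀ x, 0 ≤ f x) (hfg : ∀ x, f x ≤ g x) (hg : Integrable g P)
    (hr : ∫ x, g x ∂P ≤ r) :
    ∫⁻ x, ENNReal.ofReal (f x) ∂P ≤ ENNReal.ofReal r := by
  calc ∫⁻ x, ENNReal.ofReal (f x) ∂P ≤ ∫⁻ x, ENNReal.ofReal (g x) ∂P :=
        lintegral_mono fun x => ENNReal.ofReal_le_ofReal (hfg x)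
    _ = ENNReal.ofReal (∫ x, g x ∂P) :=
        (ofReal_integral_eq_lintegral_ofReal hg (ae_of_all _ fun x => (hf x).trans (hfg x))).symm
    _ ≤ _ := ENNReal.ofReal_le_ofReal hr

lemma integrable_and_integral_le {S : Type*} [MeasurableSpace S] {P : Measure S} {f : S → ℝ}
    (hm : Measurable f) (hf : ∀ x, 0 ≤ f x) {r : ℝ} (hr : 0 ≤ r)
    (h : ∫⁻ x, ENNReal.ofReal (f x) ∂P ≤ ENNReal.ofReal r) :
    Integrable f P ∧ ∫ x, f x ∂P ≤ r := by
  have hi : Integrable f P := by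
    refine ⟨hm.aestronglyMeasurable, ?_⟩
    rw [hasFiniteIntegral_iff_ofReal (ae_of_all _ hf)]
    exact h.trans_lt ENNReal.ofReal_lt_top
  refine ⟨hi, ?_⟩
  rw [← ofReal_integral_eq_lintegral_ofReal hi (ae_of_all _ hf)] at h
  exact (ENNReal.ofReal_le_ofReal_iff hr).1 h

lemma integrable_affine_comp {S : Type*} [MeasurableSpace S] {P : Measure S}
    [IsProbabilityMeasure P] {f : S → ℝ} (hf : Integrable f P) (α β γ : ℝ) :
    Integrable (fun x => α + β * (f x - γ)) P ∧
      ∫ x, (α + β * (f x - γ)) ∂P = α + β * (∫ x, f x ∂P - γ) := by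
  have h1 : Integrable (fun x => f x - γ) P := hf.sub (integrable_const _)
  have h2 : Integrable (fun x => β * (f x - γ)) P := h1.const_mul _
  refine ⟨(integrable_const _).add h2, ?_⟩
  rw [integral_add (integrable_const _) h2, integral_const_mul,
    integral_sub hf (integrable_const _)]
  simp

/-! ### Sub-gaussian laws on the line -/

/-- A standardized law on the line with `∫ exp (a x²) ≤ 2`. -/
structure IsSubgaussianLaw (a : ℝ) (ν : Measure ℝ) : Prop where
  isProb : IsProbabilityMeasure ν
  mean : ∫ x, x ∂ν = 0
  var : ∫ x, x ^ 2 ∂ν = 1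
  exp_sq : ∫⁻ x, ENNReal.ofReal (Real.exp (a * x ^ 2)) ∂ν ≤ 2

namespace IsSubgaussianLaw

variable {a : ℝ} {ν : Measure ℝ}

lemma integrable_exp_sq (h : IsSubgaussianLaw a ν) :
    Integrable (fun x => Real.exp (a * x ^ 2)) ν ∧ ∫ x, Real.exp (a * x ^ 2) ∂ν ≤ 2 :=
  integrable_and_integral_le (by fun_prop) (fun _ => (Real.exp_pos _).le) zero_le_two
    (by simpa using h.exp_sq)

lemma integrable_sq (h : IsSubgaussianLaw a ν) : Integrable (fun x => x ^ 2) ν := by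
  by_contra hc
  have := h.var
  rw [integral_undef hc] at this
  exact zero_ne_one this

lemma integrable_id (h : IsSubgaussianLaw a ν) : Integrable (fun x => x) ν := by
  have := h.isProb
  refine ((integrable_const (1 : ℝ)).add h.integrable_sq).mono' (by fun_prop)
    (ae_of_all _ fun x => ?_)
  simp only [Real.norm_eq_abs, Pi.add_apply]
  rw [← sq_abs x]
  nlinarith [sq_nonneg (|x| - 1), abs_nonneg x]

lemma lintegral_exp_mul_le (h : IsSubgaussianLaw a ν) (ha : 0 < a) (c : ℝ) :
    ∫⁻ x, ENNReal.ofReal (Real.exp (c * x)) ∂ν ≤ ENNReal.ofReal (Real.exp (c ^ 2 / a)) := by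
  have := h.isProb
  obtain ⟨hi, h2⟩ := h.integrable_exp_sq
  rcases le_or_gt (c ^ 2) a with hc | hc
  · have hca : c ^ 2 / a ≤ 1 := (div_le_one ha).2 hc
    refine lintegral_ofReal_le_of_le
      (g := fun x => c * x + (1 + c ^ 2 / a * (Real.exp (a * x ^ 2) - 1)))
      (fun _ => (Real.exp_pos _).le) (fun x => ?_) ?_ ?_
    · refine (exp_le_add_exp_sq _).trans ?_
      have := exp_mul_le_of_le_one (by positivity) hca (a * x ^ 2)
      rw [show c ^ 2 / a * (a * x ^ 2) = (c * x) ^ 2 by field_simp] at this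
      linarith
    · exact (h.integrable_id.const_mul c).add (integrable_affine_comp hi _ _ _).1
    · rw [integral_add (h.integrable_id.const_mul c) (integrable_affine_comp hi _ _ _).1,
        integral_const_mul, (integrable_affine_comp hi _ _ _).2, h.mean]
      have h3 := Real.add_one_le_exp (c ^ 2 / a)
      have h4 : c ^ 2 / a * (∫ x, Real.exp (a * x ^ 2) ∂ν - 1) ≤ c ^ 2 / a * 1 :=
        mul_le_mul_of_nonneg_left (by linarith) (by positivity)
      linarith
  -- For large c, cx ≤ c²/(2a) + ax²/2, and the remaining factor is at most 3/2 ≤ exp(c²/(2a))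
  -- because c²/a > 1.
  · refine lintegral_ofReal_le_of_le
      (g := fun x => Real.exp (c ^ 2 / a / 2) * (1 / 2 + 1 / 2 * Real.exp (a * x ^ 2)))
      (fun _ => (Real.exp_pos _).le) (fun x => ?_) ?_ ?_
    · have h1 := exp_mul_le_of_le_one (θ := 1 / 2) (by norm_num) (by norm_num) (a * x ^ 2)
      calc Real.exp (c * x) ≤ Real.exp (c ^ 2 / a / 2 + 1 / 2 * (a * x ^ 2)) := by
            apply Real.exp_le_exp.2
            have : c ^ 2 / a / 2 + 1 / 2 * (a * x ^ 2) - c * x = (c - a * x) ^ 2 / a / 2 := by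
              field_simp; ring
            have : 0 ≤ (c - a * x) ^ 2 / a / 2 := by positivity
            linarith
        _ = Real.exp (c ^ 2 / a / 2) * Real.exp (1 / 2 * (a * x ^ 2)) := Real.exp_add _ _
        _ ≤ _ := by
            apply mul_le_mul_of_nonneg_left _ (Real.exp_pos _).le
            linarith
    · exact ((integrable_const _).add (hi.const_mul _)).const_mul _
    · rw [integral_const_mul, integral_add (integrable_const _) (hi.const_mul _),
        integral_const_mul]
      simp only [integral_const, probReal_univ, smul_eq_mul, one_mul]
      have h3 := Real.add_one_le_exp (c ^ 2 / a / 2)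
      have h4 : 1 < c ^ 2 / a := (one_lt_div ha).2 hc
      calc _ ≤ Real.exp (c ^ 2 / a / 2) * Real.exp (c ^ 2 / a / 2) := by
            apply mul_le_mul_of_nonneg_left _ (Real.exp_pos _).le
            linarith
        _ = _ := by rw [← Real.exp_add]; ring_nf

/-- The constant in the exponential moment bound for centered squares. -/
def sqConst (a : ℝ) : ℝ := 2 * ((8 / a ^ 2 + 1) * Real.exp (a / 2))

/-- The mean of x² − 1 vanishes, so only the quadratic remainder counts. Half of the moment exp(ax²)
pays for the polynomial factor, the other half for the exponential one. -/
lemma lintegral_exp_mul_sq_sub_one_le (h : IsSubgaussianLaw a ν) (ha : 0 < a) {b : ℝ}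
    (hb : |b| ≤ a / 2) :
    ∫⁻ x, ENNReal.ofReal (Real.exp (b * (x ^ 2 - 1))) ∂ν
      ≤ ENNReal.ofReal (Real.exp (sqConst a * b ^ 2)) := by
  have := h.isProb
  obtain ⟨hi, h2⟩ := h.integrable_exp_sq
  have hs := h.integrable_sq
  set A := (8 / a ^ 2 + 1) * Real.exp (a / 2) with hA
  have hA0 : 0 ≤ A := by positivity
  refine lintegral_ofReal_le_of_le
    (g := fun x => (1 + b * (x ^ 2 - 1)) + b ^ 2 * A * Real.exp (a * x ^ 2))
    (fun _ => (Real.exp_pos _).le) (fun x => ?_) ?_ ?_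
  · refine (exp_le_quadratic _).trans ?_
    have hy : 0 ≤ x ^ 2 := sq_nonneg x
    set y := x ^ 2
    -- From u²/2 ≤ eᵘ at u = ay/2.
    have e1 : y ^ 2 ≤ 8 / a ^ 2 * Real.exp (a * y / 2) := by
      have := Real.quadratic_le_exp_of_nonneg (x := a * y / 2) (by positivity)
      rw [div_mul_eq_mul_div, le_div_iff₀ (by positivity)]
      have : 0 ≤ a * y / 2 := by positivity
      nlinarith
    have e2 : 1 ≤ Real.exp (a * y / 2) := Real.one_le_exp (by positivity)
    have e3 : (y - 1) ^ 2 ≤ (8 / a ^ 2 + 1) * Real.exp (a * y / 2) := by nlinarith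
    have e4 : Real.exp |b * (y - 1)| ≤ Real.exp (a / 2) * Real.exp (a * y / 2) := by
      rw [← Real.exp_add]
      apply Real.exp_le_exp.2
      rw [abs_mul]
      have : |y - 1| ≤ 1 + y := abs_le.2 ⟨by linarith, by linarith⟩
      calc |b| * |y - 1| ≤ a / 2 * (1 + y) := by gcongr
        _ = _ := by ring
    have e5 : (y - 1) ^ 2 * Real.exp |b * (y - 1)| ≤ A * Real.exp (a * y) := by
      calc _ ≤ (8 / a ^ 2 + 1) * Real.exp (a * y / 2) *
            (Real.exp (a / 2) * Real.exp (a * y / 2)) := by gcongr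
        _ = A * (Real.exp (a * y / 2) * Real.exp (a * y / 2)) := by rw [hA]; ring
        _ = _ := by rw [← Real.exp_add]; ring_nf
    have e6 := mul_le_mul_of_nonneg_left e5 (sq_nonneg b)
    have : (b * (y - 1)) ^ 2 * Real.exp |b * (y - 1)| ≤ b ^ 2 * A * Real.exp (a * y) := by
      rw [mul_pow]; linarith
    linarith
  · exact (integrable_affine_comp hs _ _ _).1.add (hi.const_mul _)
  · rw [integral_add (integrable_affine_comp hs _ _ _).1 (hi.const_mul _), integral_const_mul,
      (integrable_affine_comp hs _ _ _).2, h.var]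
    have h3 := Real.add_one_le_exp (sqConst a * b ^ 2)
    have h4 : b ^ 2 * A * ∫ x, Real.exp (a * x ^ 2) ∂ν ≤ b ^ 2 * A * 2 :=
      mul_le_mul_of_nonneg_left h2 (by positivity)
    have h5 : sqConst a = 2 * A := rfl
    rw [h5] at h3 ⊢
    linarith

end IsSubgaussianLaw

/-! ### Gaussian integrals -/

lemma lintegral_exp_mul_gaussian (t : ℝ) :
    ∫⁻ x, ENNReal.ofReal (Real.exp (t * x)) ∂(gaussianReal 0 1)
      = ENNReal.ofReal (Real.exp (t ^ 2 / 2)) := by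
  have h := mgf_gaussianReal (p := gaussianReal 0 1) (X := id) (μ := 0) (v := 1)
    (by simp) t
  have hi := integrable_exp_mul_gaussianReal (μ := 0) (v := 1) t
  rw [← ofReal_integral_eq_lintegral_ofReal hi (ae_of_all _ fun _ => (Real.exp_pos _).le)]
  simp only [mgf, id] at h
  rw [h]
  simp

lemma lintegral_exp_sq_gaussian :
    ∫⁻ x, ENNReal.ofReal (Real.exp (x ^ 2 / 4)) ∂(gaussianReal 0 1)
      = ENNReal.ofReal (Real.sqrt 2) := by
  rw [gaussianReal_of_var_ne_zero _ one_ne_zero,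
    lintegral_withDensity_eq_lintegral_mul _ (measurable_gaussianPDF 0 1) (by fun_prop)]
  have h1 : ∀ x : ℝ, (gaussianPDF 0 1 * fun x => ENNReal.ofReal (Real.exp (x ^ 2 / 4))) x
      = ENNReal.ofReal ((Real.sqrt (2 * Real.pi))⁻¹ * Real.exp (-(1 / 4) * x ^ 2)) := by
    intro x
    simp only [Pi.mul_apply, gaussianPDF]
    rw [← ENNReal.ofReal_mul (gaussianPDFReal_nonneg _ _ _), gaussianPDFReal]
    simp only [NNReal.coe_one, mul_one, sub_zero]
    rw [mul_assoc, ← Real.exp_add]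
    ring_nf
  simp_rw [h1]
  rw [← ofReal_integral_eq_lintegral_ofReal
    ((integrable_exp_neg_mul_sq (by norm_num)).const_mul _)
    (ae_of_all _ fun _ => by positivity), integral_const_mul, integral_gaussian]
  congr 1
  rw [← Real.sqrt_inv, ← Real.sqrt_mul (by positivity)]
  congr 1
  field_simp
  norm_num

/-- The value √2 ≤ 3/2 at exponent 1/4 is scaled down along the chord with weight 4θ, which gives 1
+ 2θ. -/
lemma lintegral_exp_mul_sq_gaussian_le {θ : ℝ} (h0 : 0 ≤ θ) (h1 : θ ≤ 1 / 4) :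
    ∫⁻ x, ENNReal.ofReal (Real.exp (θ * x ^ 2)) ∂(gaussianReal 0 1)
      ≤ ENNReal.ofReal (Real.exp (2 * θ)) := by
  obtain ⟨hi, h2⟩ := integrable_and_integral_le (P := gaussianReal 0 1)
    (f := fun x => Real.exp (x ^ 2 / 4)) (by fun_prop)
    (fun _ => (Real.exp_pos _).le) (Real.sqrt_nonneg 2) lintegral_exp_sq_gaussian.le
  refine lintegral_ofReal_le_of_le (g := fun x => 1 + 4 * θ * (Real.exp (x ^ 2 / 4) - 1))
    (fun _ => (Real.exp_pos _).le) (fun x => ?_) ?_ ?_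
  · have := exp_mul_le_of_le_one (θ := 4 * θ) (by positivity) (by linarith) (x ^ 2 / 4)
    rwa [show 4 * θ * (x ^ 2 / 4) = θ * x ^ 2 by ring] at this
  · exact (integrable_affine_comp hi _ _ _).1
  · rw [(integrable_affine_comp hi _ _ _).2]
    have h3 := Real.add_one_le_exp (2 * θ)
    have h4 : Real.sqrt 2 ≤ 3 / 2 := by
      rw [Real.sqrt_le_left (by norm_num)]; norm_num
    have : 4 * θ * (∫ x, Real.exp (x ^ 2 / 4) ∂(gaussianReal 0 1) - 1) ≤ 4 * θ * (1 / 2) :=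
      mul_le_mul_of_nonneg_left (by linarith) (by positivity)
    linarith

/-! ### Product measures -/

section Pi

variable {ι : Type*} [Fintype ι] {ν : ι → Measure ℝ}

lemma lintegral_pi_prod (hν : ∀ i, IsProbabilityMeasure (ν i)) (f : ι → ℝ → ℝ≥0∞)
    (hf : ∀ i, Measurable (f i)) :
    ∫⁻ z, ∏ i, f i (z i) ∂(Measure.pi ν) = ∏ i, ∫⁻ x, f i x ∂(ν i) := by
  have hind : iIndepFun (fun i (z : ι → ℝ) => f i (z i)) (Measure.pi ν) :=
    iIndepFun_pi (fun i => (hf i).aemeasurable)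
  rw [lintegral_prod_eq_prod_lintegral_of_indepFun Finset.univ _ hind
    (fun i => (hf i).comp (measurable_pi_apply i))]
  refine Finset.prod_congr rfl fun i _ => ?_
  exact (measurePreserving_eval ν i).lintegral_comp (hf i)

lemma lintegral_pi_exp_sum (hν : ∀ i, IsProbabilityMeasure (ν i)) (f : ι → ℝ → ℝ)
    (hf : ∀ i, Measurable (f i)) (r : ι → ℝ)
    (h : ∀ i, ∫⁻ x, ENNReal.ofReal (Real.exp (f i x)) ∂(ν i) ≤ ENNReal.ofReal (Real.exp (r i))) :
    ∫⁻ z, ENNReal.ofReal (Real.exp (∑ i, f i (z i))) ∂(Measure.pi ν)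
      ≤ ENNReal.ofReal (Real.exp (∑ i, r i)) := by
  have h1 : ∀ z : ι → ℝ, ENNReal.ofReal (Real.exp (∑ i, f i (z i)))
      = ∏ i, ENNReal.ofReal (Real.exp (f i (z i))) := fun z => by
    rw [Real.exp_sum, ENNReal.ofReal_prod_of_nonneg fun _ _ => (Real.exp_pos _).le]
  simp_rw [h1]
  rw [lintegral_pi_prod hν (fun i x => ENNReal.ofReal (Real.exp (f i x)))
    (fun i => by have := hf i; fun_prop), Real.exp_sum,
    ENNReal.ofReal_prod_of_nonneg fun _ _ => (Real.exp_pos _).le]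
  exact Finset.prod_le_prod' fun i _ => h i

lemma lintegral_pi_exp_linear (hν : ∀ i, IsProbabilityMeasure (ν i)) {κ : ℝ}
    (h : ∀ i c, ∫⁻ x, ENNReal.ofReal (Real.exp (c * x)) ∂(ν i)
      ≤ ENNReal.ofReal (Real.exp (κ * c ^ 2))) (w : ι → ℝ) :
    ∫⁻ z, ENNReal.ofReal (Real.exp (∑ i, w i * z i)) ∂(Measure.pi ν)
      ≤ ENNReal.ofReal (Real.exp (κ * ∑ i, w i ^ 2)) := by
  have := lintegral_pi_exp_sum hν (fun i x => w i * x) (fun i => by fun_prop)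
    (fun i => κ * w i ^ 2) (fun i => h i (w i))
  rwa [← Finset.mul_sum] at this

/-- Exponential moments of a nonnegative quadratic form in diagonal form, by Gaussian
linearization. -/
lemma lintegral_pi_exp_quadratic (hν : ∀ i, IsProbabilityMeasure (ν i)) {κ : ℝ} (hκ : 0 ≤ κ)
    (h : ∀ i c, ∫⁻ x, ENNReal.ofReal (Real.exp (c * x)) ∂(ν i)
      ≤ ENNReal.ofReal (Real.exp (κ * c ^ 2)))
    {J : Type*} [Fintype J] [DecidableEq J] (e : J → ℝ) (he : ∀ j, 0 ≤ e j)
    (hes : ∀ j, 8 * κ * e j ≤ 1) (w : J → ι → ℝ)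
    (hw : ∀ j k, ∑ i, w j i * w k i = if j = k then 1 else 0) :
    ∫⁻ z, ENNReal.ofReal (Real.exp (∑ j, e j * (∑ i, w j i * z i) ^ 2)) ∂(Measure.pi ν)
      ≤ ENNReal.ofReal (Real.exp (4 * κ * ∑ j, e j)) := by
  set γ : J → Measure ℝ := fun _ => gaussianReal 0 1
  -- Gaussian linearization: exp(u²/2) is the mean of exp(ug) over a standard Gaussian g, used with
  -- u = √(2e_j)·⟨w_j, z⟩.
  have h1 : ∀ z : ι → ℝ,
      ENNReal.ofReal (Real.exp (∑ j, e j * (∑ i, w j i * z i) ^ 2))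
        = ∫⁻ g, ENNReal.ofReal
            (Real.exp (∑ j, (Real.sqrt (2 * e j) * ∑ i, w j i * z i) * g j)) ∂(Measure.pi γ) := by
    intro z
    have h2 : ∀ g : J → ℝ, ENNReal.ofReal
        (Real.exp (∑ j, (Real.sqrt (2 * e j) * ∑ i, w j i * z i) * g j))
        = ∏ j, ENNReal.ofReal
            (Real.exp ((Real.sqrt (2 * e j) * ∑ i, w j i * z i) * g j)) := fun g => by
      rw [Real.exp_sum, ENNReal.ofReal_prod_of_nonneg fun _ _ => (Real.exp_pos _).le]
    simp_rw [h2]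
    rw [lintegral_pi_prod (fun _ => inferInstance) (fun j x => ENNReal.ofReal
            (Real.exp ((Real.sqrt (2 * e j) * ∑ i, w j i * z i) * x))) (fun j => by fun_prop),
      Real.exp_sum, ENNReal.ofReal_prod_of_nonneg fun _ _ => (Real.exp_pos _).le]
    refine Finset.prod_congr rfl fun j _ => ?_
    rw [lintegral_exp_mul_gaussian, mul_pow, Real.sq_sqrt (by have := he j; positivity)]
    ring_nf
  simp_rw [h1]
  -- After Fubini the exponent is linear in z for fixed g. Orthonormality of the w_j then collapses
  -- the bound to a diagonal square form in g.
  rw [lintegral_lintegral_swap (by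
    apply Measurable.aemeasurable
    unfold Function.uncurry
    fun_prop)]
  calc _ ≤ ∫⁻ g, ENNReal.ofReal (Real.exp (∑ j, (2 * κ * e j) * g j ^ 2)) ∂(Measure.pi γ) := by
        refine lintegral_mono fun g => ?_
        have h3 : ∀ z : ι → ℝ, ∑ j, (Real.sqrt (2 * e j) * ∑ i, w j i * z i) * g j
            = ∑ i, (∑ j, Real.sqrt (2 * e j) * g j * w j i) * z i := fun z => by
          simp_rw [Finset.mul_sum, Finset.sum_mul]
          rw [Finset.sum_comm]
          exact Finset.sum_congr rfl fun i _ => Finset.sum_congr rfl fun j _ => by ring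
        simp_rw [h3]
        refine (lintegral_pi_exp_linear hν h _).trans (le_of_eq ?_)
        congr 2
        have h4 : ∑ i, (∑ j, Real.sqrt (2 * e j) * g j * w j i) ^ 2
            = ∑ j, (2 * e j) * g j ^ 2 := by
          simp_rw [sq (∑ j, _), Finset.sum_mul_sum]
          rw [Finset.sum_comm]
          refine Finset.sum_congr rfl fun j _ => ?_
          rw [Finset.sum_comm]
          have : ∀ k, ∑ i, Real.sqrt (2 * e j) * g j * w j i * (Real.sqrt (2 * e k) * g k * w k i)
              = Real.sqrt (2 * e j) * g j * (Real.sqrt (2 * e k) * g k) *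
                if j = k then 1 else 0 := fun k => by
            rw [← hw, Finset.mul_sum]
            exact Finset.sum_congr rfl fun i _ => by ring
          simp_rw [this]
          simp only [mul_ite, mul_one, mul_zero, Finset.sum_ite_eq, Finset.mem_univ, if_true]
          have := Real.mul_self_sqrt (show 0 ≤ 2 * e j by have := he j; positivity)
          linear_combination g j ^ 2 * this
        rw [h4, Finset.mul_sum]
        exact Finset.sum_congr rfl fun j _ => by ring
    -- The condition 8κe_j ≤ 1 says that the exponent 2κe_j stays below 1/4.
    _ ≤ ENNReal.ofReal (Real.exp (∑ j, 2 * (2 * κ * e j))) :=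
        lintegral_pi_exp_sum (fun _ => inferInstance) (fun j x => (2 * κ * e j) * x ^ 2)
          (fun j => by fun_prop) _ fun j =>
            lintegral_exp_mul_sq_gaussian_le (by have := he j; positivity)
              (by have := hes j; linarith)
    _ = _ := by
        rw [Finset.mul_sum]
        congr 2
        exact Finset.sum_congr rfl fun j _ => by ring

end Pi


/-! ### Operator and Frobenius norms -/

section Norms

set_option linter.unusedSectionVars false

variable {n : Type*} [Fintype n] [DecidableEq n]

open scoped Matrix.Norms.L2Operator in
lemma opNorm_eq_norm (A : Matrix n n ℝ) : opNorm A = ‖A‖ := rfl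

lemma opNorm_nonneg (A : Matrix n n ℝ) : 0 ≤ opNorm A := norm_nonneg _

open scoped Matrix.Norms.L2Operator in
lemma opNorm_add_le (A B : Matrix n n ℝ) : opNorm (A + B) ≤ opNorm A + opNorm B := by
  simp only [opNorm_eq_norm]; exact norm_add_le _ _

open scoped Matrix.Norms.L2Operator in
lemma opNorm_sum_le {κ : Type*} (s : Finset κ) (A : κ → Matrix n n ℝ) :
    opNorm (∑ k ∈ s, A k) ≤ ∑ k ∈ s, opNorm (A k) := by
  simp only [opNorm_eq_norm]; exact norm_sum_le _ _

open scoped Matrix.Norms.L2Operator in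
lemma opNorm_mul_le (A B : Matrix n n ℝ) : opNorm (A * B) ≤ opNorm A * opNorm B := by
  simp only [opNorm_eq_norm]; exact norm_mul_le _ _

open scoped Matrix.Norms.L2Operator in
lemma opNorm_smul (c : ℝ) (A : Matrix n n ℝ) : opNorm (c • A) = |c| * opNorm A := by
  simp only [opNorm_eq_norm]; rw [norm_smul, Real.norm_eq_abs]

open scoped Matrix.Norms.L2Operator in
lemma opNorm_transpose (A : Matrix n n ℝ) : opNorm A.transpose = opNorm A := by
  simp only [opNorm_eq_norm]
  rw [← Matrix.conjTranspose_eq_transpose_of_trivial]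
  exact Matrix.l2_opNorm_conjTranspose A

open scoped Matrix.Norms.L2Operator in
lemma opNorm_transpose_mul_self (A : Matrix n n ℝ) : opNorm (A.transpose * A) = opNorm A ^ 2 := by
  simp only [opNorm_eq_norm]
  rw [← Matrix.conjTranspose_eq_transpose_of_trivial, Matrix.l2_opNorm_conjTranspose_mul_self, sq]

lemma euclidean_norm_sq (x : n → ℝ) : ‖WithLp.toLp 2 x‖ ^ 2 = ∑ i, x i ^ 2 := by
  rw [EuclideanSpace.norm_sq_eq]
  simp

lemma sum_sq_mulVec_le (A : Matrix n n ℝ) (x : n → ℝ) :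
    ∑ i, (A.mulVec x) i ^ 2 ≤ opNorm A ^ 2 * ∑ i, x i ^ 2 := by
  have h := (Matrix.toEuclideanCLM (n := n) (𝕜 := ℝ) A).le_opNorm (WithLp.toLp 2 x)
  rw [Matrix.toEuclideanCLM_toLp] at h
  have h2 := pow_le_pow_left₀ (norm_nonneg _) h 2
  rwa [mul_pow, euclidean_norm_sq, euclidean_norm_sq] at h2

lemma opNorm_le_of_sum_sq {A : Matrix n n ℝ} {c : ℝ} (hc : 0 ≤ c)
    (h : ∀ x : n → ℝ, ∑ i, (A.mulVec x) i ^ 2 ≤ c ^ 2 * ∑ i, x i ^ 2) : opNorm A ≤ c := by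
  refine ContinuousLinearMap.opNorm_le_bound _ hc fun x => ?_
  have h1 := h (WithLp.ofLp x)
  rw [← euclidean_norm_sq, ← euclidean_norm_sq, ← mul_pow] at h1
  exact (pow_le_pow_iff_left₀ (norm_nonneg _) (by positivity) two_ne_zero).1 h1

lemma opNorm_one_le : opNorm (1 : Matrix n n ℝ) ≤ 1 :=
  opNorm_le_of_sum_sq zero_le_one fun x => by simp

lemma frobNorm_sq (A : Matrix n n ℝ) : frobNorm A ^ 2 = ∑ i, ∑ j, A i j ^ 2 :=
  Real.sq_sqrt (by positivity)

lemma frobNorm_nonneg (A : Matrix n n ℝ) : 0 ≤ frobNorm A := Real.sqrt_nonneg _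

lemma frobNorm_transpose (A : Matrix n n ℝ) : frobNorm A.transpose = frobNorm A := by
  unfold frobNorm
  rw [Finset.sum_comm]
  rfl

lemma frobNorm_smul (c : ℝ) (A : Matrix n n ℝ) : frobNorm (c • A) = |c| * frobNorm A := by
  unfold frobNorm
  rw [← Real.sqrt_sq_eq_abs, ← Real.sqrt_mul (sq_nonneg c)]
  congr 1
  simp_rw [Finset.mul_sum]
  simp [mul_pow]

lemma frobNorm_mul_le (A B : Matrix n n ℝ) : frobNorm (A * B) ≤ opNorm A * frobNorm B := by
  refine (pow_le_pow_iff_left₀ (frobNorm_nonneg _)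
    (mul_nonneg (opNorm_nonneg _) (frobNorm_nonneg _)) two_ne_zero).1 ?_
  rw [mul_pow, frobNorm_sq, frobNorm_sq, Finset.sum_comm,
    Finset.sum_comm (f := fun i j => B i j ^ 2), Finset.mul_sum]
  exact Finset.sum_le_sum fun j _ => sum_sq_mulVec_le A fun i => B i j

lemma frobNorm_mul_le' (A B : Matrix n n ℝ) : frobNorm (A * B) ≤ frobNorm A * opNorm B := by
  rw [← frobNorm_transpose, Matrix.transpose_mul, mul_comm, ← opNorm_transpose,
    ← frobNorm_transpose A]
  exact frobNorm_mul_le _ _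

lemma opNorm_le_frobNorm (A : Matrix n n ℝ) : opNorm A ≤ frobNorm A := by
  refine opNorm_le_of_sum_sq (frobNorm_nonneg A) fun x => ?_
  rw [frobNorm_sq, Finset.sum_mul]
  exact Finset.sum_le_sum fun i _ => Finset.sum_mul_sq_le_sq_mul_sq _ _ _

/-! ### Spectral decomposition of symmetric matrices -/

lemma transpose_eq_of_isHermitian {A : Matrix n n ℝ} (hA : A.IsHermitian) : A.transpose = A := by
  rw [← Matrix.conjTranspose_eq_transpose_of_trivial]; exact hA

lemma eigenvectorBasis_sum_mul {A : Matrix n n ℝ} (hA : A.IsHermitian) (j k : n) :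
    ∑ i, hA.eigenvectorBasis j i * hA.eigenvectorBasis k i = if j = k then 1 else 0 := by
  have := (orthonormal_iff_ite.1 hA.eigenvectorBasis.orthonormal) j k
  rw [← this, PiLp.inner_apply]
  simp [mul_comm]

lemma apply_eq_sum_eigenvalues {A : Matrix n n ℝ} (hA : A.IsHermitian) (a b : n) :
    A a b = ∑ j, hA.eigenvalues j * hA.eigenvectorBasis j a * hA.eigenvectorBasis j b := by
  conv_lhs => rw [hA.spectral_theorem]
  rw [Unitary.conjStarAlgAut_apply, Matrix.mul_apply]
  refine Finset.sum_congr rfl fun j _ => ?_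
  rw [Matrix.mul_diagonal, Matrix.star_apply]
  simp only [Matrix.IsHermitian.eigenvectorUnitary_apply, Function.comp_apply, star_trivial,
    RCLike.ofReal_real_eq_id, id]
  ring

lemma quadForm_eq_sum_eigenvalues {A : Matrix n n ℝ} (hA : A.IsHermitian) (x : n → ℝ) :
    ∑ a, ∑ b, x a * A a b * x b
      = ∑ j, hA.eigenvalues j * (∑ a, hA.eigenvectorBasis j a * x a) ^ 2 := by
  have h : ∀ a b, x a * A a b * x b = ∑ j, hA.eigenvalues j *
      ((hA.eigenvectorBasis j a * x a) * (hA.eigenvectorBasis j b * x b)) := fun a b => by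
    rw [apply_eq_sum_eigenvalues hA, Finset.mul_sum, Finset.sum_mul]
    exact Finset.sum_congr rfl fun j _ => by ring
  simp_rw [h, sq, Finset.sum_mul_sum, Finset.mul_sum]
  rw [Finset.sum_congr rfl fun a _ => Finset.sum_comm, Finset.sum_comm]

lemma frobNorm_sq_eq_sum_eigenvalues {A : Matrix n n ℝ} (hA : A.IsHermitian) :
    frobNorm A ^ 2 = ∑ j, hA.eigenvalues j ^ 2 := by
  have h1 : frobNorm A ^ 2 = (A * A).trace := by
    rw [frobNorm_sq, Matrix.trace]
    refine Finset.sum_congr rfl fun i _ => ?_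
    rw [Matrix.diag_apply, Matrix.mul_apply]
    refine Finset.sum_congr rfl fun j _ => ?_
    rw [sq]
    congr 1
    exact (congr_fun (congr_fun (transpose_eq_of_isHermitian hA) j) i)
  rw [h1]
  conv_lhs => rw [hA.spectral_theorem]
  rw [← map_mul, Unitary.conjStarAlgAut_apply, Matrix.trace_mul_cycle,
    Unitary.coe_star_mul_self, one_mul, Matrix.diagonal_mul_diagonal, Matrix.trace_diagonal]
  simp [sq]

lemma trace_eq_sum_eigenvalues' {A : Matrix n n ℝ} (hA : A.IsHermitian) :
    A.trace = ∑ j, hA.eigenvalues j := by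
  simpa using hA.trace_eq_sum_eigenvalues

lemma abs_eigenvalues_le_opNorm {A : Matrix n n ℝ} (hA : A.IsHermitian) (j : n) :
    |hA.eigenvalues j| ≤ opNorm A := by
  have h := sum_sq_mulVec_le A (hA.eigenvectorBasis j)
  rw [hA.mulVec_eigenvectorBasis] at h
  have h1 : ∑ i, (hA.eigenvectorBasis j i) ^ 2 = 1 := by
    have := eigenvectorBasis_sum_mul hA j j
    simpa [sq] using this
  simp only [Pi.smul_apply, smul_eq_mul, mul_pow] at h
  rw [← Finset.mul_sum, h1, mul_one, mul_one] at h
  exact abs_le_of_sq_le_sq h (opNorm_nonneg A)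

lemma det_one_add_smul_eq_prod {A : Matrix n n ℝ} (hA : A.IsHermitian) (t : ℝ) :
    (1 + t • A).det = ∏ j, (1 + t * hA.eigenvalues j) := by
  have h : (1 + t • A) = Unitary.conjStarAlgAut ℝ _ hA.eigenvectorUnitary
      (Matrix.diagonal fun j => 1 + t * hA.eigenvalues j) := by
    have : (Matrix.diagonal fun j => 1 + t * hA.eigenvalues j)
        = 1 + t • Matrix.diagonal (RCLike.ofReal ∘ hA.eigenvalues : n → ℝ) := by
      rw [← Matrix.diagonal_one, ← Matrix.diagonal_smul, Matrix.diagonal_add]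
      rfl
    rw [this, map_add, map_one, map_smul, ← hA.spectral_theorem]
  rw [h, Unitary.conjStarAlgAut_apply, Matrix.det_mul_right_comm, Unitary.mul_star_self_of_mem hA.eigenvectorUnitary.2,
    one_mul, Matrix.det_diagonal]

end Norms


/-! ### The Hanson–Wright inequality -/

section HansonWright

set_option linter.unusedSectionVars false

variable {n : Type*} [Fintype n] [DecidableEq n]

lemma sum_mulVec_sq_eq (B : Matrix n n ℝ) (z : n → ℝ) :
    ∑ i, (B.mulVec z) i ^ 2 = ∑ a, ∑ b, z a * (B.transpose * B) a b * z b := by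
  have : ∑ i, (B.mulVec z) i ^ 2 = z ⬝ᵥ ((B.transpose * B).mulVec z) := by
    rw [← Matrix.mulVec_mulVec, Matrix.dotProduct_mulVec, Matrix.vecMul_transpose]
    simp [dotProduct, sq]
  rw [this]
  simp only [dotProduct, Matrix.mulVec, Finset.mul_sum, mul_assoc]

lemma trace_transpose_mul_self_eq (B : Matrix n n ℝ) :
    (B.transpose * B).trace = frobNorm B ^ 2 := by
  rw [frobNorm_sq, Finset.sum_comm, Matrix.trace]
  refine Finset.sum_congr rfl fun i _ => ?_
  simp [Matrix.mul_apply, sq]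

/-- Diagonalization of BᵀB: its eigenvalues are at most ‖B‖² and sum to ‖B‖_F². -/
lemma lintegral_exp_norm_sq_mulVec_le {ν : n → Measure ℝ}
    (hν : ∀ i, IsProbabilityMeasure (ν i)) {κ : ℝ} (hκ : 0 ≤ κ)
    (h : ∀ i c, ∫⁻ x, ENNReal.ofReal (Real.exp (c * x)) ∂(ν i)
      ≤ ENNReal.ofReal (Real.exp (κ * c ^ 2))) (B : Matrix n n ℝ) {μ : ℝ} (hμ : 0 ≤ μ)
    (hB : 8 * κ * (μ * opNorm B ^ 2) ≤ 1) :
    ∫⁻ z, ENNReal.ofReal (Real.exp (μ * ∑ i, (B.mulVec z) i ^ 2)) ∂(Measure.pi ν)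
      ≤ ENNReal.ofReal (Real.exp (4 * κ * (μ * frobNorm B ^ 2))) := by
  have hG : (B.transpose * B).PosSemidef := by
    rw [← Matrix.conjTranspose_eq_transpose_of_trivial]
    exact Matrix.posSemidef_conjTranspose_mul_self B
  have := lintegral_pi_exp_quadratic hν hκ h (fun j => μ * hG.1.eigenvalues j)
    (fun j => mul_nonneg hμ (hG.eigenvalues_nonneg j)) (fun j => ?_)
    (fun j => hG.1.eigenvectorBasis j) (eigenvectorBasis_sum_mul hG.1)
  · rw [← Finset.mul_sum, ← trace_eq_sum_eigenvalues', trace_transpose_mul_self_eq] at this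
    refine le_trans (le_of_eq ?_) this
    refine lintegral_congr fun z => ?_
    rw [sum_mulVec_sq_eq, quadForm_eq_sum_eigenvalues hG.1, Finset.mul_sum]
    simp only [mul_assoc]
  · refine le_trans ?_ hB
    rw [← opNorm_transpose_mul_self]
    have := (le_abs_self _).trans (abs_eigenvalues_le_opNorm hG.1 j)
    gcongr

/-- Mixing two independent copies along a set of coordinates does not change the law. -/
lemma measurePreserving_pi_piecewise {ν : n → Measure ℝ}
    (hν : ∀ i, IsProbabilityMeasure (ν i)) (δ : n → Bool) :
    MeasurePreserving (fun w : (n → ℝ) × (n → ℝ) => fun i => if δ i then w.1 i else w.2 i)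
      ((Measure.pi ν).prod (Measure.pi ν)) (Measure.pi ν) := by
  have hm : Measurable (fun w : (n → ℝ) × (n → ℝ) => fun i => if δ i then w.1 i else w.2 i) := by
    refine measurable_pi_lambda _ fun i => ?_
    cases δ i <;> simp <;> fun_prop
  refine ⟨hm, (Measure.pi_eq fun s hs => ?_).symm⟩
  rw [Measure.map_apply hm (MeasurableSet.univ_pi hs)]
  have : (fun w : (n → ℝ) × (n → ℝ) => fun i => if δ i then w.1 i else w.2 i) ⁻¹' Set.univ.pi s
      = (Set.univ.pi fun i => if δ i then s i else Set.univ) ×ˢ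
        (Set.univ.pi fun i => if δ i then Set.univ else s i) := by
    ext w
    simp only [Set.mem_preimage, Set.mem_pi, Set.mem_univ, true_implies, Set.mem_prod]
    rw [← forall_and]
    refine forall_congr' fun i => ?_
    cases δ i <;> simp
  rw [this, Measure.prod_prod, Measure.pi_pi, Measure.pi_pi, ← Finset.prod_mul_distrib]
  refine Finset.prod_congr rfl fun i _ => ?_
  cases δ i <;> simp

/-- The part of a quadratic form with rows selected by `δ` and columns by its complement. -/
def selectForm (A : Matrix n n ℝ) (δ : n → Bool) (x y : n → ℝ) : ℝ :=
  ∑ i, ∑ j, if δ i = true ∧ δ j = false then x i * A i j * y j else 0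

lemma measurable_selectForm (A : Matrix n n ℝ) (δ : n → Bool) :
    Measurable fun z : (n → ℝ) × (n → ℝ) => selectForm A δ z.1 z.2 := by
  unfold selectForm
  refine Finset.measurable_sum _ fun i _ => Finset.measurable_sum _ fun j _ => ?_
  split_ifs <;> fun_prop

lemma measurable_selectForm_diag (A : Matrix n n ℝ) (δ : n → Bool) :
    Measurable fun z : n → ℝ => selectForm A δ z z := by
  unfold selectForm
  refine Finset.measurable_sum _ fun i _ => Finset.measurable_sum _ fun j _ => ?_
  split_ifs <;> fun_prop

/-- The row variable is read only on `δ` and the column variable only off `δ`. The form in one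
vector therefore has the law of the form in two independent copies, which is the decoupling. -/
lemma selectForm_piecewise (A : Matrix n n ℝ) (δ : n → Bool) (x y : n → ℝ) :
    selectForm A δ (fun i => if δ i then x i else y i) (fun i => if δ i then x i else y i)
      = selectForm A δ x y := by
  unfold selectForm
  refine Finset.sum_congr rfl fun i _ => Finset.sum_congr rfl fun j _ => ?_
  cases hi : δ i <;> cases hj : δ j <;> simp [hi, hj]

/-- The columns of `A` outside the selection `δ`. -/
def maskColumns (A : Matrix n n ℝ) (δ : n → Bool) : Matrix n n ℝ :=
  A * Matrix.diagonal fun j => if δ j then 0 else 1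

lemma opNorm_mask_le (δ : n → Bool) :
    opNorm (Matrix.diagonal fun j => if δ j then (0 : ℝ) else 1) ≤ 1 :=
  opNorm_le_of_sum_sq zero_le_one fun x => by
    rw [one_pow, one_mul]
    refine Finset.sum_le_sum fun i _ => ?_
    rw [Matrix.mulVec_diagonal]
    cases δ i <;> simp [sq_nonneg]

lemma opNorm_maskColumns_le (A : Matrix n n ℝ) (δ : n → Bool) :
    opNorm (maskColumns A δ) ≤ opNorm A :=
  (opNorm_mul_le _ _).trans (mul_le_of_le_one_right (opNorm_nonneg _) (opNorm_mask_le δ))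

lemma frobNorm_maskColumns_le (A : Matrix n n ℝ) (δ : n → Bool) :
    frobNorm (maskColumns A δ) ≤ frobNorm A :=
  (frobNorm_mul_le' _ _).trans (mul_le_of_le_one_right (frobNorm_nonneg _) (opNorm_mask_le δ))

lemma selectForm_eq_sum (A : Matrix n n ℝ) (δ : n → Bool) (t : ℝ) (x y : n → ℝ) :
    t * selectForm A δ x y
      = ∑ i, (if δ i then t * ((maskColumns A δ).mulVec y) i else 0) * x i := by
  unfold selectForm
  rw [Finset.mul_sum]
  refine Finset.sum_congr rfl fun i _ => ?_
  cases hi : δ i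
  · simp
  · simp only [maskColumns, Matrix.mulVec, dotProduct, Matrix.mul_diagonal, if_true,
      Finset.mul_sum, Finset.sum_mul]
    refine Finset.sum_congr rfl fun j _ => ?_
    cases hj : δ j
    · simp; ring
    · simp

/-- After decoupling, the exponent is linear in x for fixed y. Integrating x first leaves the
exponential of a multiple of the squared norm of the masked matrix applied to y. -/
lemma lintegral_exp_selectForm_le {ν : n → Measure ℝ}
    (hν : ∀ i, IsProbabilityMeasure (ν i)) {κ : ℝ} (hκ : 0 ≤ κ)
    (h : ∀ i c, ∫⁻ x, ENNReal.ofReal (Real.exp (c * x)) ∂(ν i)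
      ≤ ENNReal.ofReal (Real.exp (κ * c ^ 2))) (A : Matrix n n ℝ) (δ : n → Bool) {t : ℝ}
    (hA : 8 * κ ^ 2 * t ^ 2 * opNorm A ^ 2 ≤ 1) :
    ∫⁻ z, ENNReal.ofReal (Real.exp (t * selectForm A δ z z)) ∂(Measure.pi ν)
      ≤ ENNReal.ofReal (Real.exp (4 * κ ^ 2 * t ^ 2 * frobNorm A ^ 2)) := by
  have hmeas : Measurable fun z : (n → ℝ) × (n → ℝ) =>
      ENNReal.ofReal (Real.exp (t * selectForm A δ z.1 z.2)) :=
    ((measurable_selectForm A δ).const_mul t).exp.ennreal_ofReal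
  have hmeas' : Measurable fun z : n → ℝ =>
      ENNReal.ofReal (Real.exp (t * selectForm A δ z z)) :=
    ((measurable_selectForm_diag A δ).const_mul t).exp.ennreal_ofReal
  rw [← (measurePreserving_pi_piecewise hν δ).lintegral_comp hmeas']
  simp_rw [selectForm_piecewise]
  rw [lintegral_prod_symm _ hmeas.aemeasurable]
  have hin : ∀ y : n → ℝ,
      ∫⁻ x, ENNReal.ofReal (Real.exp (t * selectForm A δ x y)) ∂(Measure.pi ν)
        ≤ ENNReal.ofReal
            (Real.exp (κ * t ^ 2 * ∑ i, ((maskColumns A δ).mulVec y) i ^ 2)) := by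
    intro y
    simp_rw [selectForm_eq_sum]
    refine (lintegral_pi_exp_linear hν h _).trans
      (ENNReal.ofReal_le_ofReal (Real.exp_le_exp.2 ?_))
    rw [mul_assoc κ, Finset.mul_sum _ _ (t ^ 2)]
    refine mul_le_mul_of_nonneg_left (Finset.sum_le_sum fun i _ => ?_) hκ
    cases δ i
    · simp only [Bool.false_eq_true, if_false, ne_eq, OfNat.ofNat_ne_zero, not_false_eq_true, zero_pow]; positivity
    · simp [mul_pow]
  refine (lintegral_mono hin).trans ?_
  refine (lintegral_exp_norm_sq_mulVec_le hν hκ h _ (by positivity) ?_).trans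
    (ENNReal.ofReal_le_ofReal (Real.exp_le_exp.2 ?_))
  · refine le_trans ?_ hA
    have := pow_le_pow_left₀ (opNorm_nonneg _) (opNorm_maskColumns_le A δ) 2
    calc 8 * κ * (κ * t ^ 2 * opNorm (maskColumns A δ) ^ 2)
        = 8 * κ ^ 2 * t ^ 2 * opNorm (maskColumns A δ) ^ 2 := by ring
      _ ≤ _ := by gcongr
  · have := pow_le_pow_left₀ (frobNorm_nonneg _) (frobNorm_maskColumns_le A δ) 2
    calc 4 * κ * (κ * t ^ 2 * frobNorm (maskColumns A δ) ^ 2)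
        = 4 * κ ^ 2 * t ^ 2 * frobNorm (maskColumns A δ) ^ 2 := by ring
      _ ≤ _ := by gcongr

lemma sum_bool_flip (i : n) (f : (n → Bool) → ℝ) :
    ∑ δ, f (Function.update δ i (!δ i)) = ∑ δ, f δ := by
  have hinv : Function.Involutive fun δ : n → Bool => Function.update δ i (!δ i) := fun δ => by
    simp
  exact Equiv.sum_comp hinv.toPerm f

/-- Flipping one coordinate is a bijection of the selectors, so the four values of (δ i, δ j) are
equally frequent. -/
lemma sum_selector {i j : n} (hij : i ≠ j) :
    4 * ∑ δ : n → Bool, (if δ i = true ∧ δ j = false then (1 : ℝ) else 0)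
      = Fintype.card (n → Bool) := by
  have h1 := sum_bool_flip i fun δ => if δ i = true ∧ δ j = false then (1 : ℝ) else 0
  have h2 := sum_bool_flip j fun δ => if δ i = true ∧ δ j = false then (1 : ℝ) else 0
  have h3 := sum_bool_flip j fun δ => if δ i = false ∧ δ j = false then (1 : ℝ) else 0
  simp only [Function.update_self, Function.update_of_ne hij, Function.update_of_ne hij.symm,
    Bool.not_eq_true', Bool.not_eq_false'] at h1 h2 h3
  have h4 : ∀ δ : n → Bool, (1 : ℝ) = (if δ i = true ∧ δ j = false then (1 : ℝ) else 0)
      + (if δ i = false ∧ δ j = false then (1 : ℝ) else 0)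
      + (if δ i = true ∧ δ j = true then (1 : ℝ) else 0)
      + (if δ i = false ∧ δ j = true then (1 : ℝ) else 0) := fun δ => by
    cases δ i <;> cases δ j <;> simp
  have h5 : (Fintype.card (n → Bool) : ℝ) = ∑ _δ : n → Bool, (1 : ℝ) := by
    simp [Finset.card_univ]
  rw [h5, Finset.sum_congr rfl fun δ _ => h4 δ, Finset.sum_add_distrib, Finset.sum_add_distrib,
    Finset.sum_add_distrib, h3, h2, h1]
  ring

/-- The off-diagonal part of a quadratic form. -/
def offForm (A : Matrix n n ℝ) (z : n → ℝ) : ℝ :=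
  ∑ i, ∑ j, if i = j then 0 else z i * A i j * z j

lemma offForm_eq_average (A : Matrix n n ℝ) (z : n → ℝ) :
    offForm A z
      = ∑ δ : n → Bool, ((Fintype.card (n → Bool) : ℝ)⁻¹) • (4 * selectForm A δ z z) := by
  have hN : (Fintype.card (n → Bool) : ℝ) ≠ 0 := by exact_mod_cast Fintype.card_ne_zero
  have hswap : ∑ δ, selectForm A δ z z
      = ∑ i, ∑ j, ∑ δ : n → Bool, if δ i = true ∧ δ j = false then z i * A i j * z j else 0 :=
    Finset.sum_comm.trans (Finset.sum_congr rfl fun i _ => Finset.sum_comm)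
  rw [← Finset.smul_sum, ← Finset.mul_sum, hswap, smul_eq_mul, Finset.mul_sum, Finset.mul_sum]
  unfold offForm
  refine Finset.sum_congr rfl fun i _ => ?_
  rw [Finset.mul_sum, Finset.mul_sum]
  refine Finset.sum_congr rfl fun j _ => ?_
  split_ifs with hij
  · subst hij
    rw [Finset.sum_eq_zero]
    · simp
    · intro δ _
      cases δ i <;> simp
  · have h : ∀ δ : n → Bool, (if δ i = true ∧ δ j = false then z i * A i j * z j else 0)
        = (if δ i = true ∧ δ j = false then (1 : ℝ) else 0) * (z i * A i j * z j) := fun δ => by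
      split_ifs <;> simp
    simp_rw [h]
    rw [← Finset.sum_mul, ← mul_assoc 4, sum_selector hij]
    field_simp

/-- A uniform selector keeps each ordered off-diagonal pair with probability 1/4, so the
off-diagonal form is four times an average of selected forms. Jensen then passes to a single
selector, with 4t in place of t. -/
lemma lintegral_exp_offForm_le {ν : n → Measure ℝ}
    (hν : ∀ i, IsProbabilityMeasure (ν i)) {κ : ℝ} (hκ : 0 ≤ κ)
    (h : ∀ i c, ∫⁻ x, ENNReal.ofReal (Real.exp (c * x)) ∂(ν i)
      ≤ ENNReal.ofReal (Real.exp (κ * c ^ 2))) (A : Matrix n n ℝ) {t : ℝ}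
    (hA : 128 * κ ^ 2 * t ^ 2 * opNorm A ^ 2 ≤ 1) :
    ∫⁻ z, ENNReal.ofReal (Real.exp (t * offForm A z)) ∂(Measure.pi ν)
      ≤ ENNReal.ofReal (Real.exp (64 * κ ^ 2 * t ^ 2 * frobNorm A ^ 2)) := by
  set N : ℝ := (Fintype.card (n → Bool) : ℝ)
  have hN : 0 < N := by simp only [N]; exact_mod_cast Fintype.card_pos
  have hsumw : ∑ _δ : n → Bool, N⁻¹ = 1 := by
    rw [Finset.sum_const, Finset.card_univ, nsmul_eq_mul]
    exact mul_inv_cancel₀ hN.ne'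
  have hJ : ∀ z : n → ℝ, ENNReal.ofReal (Real.exp (t * offForm A z))
      ≤ ∑ δ : n → Bool, ENNReal.ofReal N⁻¹ *
        ENNReal.ofReal (Real.exp ((4 * t) * selectForm A δ z z)) := fun z => by
    have h1 := convexOn_exp.map_sum_le (t := Finset.univ) (w := fun _ : n → Bool => N⁻¹)
      (p := fun δ => (4 * t) * selectForm A δ z z) (fun _ _ => by positivity) hsumw
      (fun _ _ => Set.mem_univ _)
    have h2 : t * offForm A z = ∑ δ : n → Bool, N⁻¹ • ((4 * t) * selectForm A δ z z) := by
      rw [offForm_eq_average, Finset.mul_sum]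
      refine Finset.sum_congr rfl fun δ _ => ?_
      simp only [smul_eq_mul, N]
      ring
    rw [h2]
    refine (ENNReal.ofReal_le_ofReal h1).trans (le_of_eq ?_)
    rw [ENNReal.ofReal_sum_of_nonneg fun δ _ => smul_nonneg (by positivity) (Real.exp_pos _).le]
    refine Finset.sum_congr rfl fun δ _ => ?_
    rw [smul_eq_mul, ENNReal.ofReal_mul (by positivity)]
  have hmeas : ∀ δ : n → Bool, Measurable fun z : n → ℝ =>
      ENNReal.ofReal (Real.exp ((4 * t) * selectForm A δ z z)) := fun δ =>
    ((measurable_selectForm_diag A δ).const_mul _).exp.ennreal_ofReal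
  refine (lintegral_mono hJ).trans ?_
  rw [lintegral_finsetSum _ fun δ _ => (hmeas δ).const_mul _]
  calc _ ≤ ∑ δ : n → Bool, ENNReal.ofReal N⁻¹ *
        ENNReal.ofReal (Real.exp (64 * κ ^ 2 * t ^ 2 * frobNorm A ^ 2)) := by
        refine Finset.sum_le_sum fun δ _ => ?_
        rw [lintegral_const_mul _ (hmeas δ)]
        gcongr
        refine (lintegral_exp_selectForm_le hν hκ h A δ (by linarith)).trans (le_of_eq ?_)
        congr 2
        ring
    _ = _ := by
        rw [← Finset.sum_mul, ← ENNReal.ofReal_sum_of_nonneg fun _ _ => by positivity, hsumw]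
        simp

/-- The variance constant in the Hanson–Wright inequality. -/
def hwConst (a : ℝ) : ℝ := 4 * (IsSubgaussianLaw.sqConst a + 64 / a ^ 2)

lemma hwConst_pos {a : ℝ} (ha : 0 < a) : 0 < hwConst a := by
  unfold hwConst IsSubgaussianLaw.sqConst; positivity

lemma abs_diag_le_opNorm (A : Matrix n n ℝ) (i : n) : |A i i| ≤ opNorm A := by
  have h := sum_sq_mulVec_le A (Pi.single i 1)
  rw [Matrix.mulVec_single_one] at h
  have h1 : ∑ j, (Pi.single i (1 : ℝ) : n → ℝ) j ^ 2 = 1 := by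
    rw [Finset.sum_eq_single i] <;> simp +contextual
  rw [h1, mul_one] at h
  refine abs_le_of_sq_le_sq ?_ (opNorm_nonneg A)
  refine le_trans ?_ h
  exact Finset.single_le_sum (f := fun j => A.col i j ^ 2) (fun _ _ => sq_nonneg _)
    (Finset.mem_univ i)

/-- Hanson–Wright: exponential moments of a centered quadratic form. -/
lemma lintegral_exp_quadForm_le {ν : n → Measure ℝ} {a : ℝ} (ha : 0 < a)
    (hν : ∀ i, IsSubgaussianLaw a (ν i)) (A : Matrix n n ℝ) {t : ℝ}
    (hA : 32 * |t| * opNorm A ≤ a) :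
    ∫⁻ z, ENNReal.ofReal (Real.exp (t * (∑ i, ∑ j, z i * A i j * z j - A.trace)))
        ∂(Measure.pi ν)
      ≤ ENNReal.ofReal (Real.exp (hwConst a * t ^ 2 * frobNorm A ^ 2)) := by
  have hp : ∀ i, IsProbabilityMeasure (ν i) := fun i => (hν i).isProb
  have hlin : ∀ i c, ∫⁻ x, ENNReal.ofReal (Real.exp (c * x)) ∂(ν i)
      ≤ ENNReal.ofReal (Real.exp (a⁻¹ * c ^ 2)) := fun i c =>
    ((hν i).lintegral_exp_mul_le ha c).trans (le_of_eq (by congr 2; field_simp))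
  have hop := opNorm_nonneg A
  -- The doubled parameter anticipates exp(u + v) ≤ (e^{2u} + e^{2v})/2, which separates the
  -- diagonal from the off-diagonal part.
  have hoff := lintegral_exp_offForm_le hp (by positivity) hlin A (t := 2 * t) (by
    have h1 : (32 * |t| * opNorm A) ^ 2 ≤ a ^ 2 := pow_le_pow_left₀ (by positivity) hA 2
    have h2 : (32 * |t| * opNorm A) ^ 2 = 1024 * t ^ 2 * opNorm A ^ 2 := by
      rw [mul_pow, mul_pow, sq_abs]; norm_num
    rw [h2] at h1
    have : 128 * a⁻¹ ^ 2 * (2 * t) ^ 2 * opNorm A ^ 2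
        = (512 * t ^ 2 * opNorm A ^ 2) / a ^ 2 := by field_simp; ring
    rw [this, div_le_one (by positivity)]
    have : 0 ≤ t ^ 2 * opNorm A ^ 2 := by positivity
    linarith)
  have hdiag := lintegral_pi_exp_sum hp (fun i x => (2 * t * A i i) * (x ^ 2 - 1))
    (fun i => by fun_prop) (fun i => IsSubgaussianLaw.sqConst a * (2 * t * A i i) ^ 2)
    (fun i => (hν i).lintegral_exp_mul_sq_sub_one_le ha (by
      rw [abs_mul, abs_mul, abs_two]
      have := mul_le_mul_of_nonneg_left (abs_diag_le_opNorm A i)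
        (mul_nonneg zero_le_two (abs_nonneg t))
      have h0 : 0 ≤ |t| * opNorm A := by positivity
      nlinarith))
  have hsplit : ∀ z : n → ℝ, ∑ i, ∑ j, z i * A i j * z j - A.trace
      = ∑ i, A i i * (z i ^ 2 - 1) + offForm A z := fun z => by
    unfold offForm
    rw [Matrix.trace, ← Finset.sum_sub_distrib, ← Finset.sum_add_distrib]
    refine Finset.sum_congr rfl fun i _ => ?_
    have h1 : ∀ j, z i * A i j * z j = (if i = j then z i * A i j * z j else 0)
        + (if i = j then 0 else z i * A i j * z j) := fun j => by split_ifs <;> simp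
    rw [Finset.sum_congr rfl fun j _ => h1 j, Finset.sum_add_distrib, Finset.sum_ite_eq]
    simp only [Finset.mem_univ, if_true, Matrix.diag_apply]
    ring
  have hF : ∑ i, A i i ^ 2 ≤ frobNorm A ^ 2 := by
    rw [frobNorm_sq]
    exact Finset.sum_le_sum fun i _ =>
      Finset.single_le_sum (f := fun j => A i j ^ 2) (fun _ _ => sq_nonneg _) (Finset.mem_univ i)
  have hs0 : 0 ≤ IsSubgaussianLaw.sqConst a := by unfold IsSubgaussianLaw.sqConst; positivity
  set R := ENNReal.ofReal (Real.exp (hwConst a * t ^ 2 * frobNorm A ^ 2))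
  have hoff' : ∫⁻ z, ENNReal.ofReal (Real.exp (2 * t * offForm A z)) ∂(Measure.pi ν) ≤ R := by
    refine hoff.trans (ENNReal.ofReal_le_ofReal (Real.exp_le_exp.2 ?_))
    unfold hwConst
    have : 64 * a⁻¹ ^ 2 * (2 * t) ^ 2 * frobNorm A ^ 2
      = 4 * (64 / a ^ 2) * t ^ 2 * frobNorm A ^ 2 := by field_simp; ring
    rw [this]
    gcongr
    linarith
  have hdiag' : ∫⁻ z, ENNReal.ofReal (Real.exp (∑ i, (2 * t * A i i) * (z i ^ 2 - 1)))
      ∂(Measure.pi ν) ≤ R := by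
    refine hdiag.trans (ENNReal.ofReal_le_ofReal (Real.exp_le_exp.2 ?_))
    rw [← Finset.mul_sum]
    have : ∑ i, (2 * t * A i i) ^ 2 = 4 * t ^ 2 * ∑ i, A i i ^ 2 := by
      rw [Finset.mul_sum]; exact Finset.sum_congr rfl fun i _ => by ring
    rw [this]
    unfold hwConst
    have h2 : 0 ≤ 64 / a ^ 2 := by positivity
    calc _ = 4 * IsSubgaussianLaw.sqConst a * t ^ 2 * ∑ i, A i i ^ 2 := by ring
      _ ≤ _ := by gcongr; linarith
  have hpt : ∀ z : n → ℝ,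
      ENNReal.ofReal (Real.exp (t * (∑ i, ∑ j, z i * A i j * z j - A.trace)))
        ≤ ENNReal.ofReal (1 / 2) *
            ENNReal.ofReal (Real.exp (∑ i, (2 * t * A i i) * (z i ^ 2 - 1)))
          + ENNReal.ofReal (1 / 2) * ENNReal.ofReal (Real.exp (2 * t * offForm A z)) := fun z => by
    rw [← ENNReal.ofReal_mul (by norm_num), ← ENNReal.ofReal_mul (by norm_num),
      ← ENNReal.ofReal_add (by positivity) (by positivity)]
    apply ENNReal.ofReal_le_ofReal
    have h1 := convexOn_exp.2 (Set.mem_univ (∑ i, (2 * t * A i i) * (z i ^ 2 - 1)))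
      (Set.mem_univ (2 * t * offForm A z)) (show (0 : ℝ) ≤ 1 / 2 by norm_num)
      (show (0 : ℝ) ≤ 1 / 2 by norm_num) (by norm_num)
    simp only [smul_eq_mul] at h1
    refine le_trans (le_of_eq ?_) h1
    rw [hsplit, mul_add, Finset.mul_sum, Finset.mul_sum]
    congr 2
    · exact Finset.sum_congr rfl fun i _ => by ring
    · ring
  have hm1 : Measurable fun z : n → ℝ =>
      ENNReal.ofReal (Real.exp (∑ i, (2 * t * A i i) * (z i ^ 2 - 1))) := by fun_prop
  have hm2 : Measurable fun z : n → ℝ =>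
      ENNReal.ofReal (Real.exp (2 * t * offForm A z)) := by
    unfold offForm
    apply ENNReal.measurable_ofReal.comp
    apply Real.measurable_exp.comp
    apply Measurable.const_mul
    refine Finset.measurable_sum _ fun i _ => Finset.measurable_sum _ fun j _ => ?_
    split_ifs <;> fun_prop
  refine (lintegral_mono hpt).trans ?_
  rw [lintegral_add_left (hm1.const_mul _), lintegral_const_mul _ hm1, lintegral_const_mul _ hm2]
  calc _ ≤ ENNReal.ofReal (1 / 2) * R + ENNReal.ofReal (1 / 2) * R := by gcongr
    _ = R := by
      rw [← add_mul, ← ENNReal.ofReal_add (by norm_num) (by norm_num)]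
      norm_num

/-- Hanson–Wright: tail bound in the sub-gaussian range. -/
lemma measure_quadForm_ge_le {ν : n → Measure ℝ} {a : ℝ} (ha : 0 < a)
    (hν : ∀ i, IsSubgaussianLaw a (ν i)) (A : Matrix n n ℝ) {s F : ℝ} (hs : 0 ≤ s) (hF : 0 < F)
    (hAF : frobNorm A ^ 2 ≤ F) (hA : 16 * s * opNorm A ≤ a * hwConst a * F) :
    Measure.pi ν {z | s ≤ |∑ i, ∑ j, z i * A i j * z j - A.trace|}
      ≤ ENNReal.ofReal (2 * Real.exp (-(s ^ 2 / (4 * hwConst a * F)))) := by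
  have hK := hwConst_pos ha
  set K := hwConst a
  -- The minimizer of Kt²F − ts; the assumption on ‖A‖ places it in the admissible range of t.
  set t := s / (2 * K * F) with ht
  have ht0 : 0 ≤ t := by positivity
  have hone : ∀ t' : ℝ, |t'| = t →
      Measure.pi ν {z | t * s ≤ t' * (∑ i, ∑ j, z i * A i j * z j - A.trace)}
        ≤ ENNReal.ofReal (Real.exp (-(s ^ 2 / (4 * K * F)))) := fun t' ht' => by
    have h1 := lintegral_exp_quadForm_le ha hν A (t := t') (by
      rw [ht', ht]
      rw [show 32 * (s / (2 * K * F)) * opNorm A = (16 * s * opNorm A) / (K * F) by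
        field_simp; ring]
      rw [div_le_iff₀ (by positivity)]
      linarith)
    have hm : Measurable fun z : n → ℝ => ENNReal.ofReal
        (Real.exp (t' * (∑ i, ∑ j, z i * A i j * z j - A.trace))) := by fun_prop
    have h2 := mul_meas_ge_le_lintegral (μ := Measure.pi ν) hm
      (ENNReal.ofReal (Real.exp (t * s)))
    have hset : {z : n → ℝ | t * s ≤ t' * (∑ i, ∑ j, z i * A i j * z j - A.trace)}
        = {z | ENNReal.ofReal (Real.exp (t * s)) ≤ ENNReal.ofReal
        (Real.exp (t' * (∑ i, ∑ j, z i * A i j * z j - A.trace)))} := by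
      ext z
      simp only [Set.mem_ofPred_eq]
      rw [ENNReal.ofReal_le_ofReal_iff (Real.exp_pos _).le, Real.exp_le_exp]
    rw [← hset] at h2
    have h3 := (h2.trans h1)
    have h4 : ENNReal.ofReal (Real.exp (t * s)) ≠ 0 := by
      simp [Real.exp_pos]
    rw [mul_comm, ← ENNReal.le_div_iff_mul_le (Or.inl h4) (Or.inl ENNReal.ofReal_ne_top),
      ← ENNReal.ofReal_div_of_pos (Real.exp_pos _), ← Real.exp_sub] at h3
    refine h3.trans (ENNReal.ofReal_le_ofReal (Real.exp_le_exp.2 ?_))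
    have h5 : t' ^ 2 = t ^ 2 := by rw [← ht', sq_abs]
    rw [h5]
    have h6 : K * t ^ 2 * frobNorm A ^ 2 ≤ K * t ^ 2 * F := by gcongr
    have h7 : K * t ^ 2 * F - t * s = -(s ^ 2 / (4 * K * F)) := by
      rw [ht]; field_simp; ring
    linarith
  have hsub : {z : n → ℝ | s ≤ |∑ i, ∑ j, z i * A i j * z j - A.trace|}
      ⊆ {z | t * s ≤ t * (∑ i, ∑ j, z i * A i j * z j - A.trace)}
        ∪ {z | t * s ≤ (-t) * (∑ i, ∑ j, z i * A i j * z j - A.trace)} := fun z hz => by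
    rcases le_abs.1 (show s ≤ |∑ i, ∑ j, z i * A i j * z j - A.trace| from hz) with h | h
    · exact Or.inl (mul_le_mul_of_nonneg_left h ht0)
    · refine Or.inr ?_
      have := mul_le_mul_of_nonneg_left h ht0
      simp only [Set.mem_ofPred_eq]
      linarith
  refine (measure_mono hsub).trans ((measure_union_le _ _).trans ?_)
  refine (add_le_add (hone t (abs_of_nonneg ht0)) (hone (-t) (by rw [abs_neg, abs_of_nonneg ht0]))).trans
    (le_of_eq ?_)
  rw [← ENNReal.ofReal_add (Real.exp_pos _).le (Real.exp_pos _).le]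
  ring_nf

end HansonWright


/-! ### Frobenius inner product -/

section Inner

set_option linter.unusedSectionVars false

variable {n : Type*} [Fintype n] [DecidableEq n]

/-- Frobenius inner product. -/
def frobInner (A B : Matrix n n ℝ) : ℝ := ∑ i, ∑ j, A i j * B i j

lemma frobInner_self (A : Matrix n n ℝ) : frobInner A A = frobNorm A ^ 2 := by
  rw [frobNorm_sq]; simp [frobInner, sq]

lemma frobInner_comm (A B : Matrix n n ℝ) : frobInner A B = frobInner B A := by
  simp [frobInner, mul_comm]

lemma frobInner_add_left (A B D : Matrix n n ℝ) :
    frobInner (A + B) D = frobInner A D + frobInner B D := by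
  simp [frobInner, add_mul, Finset.sum_add_distrib]

lemma frobInner_smul_left (c : ℝ) (A B : Matrix n n ℝ) :
    frobInner (c • A) B = c * frobInner A B := by
  simp [frobInner, Finset.mul_sum, mul_assoc]

lemma frobInner_sum_left {κ : Type*} (s : Finset κ) (A : κ → Matrix n n ℝ) (B : Matrix n n ℝ) :
    frobInner (∑ k ∈ s, A k) B = ∑ k ∈ s, frobInner (A k) B := by
  classical
  induction s using Finset.induction_on with
  | empty => simp [frobInner]
  | insert a s ha ih => rw [Finset.sum_insert ha, Finset.sum_insert ha, frobInner_add_left, ih]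

lemma frobInner_add_right (A B D : Matrix n n ℝ) :
    frobInner A (B + D) = frobInner A B + frobInner A D := by
  rw [frobInner_comm, frobInner_add_left, frobInner_comm B, frobInner_comm D]

lemma frobInner_smul_right (c : ℝ) (A B : Matrix n n ℝ) :
    frobInner A (c • B) = c * frobInner A B := by
  rw [frobInner_comm, frobInner_smul_left, frobInner_comm]

lemma frobInner_sum_right {κ : Type*} (s : Finset κ) (A : κ → Matrix n n ℝ) (B : Matrix n n ℝ) :
    frobInner B (∑ k ∈ s, A k) = ∑ k ∈ s, frobInner B (A k) := by
  rw [frobInner_comm, frobInner_sum_left]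
  exact Finset.sum_congr rfl fun k _ => frobInner_comm _ _

lemma frobInner_one_right (A : Matrix n n ℝ) : frobInner A 1 = A.trace := by
  simp [frobInner, Matrix.one_apply, Matrix.trace]

lemma frobNorm_add_sq (A B : Matrix n n ℝ) :
    frobNorm (A + B) ^ 2 = frobNorm A ^ 2 + 2 * frobInner A B + frobNorm B ^ 2 := by
  simp only [← frobInner_self, frobInner_add_left, frobInner_add_right]
  rw [frobInner_comm B A]
  ring

/-- Projection onto the trace-free matrices. -/
def center : Matrix n n ℝ →ₗ[ℝ] Matrix n n ℝ where
  toFun A := A - (A.trace / Fintype.card n) • (1 : Matrix n n ℝ)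
  map_add' A B := by rw [Matrix.trace_add, add_div, add_smul]; abel
  map_smul' c A := by
    rw [Matrix.trace_smul, smul_sub, smul_smul, smul_eq_mul, mul_div_assoc, RingHom.id_apply]

lemma center_apply (A : Matrix n n ℝ) :
    center A = A - (A.trace / Fintype.card n) • (1 : Matrix n n ℝ) := rfl

lemma trace_center [Nonempty n] (A : Matrix n n ℝ) : (center A).trace = 0 := by
  have : (Fintype.card n : ℝ) ≠ 0 := by exact_mod_cast Fintype.card_ne_zero
  rw [center_apply, Matrix.trace_sub, Matrix.trace_smul, Matrix.trace_one, smul_eq_mul,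
    div_mul_cancel₀ _ this, sub_self]

lemma center_eq_self {A : Matrix n n ℝ} (h : A.trace = 0) : center A = A := by
  rw [center_apply, h]; simp

lemma frobNorm_center_le [Nonempty n] (A : Matrix n n ℝ) :
    frobNorm (center A) ^ 2 ≤ frobNorm A ^ 2 := by
  have h : A = center A + (A.trace / Fintype.card n) • (1 : Matrix n n ℝ) := by
    rw [center_apply]; abel
  conv_rhs => rw [h, frobNorm_add_sq, frobInner_smul_right, frobInner_one_right, trace_center]
  have := sq_nonneg (frobNorm ((A.trace / Fintype.card n) • (1 : Matrix n n ℝ)))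
  linarith

/-- Sum of the squares of the off-diagonal entries. -/
def offSq (A : Matrix n n ℝ) : ℝ := ∑ i, ∑ j, if i = j then 0 else A i j ^ 2

lemma offSq_nonneg (A : Matrix n n ℝ) : 0 ≤ offSq A :=
  Finset.sum_nonneg fun _ _ => Finset.sum_nonneg fun _ _ => by split_ifs <;> positivity

lemma frobNorm_sq_eq_diag_add_offSq (A : Matrix n n ℝ) :
    frobNorm A ^ 2 = ∑ i, A i i ^ 2 + offSq A := by
  rw [frobNorm_sq, offSq, ← Finset.sum_add_distrib]
  refine Finset.sum_congr rfl fun i _ => ?_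
  have h1 : ∀ j, A i j ^ 2 = (if i = j then A i j ^ 2 else 0)
      + (if i = j then 0 else A i j ^ 2) := fun j => by split_ifs <;> simp
  rw [Finset.sum_congr rfl fun j _ => h1 j, Finset.sum_add_distrib, Finset.sum_ite_eq]
  simp

lemma offSq_center (A : Matrix n n ℝ) : offSq (center A) = offSq A := by
  unfold offSq
  refine Finset.sum_congr rfl fun i _ => Finset.sum_congr rfl fun j _ => ?_
  split_ifs with h
  · rfl
  · simp [center_apply, Matrix.one_apply_ne h]

lemma eq_diagonal_add_sum_single (A : Matrix n n ℝ) :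
    A = Matrix.diagonal A.diag
      + ∑ i, ∑ j, (if i = j then 0 else A i j) • Matrix.single i j (1 : ℝ) := by
  conv_lhs => rw [Matrix.matrix_eq_sum_single A]
  have hd : Matrix.diagonal A.diag
      = ∑ i, ∑ j, (if i = j then A i j else 0) • Matrix.single i j (1 : ℝ) := by
    ext a b
    simp only [Matrix.sum_apply, Matrix.smul_apply, smul_eq_mul, Matrix.single_apply,
      Matrix.diagonal_apply, Matrix.diag_apply]
    rw [Finset.sum_eq_single a, Finset.sum_eq_single b]
    · by_cases h : a = b <;> simp [h]
    · intro c _ hc; simp [hc]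
    · simp
    · intro c _ hc; simp [hc]
    · simp
  rw [hd, ← Finset.sum_add_distrib]
  refine Finset.sum_congr rfl fun i _ => ?_
  rw [← Finset.sum_add_distrib]
  refine Finset.sum_congr rfl fun j _ => ?_
  rw [← add_smul]
  split_ifs <;> simp [Matrix.smul_single]

end Inner

/-! ### Kronecker sums -/

section Kronecker

variable {L : ℕ} {d : Fin L → ℕ}

lemma sum_idx_prod (g : ∀ l, Fin (d l) → ℝ) :
    ∑ j : Idx d, ∏ l, g l (j l) = ∏ l, ∑ b, g l b := by
  rw [Finset.prod_univ_sum, Fintype.piFinset_univ]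

lemma frobInner_kronProd (A B : Factors d) :
    frobInner (kronProd A) (kronProd B) = ∏ l, frobInner (A l) (B l) := by
  unfold frobInner kronProd
  simp only [Matrix.of_apply, ← Finset.prod_mul_distrib]
  have h : ∀ i : Idx d, ∑ j : Idx d, ∏ l, A l (i l) (j l) * B l (i l) (j l)
      = ∏ l, ∑ b, A l (i l) b * B l (i l) b := fun i =>
    sum_idx_prod fun l b => A l (i l) b * B l (i l) b
  simp_rw [h]
  exact sum_idx_prod fun l a => ∑ b, A l a b * B l a b

/-- Indicator that two positions agree outside mode `k`. -/
def agree (k : Fin L) (i j : Idx d) : ℝ :=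
  ∏ l ∈ Finset.univ.erase k, if i l = j l then 1 else 0

lemma agree_comm (k : Fin L) (i j : Idx d) : agree k i j = agree k j i := by
  simp [agree, eq_comm]

lemma agree_sq (k : Fin L) (i j : Idx d) : agree k i j ^ 2 = agree k i j := by
  unfold agree
  rw [← Finset.prod_pow]
  exact Finset.prod_congr rfl fun l _ => by split_ifs <;> simp

/-- Once the coordinates outside mode k are frozen, only the fibre in direction k remains. -/
lemma sum_mul_agree (k : Fin L) (i : Idx d) (f : Fin (d k) → ℝ) :
    ∑ j : Idx d, f (j k) * agree k i j = ∑ a, f a := by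
  have h := sum_idx_prod (Function.update (fun l b => if i l = b then (1 : ℝ) else 0) k f)
  rw [← Finset.mul_prod_erase _ _ (Finset.mem_univ k), Function.update_self] at h
  have h1 : ∏ l ∈ Finset.univ.erase k,
      ∑ b, Function.update (fun l b => if i l = b then (1 : ℝ) else 0) k f l b = 1 := by
    refine Finset.prod_eq_one fun l hl => ?_
    rw [Function.update_of_ne (Finset.ne_of_mem_erase hl)]
    simp
  rw [h1, mul_one] at h
  rw [← h]
  refine Finset.sum_congr rfl fun j _ => ?_
  rw [← Finset.mul_prod_erase _ _ (Finset.mem_univ k), Function.update_self, agree]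
  congr 1
  refine Finset.prod_congr rfl fun l hl => ?_
  rw [Function.update_of_ne (Finset.ne_of_mem_erase hl)]

lemma kronProd_update_apply (k : Fin L) (A : Matrix (Fin (d k)) (Fin (d k)) ℝ) (i j : Idx d) :
    kronProd (Function.update (fun _ => 1) k A) i j = A (i k) (j k) * agree k i j := by
  unfold kronProd agree
  rw [Matrix.of_apply, ← Finset.mul_prod_erase _ _ (Finset.mem_univ k), Function.update_self]
  congr 1
  refine Finset.prod_congr rfl fun l hl => ?_
  rw [Function.update_of_ne (Finset.ne_of_mem_erase hl), Matrix.one_apply]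

/-- The map `A ↦ I ⊗ ⋯ ⊗ A ⊗ ⋯ ⊗ I` with `A` in position `k`. -/
def embed (k : Fin L) :
    Matrix (Fin (d k)) (Fin (d k)) ℝ →ₗ[ℝ] Matrix (Idx d) (Idx d) ℝ where
  toFun A := kronProd (Function.update (fun _ => 1) k A)
  map_add' A B := by
    ext i j; simp only [kronProd_update_apply, Matrix.add_apply, add_mul]
  map_smul' c A := by
    ext i j
    simp only [kronProd_update_apply, Matrix.smul_apply, smul_eq_mul, mul_assoc, RingHom.id_apply]

lemma embed_eq (k : Fin L) (A : Matrix (Fin (d k)) (Fin (d k)) ℝ) :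
    embed k A = kronProd (Function.update (fun _ => 1) k A) := rfl

lemma embed_apply (k : Fin L) (A : Matrix (Fin (d k)) (Fin (d k)) ℝ) (i j : Idx d) :
    embed k A i j = A (i k) (j k) * agree k i j := kronProd_update_apply k A i j

lemma kronSum_eq (B : Factors d) : kronSum B = ∑ k, embed k (B k) := rfl

lemma kronSum_add (A B : Factors d) : kronSum (A + B) = kronSum A + kronSum B := by
  simp [kronSum_eq, Finset.sum_add_distrib]

lemma kronSum_smul (c : ℝ) (A : Factors d) : kronSum (c • A) = c • kronSum A := by
  simp [kronSum_eq, Finset.smul_sum]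

lemma kronProd_one : kronProd (fun l : Fin L => (1 : Matrix (Fin (d l)) (Fin (d l)) ℝ)) = 1 := by
  ext i j
  unfold kronProd
  rw [Matrix.of_apply, Matrix.one_apply]
  split_ifs with h
  · subst h; simp
  · obtain ⟨l, hl⟩ := Function.ne_iff.1 h
    exact Finset.prod_eq_zero (Finset.mem_univ l) (Matrix.one_apply_ne hl)

lemma embed_one (k : Fin L) : embed k (1 : Matrix (Fin (d k)) (Fin (d k)) ℝ) = 1 := by
  rw [embed_eq, ← kronProd_one]
  congr 1
  exact Function.update_eq_self k _

lemma prod_eq_coDim_mul (d : Fin L → ℕ) (k : Fin L) : ∏ l, d l = coDim d k * d k :=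
  (Finset.prod_erase_mul _ _ (Finset.mem_univ k)).symm

lemma frobInner_embed_self (k : Fin L) (A B : Matrix (Fin (d k)) (Fin (d k)) ℝ) :
    frobInner (embed k A) (embed k B) = coDim d k * frobInner A B := by
  rw [embed_eq, embed_eq, frobInner_kronProd, ← Finset.prod_erase_mul _ _ (Finset.mem_univ k),
    Function.update_self, Function.update_self, coDim, Nat.cast_prod]
  congr 1
  refine Finset.prod_congr rfl fun l hl => ?_
  rw [Function.update_of_ne (Finset.ne_of_mem_erase hl),
    Function.update_of_ne (Finset.ne_of_mem_erase hl), frobInner_one_right]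
  simp

lemma frobNorm_embed_sq (k : Fin L) (A : Matrix (Fin (d k)) (Fin (d k)) ℝ) :
    frobNorm (embed k A) ^ 2 = coDim d k * frobNorm A ^ 2 := by
  rw [← frobInner_self, frobInner_embed_self, frobInner_self]

/-- In mode k the other factor is the identity, so the product of inner products contains tr A. This
is why the factors are centred. -/
lemma frobInner_embed_of_ne {k l : Fin L} (hkl : k ≠ l)
    {A : Matrix (Fin (d k)) (Fin (d k)) ℝ} (hA : A.trace = 0)
    (B : Matrix (Fin (d l)) (Fin (d l)) ℝ) : frobInner (embed k A) (embed l B) = 0 := by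
  rw [embed_eq, embed_eq, frobInner_kronProd]
  refine Finset.prod_eq_zero (Finset.mem_univ k) ?_
  rw [Function.update_self, Function.update_of_ne hkl, frobInner_one_right, hA]

lemma trace_embed_eq_zero (k : Fin L) {A : Matrix (Fin (d k)) (Fin (d k)) ℝ}
    (hA : A.trace = 0) : (embed k A).trace = 0 := by
  rw [← frobInner_one_right, ← embed_one k, frobInner_embed_self, frobInner_one_right, hA,
    mul_zero]

/-- Cauchy–Schwarz in each mode-k fibre. No power of m_k appears here, while the Frobenius norm of
the embedding gains √m_k. -/
lemma opNorm_embed_le (k : Fin L) (A : Matrix (Fin (d k)) (Fin (d k)) ℝ) :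
    opNorm (embed k A) ≤ frobNorm A := by
  refine opNorm_le_of_sum_sq (frobNorm_nonneg A) fun x => ?_
  have h1 : ∀ i : Idx d, ((embed k A).mulVec x) i ^ 2
      ≤ (∑ a, A (i k) a ^ 2) * ∑ j : Idx d, agree k i j * x j ^ 2 := fun i => by
    have hcs := Finset.sum_mul_sq_le_sq_mul_sq Finset.univ
      (fun j : Idx d => A (i k) (j k) * agree k i j) (fun j => agree k i j * x j)
    have e1 : ((embed k A).mulVec x) i
        = ∑ j : Idx d, (A (i k) (j k) * agree k i j) * (agree k i j * x j) := by
      simp only [Matrix.mulVec, dotProduct]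
      refine Finset.sum_congr rfl fun j _ => ?_
      rw [embed_apply]
      nth_rewrite 1 [← agree_sq]
      ring
    have e2 : ∑ j : Idx d, (A (i k) (j k) * agree k i j) ^ 2 = ∑ a, A (i k) a ^ 2 := by
      simp_rw [mul_pow, agree_sq]
      exact sum_mul_agree k i fun a => A (i k) a ^ 2
    rw [e1]
    refine hcs.trans (le_of_eq ?_)
    rw [e2]
    simp_rw [mul_pow, agree_sq]
  refine (Finset.sum_le_sum fun i _ => h1 i).trans (le_of_eq ?_)
  simp_rw [Finset.mul_sum]
  rw [Finset.sum_comm]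
  refine Finset.sum_congr rfl fun j _ => ?_
  have := sum_mul_agree k j fun b => ∑ a, A b a ^ 2
  rw [frobNorm_sq, ← this, Finset.sum_mul]
  refine Finset.sum_congr rfl fun i _ => ?_
  rw [agree_comm]
  ring

lemma frobNorm_one_sq : frobNorm (1 : Matrix (Idx d) (Idx d) ℝ) ^ 2 = ((∏ l, d l : ℕ) : ℝ) := by
  rw [← frobInner_self, frobInner_one_right, Matrix.trace_one]
  simp

/-- Pythagoras: the identity and the trace-free embeddings in different modes are pairwise
orthogonal. -/
lemma frobNorm_sq_of_traceless (τ : ℝ) {B : Factors d} (hB : ∀ k, (B k).trace = 0) :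
    frobNorm (τ • (1 : Matrix (Idx d) (Idx d) ℝ) + ∑ k, embed k (B k)) ^ 2
      = ((∏ l, d l : ℕ) : ℝ) * τ ^ 2 + ∑ k, (coDim d k : ℝ) * frobNorm (B k) ^ 2 := by
  rw [frobNorm_add_sq, frobNorm_smul, mul_pow, sq_abs, frobNorm_one_sq, frobInner_comm,
    frobInner_smul_right, frobInner_one_right, Matrix.trace_sum,
    Finset.sum_eq_zero fun k _ => trace_embed_eq_zero k (hB k), ← frobInner_self (∑ k, _),
    frobInner_sum_left]
  have : ∀ k, frobInner (embed k (B k)) (∑ l, embed l (B l))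
      = (coDim d k : ℝ) * frobNorm (B k) ^ 2 := fun k => by
    rw [frobInner_sum_right, Finset.sum_eq_single k
      (fun l _ hl => frobInner_embed_of_ne hl.symm (hB k) _) (by simp), frobInner_embed_self,
      frobInner_self]
  simp_rw [this]
  ring

/-- Cauchy–Schwarz over the L + 1 orthogonal pieces. Each piece has operator norm at most the norm
of its small factor, whose square enters the squared Frobenius norm with weight at least m. -/
lemma opNorm_sq_le_of_traceless (τ : ℝ) {B : Factors d} (hB : ∀ k, (B k).trace = 0) {m : ℝ}
    (hm0 : 0 ≤ m) (hm : ∀ k, m ≤ coDim d k) (hmp : m ≤ ((∏ l, d l : ℕ) : ℝ)) :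
    m * opNorm (τ • (1 : Matrix (Idx d) (Idx d) ℝ) + ∑ k, embed k (B k)) ^ 2
      ≤ (L + 1) * frobNorm (τ • (1 : Matrix (Idx d) (Idx d) ℝ) + ∑ k, embed k (B k)) ^ 2 := by
  have h1 : opNorm (τ • (1 : Matrix (Idx d) (Idx d) ℝ) + ∑ k, embed k (B k))
      ≤ |τ| + ∑ k, frobNorm (B k) := by
    refine (opNorm_add_le _ _).trans (add_le_add ?_ ((opNorm_sum_le _ _).trans
      (Finset.sum_le_sum fun k _ => opNorm_embed_le k _)))
    rw [opNorm_smul]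
    exact mul_le_of_le_one_right (abs_nonneg _) opNorm_one_le
  have h2 := sq_sum_le_card_mul_sum_sq (s := (Finset.univ : Finset (Option (Fin L))))
    (f := fun o => o.elim |τ| fun k => frobNorm (B k))
  rw [Fintype.sum_option, Fintype.sum_option] at h2
  simp only [Option.elim_none, Option.elim_some, sq_abs, Finset.card_univ, Fintype.card_option,
    Fintype.card_fin, Nat.cast_add, Nat.cast_one] at h2
  have h3 := pow_le_pow_left₀ (opNorm_nonneg _) h1 2
  rw [frobNorm_sq_of_traceless τ hB]
  have h4 : m * (τ ^ 2 + ∑ k, frobNorm (B k) ^ 2)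
      ≤ ((∏ l, d l : ℕ) : ℝ) * τ ^ 2 + ∑ k, (coDim d k : ℝ) * frobNorm (B k) ^ 2 := by
    rw [mul_add, Finset.mul_sum]
    refine add_le_add (mul_le_mul_of_nonneg_right hmp (sq_nonneg _))
      (Finset.sum_le_sum fun k _ => mul_le_mul_of_nonneg_right (hm k) (sq_nonneg _))
  calc _ ≤ m * ((L + 1) * (τ ^ 2 + ∑ k, frobNorm (B k) ^ 2)) :=
        mul_le_mul_of_nonneg_left (h3.trans h2) hm0
    _ = (L + 1) * (m * (τ ^ 2 + ∑ k, frobNorm (B k) ^ 2)) := by ring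
    _ ≤ _ := mul_le_mul_of_nonneg_left h4 (by positivity)

/-- The normalized trace of a Kronecker sum. -/
def kronTrace (A : Factors d) : ℝ := ∑ k, (A k).trace / d k

lemma kronSum_eq_trace_add_center (A : Factors d) :
    kronSum A = kronTrace A • (1 : Matrix (Idx d) (Idx d) ℝ) + ∑ k, embed k (center (A k)) := by
  rw [kronSum_eq, kronTrace, Finset.sum_smul, ← Finset.sum_add_distrib]
  refine Finset.sum_congr rfl fun k _ => ?_
  rw [center_apply, map_sub, map_smul, embed_one, Fintype.card_fin]
  abel

lemma opNorm_kronSum_sq_le (hd : ∀ k, 0 < d k) (A : Factors d) {m : ℝ}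
    (hm0 : 0 ≤ m) (hm : ∀ k, m ≤ coDim d k) (hmp : m ≤ ((∏ l, d l : ℕ) : ℝ)) :
    m * opNorm (kronSum A) ^ 2 ≤ (L + 1) * frobNorm (kronSum A) ^ 2 := by
  rw [kronSum_eq_trace_add_center]
  have : ∀ k, Nonempty (Fin (d k)) := fun k => ⟨⟨0, hd k⟩⟩
  exact opNorm_sq_le_of_traceless _ (fun k => trace_center (A k)) hm0 hm hmp

/-- When two positions differ in mode k alone, every other mode contributes zero. -/
lemma kronSum_apply_update (B : Factors d) (k : Fin L) (i : Idx d) {b : Fin (d k)}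
    (hb : i k ≠ b) : kronSum B i (Function.update i k b) = B k (i k) b := by
  rw [kronSum_eq, Matrix.sum_apply, Finset.sum_eq_single k]
  · rw [embed_apply, Function.update_self, agree, Finset.prod_eq_one, mul_one]
    intro l hl
    rw [Function.update_of_ne (Finset.ne_of_mem_erase hl), if_pos rfl]
  · intro l _ hl
    rw [embed_apply, agree, Finset.prod_eq_zero
      (Finset.mem_erase.2 ⟨hl.symm, Finset.mem_univ k⟩), mul_zero]
    rw [Function.update_self, if_neg hb]
  · simp

/-- The off-diagonal entries of the factors are determined by the Kronecker sum. -/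
lemma factors_apply_eq_of_kronSum_eq (hd : ∀ k, 0 < d k) {A B : Factors d}
    (h : kronSum A = kronSum B) (k : Fin L) {a b : Fin (d k)} (hab : a ≠ b) :
    A k a b = B k a b := by
  set i : Idx d := Function.update (fun l => ⟨0, hd l⟩) k a with hi
  have hik : i k = a := Function.update_self ..
  have h1 := kronSum_apply_update A k i (b := b) (by rwa [hik])
  have h2 := kronSum_apply_update B k i (b := b) (by rwa [hik])
  rw [hik] at h1 h2
  rw [← h1, ← h2, h]

/-- Multiples of the identity can be moved between factors, so the factors are not unique; the
penalty ignores the diagonals and is not affected. -/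
lemma objective_congr (hd : ∀ k, 0 < d k) (S : Matrix (Idx d) (Idx d) ℝ) (ρ : Fin L → ℝ)
    {A B : Factors d} (h : kronSum A = kronSum B) : objective S ρ A = objective S ρ B := by
  unfold objective
  rw [h]
  congr 1
  refine Finset.sum_congr rfl fun k _ => ?_
  congr 1
  unfold offOne
  refine Finset.sum_congr rfl fun a _ => Finset.sum_congr rfl fun b _ => ?_
  split_ifs with hab
  · rfl
  · rw [factors_apply_eq_of_kronSum_eq hd h k hab]

/-! ### Diagonal Kronecker sums -/

/-- Parameters of diagonal Kronecker sums: the trace part and the diagonals of the factors. -/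
abbrev DiagIdx (d : Fin L → ℕ) : Type := Option (Σ k, Fin (d k))

/-- A parametrization of the diagonal Kronecker sums that does not increase the norm. -/
def diagKron (d : Fin L → ℕ) : (DiagIdx d → ℝ) →ₗ[ℝ] Matrix (Idx d) (Idx d) ℝ :=
  (Real.sqrt ((∏ l, d l : ℕ) : ℝ))⁻¹ •
      ((LinearMap.proj (R := ℝ) (φ := fun _ : DiagIdx d => ℝ) none).smulRight 1)
    + ∑ k, (Real.sqrt (coDim d k))⁻¹ •
      ((embed k).comp (center.comp ((Matrix.diagonalLinearMap (Fin (d k)) ℝ ℝ).comp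
        (LinearMap.pi fun a =>
          LinearMap.proj (R := ℝ) (φ := fun _ : DiagIdx d => ℝ) (some ⟨k, a⟩)))))

lemma diagKron_apply (w : DiagIdx d → ℝ) :
    diagKron d w = ((Real.sqrt ((∏ l, d l : ℕ) : ℝ))⁻¹ * w none) • 1
      + ∑ k, embed k (center ((Real.sqrt (coDim d k))⁻¹ •
          Matrix.diagonal fun a => w (some ⟨k, a⟩))) := by
  simp only [diagKron, LinearMap.add_apply, LinearMap.smul_apply, LinearMap.sum_apply,
    LinearMap.smulRight_apply, LinearMap.proj_apply, LinearMap.comp_apply, map_smul, smul_smul]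
  rfl

lemma coDim_pos (hd : ∀ k, 0 < d k) (k : Fin L) : 0 < coDim d k :=
  Finset.prod_pos fun l _ => hd l

lemma sum_diagIdx (f : DiagIdx d → ℝ) :
    ∑ o, f o = f none + ∑ k, ∑ a, f (some ⟨k, a⟩) := by
  rw [Fintype.sum_option, Fintype.sum_sigma]

lemma frobNorm_diagonal_sq {n : Type*} [Fintype n] [DecidableEq n] (v : n → ℝ) :
    frobNorm (Matrix.diagonal v) ^ 2 = ∑ i, v i ^ 2 := by
  rw [frobNorm_sq]
  refine Finset.sum_congr rfl fun i _ => ?_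
  rw [Finset.sum_eq_single i] <;> simp +contextual [eq_comm]

lemma frobNorm_diagKron_sq_le (hd : ∀ k, 0 < d k) (w : DiagIdx d → ℝ) :
    frobNorm (diagKron d w) ^ 2 ≤ ∑ o, w o ^ 2 := by
  have : ∀ k, Nonempty (Fin (d k)) := fun k => ⟨⟨0, hd k⟩⟩
  have hp : 0 < ((∏ l, d l : ℕ) : ℝ) := by exact_mod_cast Finset.prod_pos fun l _ => hd l
  rw [diagKron_apply, frobNorm_sq_of_traceless _ (fun k => trace_center _), sum_diagIdx]
  refine add_le_add (le_of_eq ?_) (Finset.sum_le_sum fun k _ => ?_)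
  · rw [mul_pow, inv_pow, Real.sq_sqrt hp.le]
    field_simp
  · have hm : 0 < (coDim d k : ℝ) := by exact_mod_cast coDim_pos hd k
    calc _ ≤ (coDim d k : ℝ) * frobNorm ((Real.sqrt (coDim d k))⁻¹ •
          Matrix.diagonal fun a => w (some ⟨k, a⟩)) ^ 2 := by
          exact mul_le_mul_of_nonneg_left (frobNorm_center_le _) hm.le
      _ = _ := by
          rw [frobNorm_smul, mul_pow, sq_abs, inv_pow, Real.sq_sqrt hm.le, frobNorm_diagonal_sq]
          field_simp

lemma opNorm_diagKron_sq_le (hd : ∀ k, 0 < d k) (w : DiagIdx d → ℝ) {m : ℝ}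
    (hm0 : 0 ≤ m) (hm : ∀ k, m ≤ coDim d k) (hmp : m ≤ ((∏ l, d l : ℕ) : ℝ)) :
    m * opNorm (diagKron d w) ^ 2 ≤ (L + 1) * ∑ o, w o ^ 2 := by
  have : ∀ k, Nonempty (Fin (d k)) := fun k => ⟨⟨0, hd k⟩⟩
  have h1 := frobNorm_diagKron_sq_le hd w
  rw [diagKron_apply] at h1 ⊢
  refine (opNorm_sq_le_of_traceless _ (fun k => trace_center (n := Fin (d k)) _) hm0 hm hmp).trans ?_
  gcongr

/-- The diagonal part of a Kronecker sum in the coordinates of `diagKron`. -/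
def diagCoord (A : Factors d) : DiagIdx d → ℝ
  | none => Real.sqrt ((∏ l, d l : ℕ) : ℝ) * kronTrace A
  | some ⟨k, a⟩ => Real.sqrt (coDim d k) * center (A k) a a

lemma kronSum_eq_diag_add_off (hd : ∀ k, 0 < d k) (A : Factors d) :
    kronSum A = diagKron d (diagCoord A)
      + ∑ k, ∑ a, ∑ b, (if a = b then 0 else A k a b) • embed k (Matrix.single a b (1 : ℝ)) := by
  have hne : ∀ k, Nonempty (Fin (d k)) := fun k => ⟨⟨0, hd k⟩⟩
  have hp : 0 < ((∏ l, d l : ℕ) : ℝ) := by exact_mod_cast Finset.prod_pos fun l _ => hd l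
  rw [kronSum_eq_trace_add_center, diagKron_apply, add_assoc, ← Finset.sum_add_distrib]
  congr 1
  · simp only [diagCoord]
    rw [inv_mul_cancel_left₀ (Real.sqrt_pos.2 hp).ne']
  · refine Finset.sum_congr rfl fun k _ => ?_
    have hm : 0 < (coDim d k : ℝ) := by exact_mod_cast coDim_pos hd k
    have h1 : ((Real.sqrt (coDim d k))⁻¹ • Matrix.diagonal fun a => diagCoord A (some ⟨k, a⟩))
        = Matrix.diagonal (center (A k)).diag := by
      rw [← Matrix.diagonal_smul]
      congr 1
      ext a
      simp only [diagCoord, Pi.smul_apply, smul_eq_mul, Matrix.diag_apply]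
      rw [inv_mul_cancel_left₀ (Real.sqrt_pos.2 hm).ne']
    have h2 : center (Matrix.diagonal (center (A k)).diag)
        = Matrix.diagonal (center (A k)).diag :=
      center_eq_self (by rw [Matrix.trace_diagonal]; exact trace_center (A k))
    have h3 : ∀ a b : Fin (d k), (if a = b then 0 else center (A k) a b)
        = if a = b then 0 else A k a b := fun a b => by
      split_ifs with h
      · rfl
      · simp [center_apply, Matrix.one_apply_ne h]
    rw [h1, h2]
    conv_lhs => rw [eq_diagonal_add_sum_single (center (A k))]
    simp only [map_add, map_sum, map_smul, h3]

/-- The weights √p and √m_k in `diagCoord` make the splitting orthogonal, so the diagonal and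
off-diagonal contributions can be bounded separately without loss. -/
lemma frobNorm_kronSum_sq (hd : ∀ k, 0 < d k) (A : Factors d) :
    frobNorm (kronSum A) ^ 2
      = ∑ o, diagCoord A o ^ 2 + ∑ k, (coDim d k : ℝ) * offSq (A k) := by
  have hne : ∀ k, Nonempty (Fin (d k)) := fun k => ⟨⟨0, hd k⟩⟩
  rw [kronSum_eq_trace_add_center, frobNorm_sq_of_traceless _ (fun k => trace_center (A k)),
    sum_diagIdx, add_assoc, ← Finset.sum_add_distrib]
  congr 1
  · simp only [diagCoord]
    rw [mul_pow, Real.sq_sqrt (Nat.cast_nonneg _)]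
  · refine Finset.sum_congr rfl fun k _ => ?_
    rw [frobNorm_sq_eq_diag_add_offSq, offSq_center, mul_add, Finset.mul_sum]
    congr 1
    refine Finset.sum_congr rfl fun a _ => ?_
    simp only [diagCoord]
    rw [mul_pow, Real.sq_sqrt (Nat.cast_nonneg _)]

end Kronecker


/-! ### Square roots, condition numbers and the log-determinant -/

section LogDet

set_option linter.unusedSectionVars false

variable {n : Type*} [Fintype n] [DecidableEq n]

lemma one_add_smul_eq_conj {A : Matrix n n ℝ} (hA : A.IsHermitian) (t : ℝ) :
    1 + t • A = (hA.eigenvectorUnitary : Matrix n n ℝ) *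
      (Matrix.diagonal fun j => 1 + t * hA.eigenvalues j) *
        star (hA.eigenvectorUnitary : Matrix n n ℝ) := by
  have : (Matrix.diagonal fun j => 1 + t * hA.eigenvalues j)
      = 1 + t • Matrix.diagonal (RCLike.ofReal ∘ hA.eigenvalues : n → ℝ) := by
    rw [← Matrix.diagonal_one, ← Matrix.diagonal_smul, Matrix.diagonal_add]
    rfl
  rw [← Unitary.conjStarAlgAut_apply (S := ℝ), this, map_add, map_one, map_smul,
    ← hA.spectral_theorem]

lemma isUnit_eigenvectorUnitary {A : Matrix n n ℝ} (hA : A.IsHermitian) :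
    IsUnit (hA.eigenvectorUnitary : Matrix n n ℝ) :=
  IsUnit.of_mul_eq_one _ (Unitary.mul_star_self_of_mem hA.eigenvectorUnitary.2)

lemma posDef_one_add_smul_iff {A : Matrix n n ℝ} (hA : A.IsHermitian) (t : ℝ) :
    (1 + t • A).PosDef ↔ ∀ j, 0 < 1 + t * hA.eigenvalues j := by
  rw [one_add_smul_eq_conj hA, Matrix.IsUnit.posDef_star_right_conjugate_iff
    (isUnit_eigenvectorUnitary hA), Matrix.posDef_diagonal_iff]

open scoped Matrix.Norms.L2Operator in
lemma opNorm_le_of_eigenvalues {A : Matrix n n ℝ} (hA : A.IsHermitian) {c : ℝ} (hc : 0 ≤ c)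
    (h : ∀ j, |hA.eigenvalues j| ≤ c) : opNorm A ≤ c := by
  have hU : opNorm (hA.eigenvectorUnitary : Matrix n n ℝ) ≤ 1 := by
    have h1 := opNorm_transpose_mul_self (hA.eigenvectorUnitary : Matrix n n ℝ)
    rw [← Matrix.conjTranspose_eq_transpose_of_trivial, ← Matrix.star_eq_conjTranspose,
      Unitary.star_mul_self_of_mem hA.eigenvectorUnitary.2] at h1
    have h2 := opNorm_one_le (n := n)
    rw [h1] at h2
    exact (sq_le_one_iff₀ (opNorm_nonneg _)).1 h2
  have hU' : opNorm (star (hA.eigenvectorUnitary : Matrix n n ℝ)) ≤ 1 := by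
    rw [Matrix.star_eq_conjTranspose, Matrix.conjTranspose_eq_transpose_of_trivial,
      opNorm_transpose]
    exact hU
  have hD : opNorm (Matrix.diagonal (RCLike.ofReal ∘ hA.eigenvalues : n → ℝ)) ≤ c := by
    rw [opNorm_eq_norm, Matrix.l2_opNorm_diagonal]
    exact (pi_norm_le_iff_of_nonneg hc).2 h
  rw [hA.spectral_theorem, Unitary.conjStarAlgAut_apply]
  calc _ ≤ opNorm _ * opNorm _ := opNorm_mul_le _ _
    _ ≤ (opNorm _ * opNorm _) * opNorm _ :=
      mul_le_mul_of_nonneg_right (opNorm_mul_le _ _) (opNorm_nonneg _)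
    _ ≤ (1 * c) * 1 := by
      refine mul_le_mul (mul_le_mul hU hD (opNorm_nonneg _) zero_le_one) hU' (opNorm_nonneg _)
        (by positivity)
    _ = c := by ring

variable {Ω : Matrix n n ℝ}

open scoped MatrixOrder in
lemma matSqrt_posSemidef (A : Matrix n n ℝ) : (matSqrt A).PosSemidef :=
  Matrix.nonneg_iff_posSemidef.1 (CFC.sqrt_nonneg A)

open scoped MatrixOrder in
lemma matSqrt_mul_self {A : Matrix n n ℝ} (hA : A.PosSemidef) : matSqrt A * matSqrt A = A :=
  CFC.sqrt_mul_sqrt_self A (Matrix.nonneg_iff_posSemidef.2 hA)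

lemma transpose_matSqrt (A : Matrix n n ℝ) : (matSqrt A).transpose = matSqrt A :=
  transpose_eq_of_isHermitian (matSqrt_posSemidef A).1

lemma opNorm_matSqrt_sq {A : Matrix n n ℝ} (hA : A.PosSemidef) :
    opNorm (matSqrt A) ^ 2 = opNorm A := by
  rw [← opNorm_transpose_mul_self, transpose_matSqrt, matSqrt_mul_self hA]

lemma opNorm_conj_matSqrt_le {A : Matrix n n ℝ} (hA : A.PosSemidef) (M : Matrix n n ℝ) :
    opNorm (matSqrt A * M * matSqrt A) ≤ opNorm A * opNorm M := by
  rw [← opNorm_matSqrt_sq hA]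
  calc _ ≤ opNorm (matSqrt A * M) * opNorm (matSqrt A) := opNorm_mul_le _ _
    _ ≤ (opNorm (matSqrt A) * opNorm M) * opNorm (matSqrt A) :=
      mul_le_mul_of_nonneg_right (opNorm_mul_le _ _) (opNorm_nonneg _)
    _ = _ := by ring

lemma frobNorm_conj_le (R M : Matrix n n ℝ) :
    frobNorm (R * M * R) ≤ opNorm R ^ 2 * frobNorm M := by
  calc _ ≤ frobNorm (R * M) * opNorm R := frobNorm_mul_le' _ _
    _ ≤ (opNorm R * frobNorm M) * opNorm R :=
      mul_le_mul_of_nonneg_right (frobNorm_mul_le _ _) (opNorm_nonneg _)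
    _ = _ := by ring

lemma frobNorm_conj_matSqrt_le {A : Matrix n n ℝ} (hA : A.PosSemidef) (M : Matrix n n ℝ) :
    frobNorm (matSqrt A * M * matSqrt A) ≤ opNorm A * frobNorm M := by
  rw [← opNorm_matSqrt_sq hA]; exact frobNorm_conj_le _ _

lemma inv_mul_self_of_posDef (hΩ : Ω.PosDef) : Ω⁻¹ * Ω = 1 :=
  Matrix.nonsing_inv_mul _ ((Matrix.isUnit_iff_isUnit_det _).1 hΩ.isUnit)

lemma matSqrt_inv_mul_mul (hΩ : Ω.PosDef) : matSqrt Ω⁻¹ * Ω * matSqrt Ω⁻¹ = 1 := by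
  rw [mul_eq_one_comm, ← mul_assoc, matSqrt_mul_self hΩ.inv.posSemidef,
    inv_mul_self_of_posDef hΩ]

/-- The matrix `Ω * matSqrt Ω⁻¹` plays the part of Ω^{1/2}: multiplied by its transpose it gives Ω.
-/
lemma opNorm_mul_matSqrt_inv_sq (hΩ : Ω.PosDef) :
    opNorm (Ω * matSqrt Ω⁻¹) ^ 2 = opNorm Ω := by
  rw [← opNorm_transpose, ← opNorm_transpose_mul_self, Matrix.transpose_transpose,
    Matrix.transpose_mul, transpose_matSqrt, transpose_eq_of_isHermitian hΩ.1, mul_assoc,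
    ← mul_assoc (matSqrt Ω⁻¹), matSqrt_mul_self hΩ.inv.posSemidef, inv_mul_self_of_posDef hΩ,
    mul_one]

/-- Undoing the conjugation by `Ω^{-1/2}`. -/
lemma conj_matSqrt_inv_cancel (hΩ : Ω.PosDef) (M : Matrix n n ℝ) :
    (Ω * matSqrt Ω⁻¹) * (matSqrt Ω⁻¹ * M * matSqrt Ω⁻¹) * (Ω * matSqrt Ω⁻¹) = M := by
  have h1 : Ω * matSqrt Ω⁻¹ * matSqrt Ω⁻¹ = 1 := by
    rw [mul_assoc, matSqrt_mul_self hΩ.inv.posSemidef, mul_eq_one_comm,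
      inv_mul_self_of_posDef hΩ]
  have h2 : matSqrt Ω⁻¹ * (Ω * matSqrt Ω⁻¹) = 1 := by
    rw [← mul_assoc]; exact matSqrt_inv_mul_mul hΩ
  calc _ = (Ω * matSqrt Ω⁻¹ * matSqrt Ω⁻¹) * M * (matSqrt Ω⁻¹ * (Ω * matSqrt Ω⁻¹)) := by
        simp only [mul_assoc]
    _ = M := by rw [h1, h2, one_mul, mul_one]

lemma frobNorm_le_opNorm_mul_frobNorm_conj (hΩ : Ω.PosDef) (M : Matrix n n ℝ) :
    frobNorm M ≤ opNorm Ω * frobNorm (matSqrt Ω⁻¹ * M * matSqrt Ω⁻¹) := by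
  conv_lhs => rw [← conj_matSqrt_inv_cancel hΩ M]
  rw [← opNorm_mul_matSqrt_inv_sq hΩ]
  exact frobNorm_conj_le _ _

lemma isHermitian_conj_matSqrt (A : Matrix n n ℝ) {M : Matrix n n ℝ} (hM : M.IsHermitian) :
    (matSqrt A * M * matSqrt A).IsHermitian := by
  have := Matrix.isHermitian_mul_mul_conjTranspose (matSqrt A) hM
  rwa [(matSqrt_posSemidef A).1.eq] at this

lemma conj_matSqrt_add_smul (hΩ : Ω.PosDef) (M : Matrix n n ℝ) (t : ℝ) :
    matSqrt Ω⁻¹ * (Ω + t • M) * matSqrt Ω⁻¹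
      = 1 + t • (matSqrt Ω⁻¹ * M * matSqrt Ω⁻¹) := by
  rw [mul_add, add_mul, matSqrt_inv_mul_mul hΩ, Matrix.mul_smul, Matrix.smul_mul]

lemma isUnit_matSqrt_inv (hΩ : Ω.PosDef) : IsUnit (matSqrt Ω⁻¹) :=
  IsUnit.of_mul_eq_one (Ω * matSqrt Ω⁻¹) (by rw [← mul_assoc]; exact matSqrt_inv_mul_mul hΩ)

lemma posDef_add_smul_iff (hΩ : Ω.PosDef) (M : Matrix n n ℝ) (t : ℝ) :
    (Ω + t • M).PosDef ↔ (1 + t • (matSqrt Ω⁻¹ * M * matSqrt Ω⁻¹)).PosDef := by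
  rw [← conj_matSqrt_add_smul hΩ]
  have := Matrix.IsUnit.posDef_star_right_conjugate_iff (x := Ω + t • M) (isUnit_matSqrt_inv hΩ)
  rw [Matrix.star_eq_conjTranspose, (matSqrt_posSemidef _).1.eq] at this
  exact this.symm

lemma det_add_smul (hΩ : Ω.PosDef) (M : Matrix n n ℝ) (t : ℝ) :
    (Ω + t • M).det = Ω.det * (1 + t • (matSqrt Ω⁻¹ * M * matSqrt Ω⁻¹)).det := by
  have h1 := congrArg Matrix.det (conj_matSqrt_add_smul hΩ M t)
  have h2 := congrArg Matrix.det (matSqrt_inv_mul_mul hΩ)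
  rw [Matrix.det_mul, Matrix.det_mul] at h1 h2
  rw [Matrix.det_one] at h2
  rw [← h1]
  linear_combination (-(Ω + t • M).det) * h2

/-- In the coordinates conjugated by Ω^{-1/2} the log-determinant along a segment is a sum of scalar
logarithms. Curvature and concavity both become one-variable facts. -/
lemma log_det_add_smul (hΩ : Ω.PosDef) {M : Matrix n n ℝ} (hM : M.IsHermitian) {t : ℝ}
    (h : ∀ j, 0 < 1 + t * (isHermitian_conj_matSqrt Ω⁻¹ hM).eigenvalues j) :
    Real.log (Ω + t • M).det
      = Real.log Ω.det + ∑ j, Real.log (1 + t * (isHermitian_conj_matSqrt Ω⁻¹ hM).eigenvalues j) := by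
  rw [det_add_smul hΩ, det_one_add_smul_eq_prod (isHermitian_conj_matSqrt Ω⁻¹ hM),
    Real.log_mul hΩ.det_pos.ne' (Finset.prod_ne_zero_iff.2 fun j _ => (h j).ne'),
    Real.log_prod fun j _ => (h j).ne']

lemma trace_conj_matSqrt (hΩ : Ω.PosDef) (M : Matrix n n ℝ) :
    (matSqrt Ω⁻¹ * M * matSqrt Ω⁻¹).trace = (Ω⁻¹ * M).trace := by
  rw [Matrix.trace_mul_comm, ← mul_assoc, matSqrt_mul_self hΩ.inv.posSemidef]

/-- Half of the second-order term −x²/2 is given up to absorb the remainder |x|³/(1 − |x|), which is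
at most x²/4 exactly when |x| ≤ 1/5. -/
lemma log_one_add_le_sub_sq {x : ℝ} (hx : |x| ≤ 1 / 5) : Real.log (1 + x) ≤ x - x ^ 2 / 4 := by
  have h := Real.abs_log_sub_add_sum_range_le (x := -x) (by rw [abs_neg]; linarith) 2
  rw [abs_neg, Finset.sum_range_succ, Finset.sum_range_one, sub_neg_eq_add] at h
  have h1 := (abs_le.1 h).2
  have h2 : |x| ^ (2 + 1) / (1 - |x|) ≤ x ^ 2 / 4 := by
    rw [div_le_div_iff₀ (by linarith) (by norm_num), ← sq_abs x]
    have h3 := mul_nonneg (sq_nonneg |x|) (show 0 ≤ 1 - 5 * |x| by linarith)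
    have h4 : |x| ^ (2 + 1) = |x| ^ 2 * |x| := pow_succ _ _
    rw [h4]
    linarith
  norm_num at h1
  linarith

/-- Near `Ω`, the negative log-determinant exceeds its linearization by a quadratic term. -/
lemma posDef_add_and_logDet_bound (hΩ : Ω.PosDef) {M : Matrix n n ℝ} (hM : M.IsHermitian)
    (h : opNorm Ω⁻¹ * opNorm M ≤ 1 / 5) :
    (Ω + M).PosDef ∧
      Real.log (Ω + M).det * (4 * opNorm Ω ^ 2) + frobNorm M ^ 2
        ≤ (Real.log Ω.det + (Ω⁻¹ * M).trace) * (4 * opNorm Ω ^ 2) := by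
  set hH := isHermitian_conj_matSqrt Ω⁻¹ hM
  have hj : ∀ j, |hH.eigenvalues j| ≤ 1 / 5 := fun j =>
    ((abs_eigenvalues_le_opNorm hH j).trans
      (opNorm_conj_matSqrt_le hΩ.inv.posSemidef M)).trans h
  have hpos : ∀ j, 0 < 1 + 1 * hH.eigenvalues j := fun j => by
    have := (abs_le.1 (hj j)).1
    linarith
  have hlog := log_det_add_smul hΩ hM hpos
  have hpd := (posDef_add_smul_iff hΩ M 1).2 ((posDef_one_add_smul_iff hH 1).2 hpos)
  rw [one_smul] at hlog hpd
  refine ⟨hpd, ?_⟩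
  have h1 : ∑ j, Real.log (1 + 1 * hH.eigenvalues j)
      ≤ (Ω⁻¹ * M).trace - frobNorm (matSqrt Ω⁻¹ * M * matSqrt Ω⁻¹) ^ 2 / 4 := by
    rw [← trace_conj_matSqrt hΩ, trace_eq_sum_eigenvalues' hH, frobNorm_sq_eq_sum_eigenvalues hH,
      Finset.sum_div, ← Finset.sum_sub_distrib]
    refine Finset.sum_le_sum fun j _ => ?_
    rw [one_mul]
    exact log_one_add_le_sub_sq (hj j)
  -- The curvature is in terms of the conjugated perturbation; undoing the conjugation costs ‖Ω‖,
  -- squared.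
  have h2 := pow_le_pow_left₀ (frobNorm_nonneg M) (frobNorm_le_opNorm_mul_frobNorm_conj hΩ M) 2
  rw [hlog]
  rw [mul_pow] at h2
  have h3 := mul_le_mul_of_nonneg_right h1 (show 0 ≤ 4 * opNorm Ω ^ 2 by positivity)
  linarith

/-- Concavity of the log-determinant along segments. -/
lemma logDet_segment_ge (hΩ : Ω.PosDef) {M : Matrix n n ℝ} (hM : (Ω + M).PosDef) {t : ℝ}
    (h0 : 0 ≤ t) (h1 : t ≤ 1) :
    (1 - t) * Real.log Ω.det + t * Real.log (Ω + M).det ≤ Real.log (Ω + t • M).det := by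
  have hMh : M.IsHermitian := by
    have := hM.1.sub hΩ.1
    rwa [add_sub_cancel_left] at this
  set hH := isHermitian_conj_matSqrt Ω⁻¹ hMh
  have hpos : ∀ j, 0 < 1 + 1 * hH.eigenvalues j := by
    refine (posDef_one_add_smul_iff hH 1).1 ((posDef_add_smul_iff hΩ M 1).1 ?_)
    rwa [one_smul]
  -- 1 + tλ is a convex combination of 1 and 1 + λ.
  have hpos' : ∀ j, 0 < 1 + t * hH.eigenvalues j := fun j => by
    have := hpos j
    rcases h1.lt_or_eq with h | h
    · nlinarith
    · rw [h]; exact this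
  have hlog := log_det_add_smul hΩ hMh hpos
  rw [one_smul] at hlog
  rw [log_det_add_smul hΩ hMh hpos', hlog]
  have : t * ∑ j, Real.log (1 + 1 * hH.eigenvalues j)
      ≤ ∑ j, Real.log (1 + t * hH.eigenvalues j) := by
    rw [Finset.mul_sum]
    refine Finset.sum_le_sum fun j _ => ?_
    have := strictConcaveOn_log_Ioi.concaveOn.2 (Set.mem_Ioi.2 (hpos j))
      (Set.mem_Ioi.2 zero_lt_one) h0 (sub_nonneg.2 h1) (by ring)
    simp only [smul_eq_mul, Real.log_one, mul_zero, add_zero] at this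
    refine this.trans (le_of_eq ?_)
    congr 1
    ring
  linarith

lemma phiMin_pos [Nonempty n] {A : Matrix n n ℝ} (hA : A.PosDef) : 0 < phiMin A := by
  unfold phiMin
  have hne : (spectrum ℝ A).Nonempty := by
    rw [hA.1.spectrum_real_eq_range_eigenvalues]; exact Set.range_nonempty _
  have hmem := hne.csInf_mem (Matrix.finite_real_spectrum (A := A))
  rw [hA.1.spectrum_real_eq_range_eigenvalues] at hmem
  obtain ⟨j, hj⟩ := hmem
  rw [hA.1.spectrum_real_eq_range_eigenvalues, ← hj]
  exact hA.eigenvalues_pos j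

lemma opNorm_le_phiMax [Nonempty n] {A : Matrix n n ℝ} (hA : A.PosDef) : opNorm A ≤ phiMax A := by
  have hle : ∀ j, hA.1.eigenvalues j ≤ phiMax A := fun j =>
    le_csSup (Matrix.finite_real_spectrum (A := A)).bddAbove (hA.1.eigenvalues_mem_spectrum_real j)
  refine opNorm_le_of_eigenvalues hA.1 ?_ fun j => ?_
  · exact (hA.eigenvalues_pos (Classical.arbitrary n)).le.trans (hle _)
  · rw [abs_of_pos (hA.eigenvalues_pos j)]; exact hle j

/-- Inverses of eigenvalues of Ω lie in the spectrum of Ω⁻¹, so they are at least its minimum. -/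
lemma opNorm_mul_phiMin_inv_le [Nonempty n] (hΩ : Ω.PosDef) : opNorm Ω * phiMin Ω⁻¹ ≤ 1 := by
  have hmin := phiMin_pos hΩ.inv
  rw [← le_div_iff₀ hmin]
  refine opNorm_le_of_eigenvalues hΩ.1 (by positivity) fun j => ?_
  have hj := hΩ.eigenvalues_pos j
  rw [abs_of_pos hj, le_div_comm₀ hj hmin, one_div]
  refine csInf_le (Matrix.finite_real_spectrum (A := Ω⁻¹)).bddBelow ?_
  have hmem := hΩ.1.eigenvalues_mem_spectrum_real j
  generalize hΩ.1.eigenvalues j = r at hmem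
  obtain ⟨U, hU⟩ := hΩ.isUnit
  rw [← hU] at hmem
  have h2 := spectrum.inv₀_mem_inv_iff.2 hmem
  rwa [Matrix.coe_units_inv, hU] at h2

lemma opNorm_mul_opNorm_inv_le_condNum [Nonempty n] (hΩ : Ω.PosDef) :
    opNorm Ω⁻¹ * opNorm Ω ≤ condNum Ω⁻¹ := by
  unfold condNum
  rw [le_div_iff₀ (phiMin_pos hΩ.inv), mul_assoc]
  exact (mul_le_of_le_one_right (opNorm_nonneg _) (opNorm_mul_phiMin_inv_le hΩ)).trans
    (opNorm_le_phiMax hΩ.inv)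

lemma one_le_opNorm_inv_mul_opNorm [Nonempty n] (hΩ : Ω.PosDef) :
    1 ≤ opNorm Ω⁻¹ * opNorm Ω := by
  have h1 := opNorm_mul_le Ω⁻¹ Ω
  rw [inv_mul_self_of_posDef hΩ] at h1
  refine le_trans ?_ h1
  have := abs_diag_le_opNorm (1 : Matrix n n ℝ) (Classical.arbitrary n)
  simpa using this

lemma opNorm_pos [Nonempty n] (hΩ : Ω.PosDef) : 0 < opNorm Ω := by
  rcases (opNorm_nonneg Ω).lt_or_eq with h | h
  · exact h
  · have := one_le_opNorm_inv_mul_opNorm hΩ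
    rw [← h, mul_zero] at this
    linarith

end LogDet


/-! ### The basic inequality for the penalized likelihood -/

section Penalty

set_option linter.unusedSectionVars false

variable {n : Type*} [Fintype n] [DecidableEq n]

/-- The off-diagonal `ℓ₁` norm of `A` restricted to the support of `Ψ`. -/
def supportOne (Ψ A : Matrix n n ℝ) : ℝ :=
  ∑ i, ∑ j, if i ≠ j ∧ Ψ i j ≠ 0 then |A i j| else 0

/-- Off the support of Ψ the entries of Ψ + A are those of A and nothing is lost; on the support the
triangle inequality costs 2|A|. -/
lemma offOne_add_sub_ge (Ψ A : Matrix n n ℝ) :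
    -(2 * supportOne Ψ A) ≤ offOne (Ψ + A) - offOne Ψ - offOne A := by
  unfold supportOne offOne
  simp only [Finset.mul_sum, ← Finset.sum_sub_distrib, ← Finset.sum_neg_distrib]
  refine Finset.sum_le_sum fun i _ => Finset.sum_le_sum fun j _ => ?_
  by_cases hij : i = j
  · simp [hij]
  · by_cases hΨ : Ψ i j = 0
    · simp [hij, hΨ]
    · simp only [hij, hΨ, ne_eq, not_false_eq_true, and_self, if_true, if_false, Matrix.add_apply]
      have := abs_sub_abs_le_abs_sub (Ψ i j) (-A i j)
      rw [sub_neg_eq_add, abs_neg] at this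
      linarith

lemma supportOne_sq_le (Ψ A : Matrix n n ℝ) :
    supportOne Ψ A ^ 2 ≤ offSupportCard Ψ * offSq A := by
  have h1 : supportOne Ψ A
      = ∑ e ∈ Finset.univ.filter (fun e : n × n => e.1 ≠ e.2 ∧ Ψ e.1 e.2 ≠ 0), |A e.1 e.2| := by
    rw [Finset.sum_filter, Fintype.sum_prod_type]
    rfl
  have h2 : ∑ e ∈ Finset.univ.filter (fun e : n × n => e.1 ≠ e.2 ∧ Ψ e.1 e.2 ≠ 0),
      |A e.1 e.2| ^ 2 ≤ offSq A := by
    rw [Finset.sum_filter, Fintype.sum_prod_type]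
    unfold offSq
    refine Finset.sum_le_sum fun i _ => Finset.sum_le_sum fun j _ => ?_
    simp only [sq_abs]
    by_cases hij : i = j
    · simp [hij]
    · by_cases hΨ : Ψ i j = 0
      · simp [hij, hΨ, sq_nonneg]
      · simp [hij, hΨ]
  rw [h1]
  refine (sq_sum_le_card_mul_sum_sq (s := Finset.univ.filter
    (fun e : n × n => e.1 ≠ e.2 ∧ Ψ e.1 e.2 ≠ 0)) (f := fun e => |A e.1 e.2|)).trans ?_
  exact mul_le_mul_of_nonneg_left h2 (Nat.cast_nonneg _)

lemma supportOne_nonneg (Ψ A : Matrix n n ℝ) : 0 ≤ supportOne Ψ A :=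
  Finset.sum_nonneg fun _ _ => Finset.sum_nonneg fun _ _ => by split_ifs <;> positivity

end Penalty

/-! ### Localization of the minimizer on the score event -/

section Deterministic

variable {L : ℕ} {d : Fin L → ℕ}

/-- The centered linear part of the likelihood, as a linear functional. -/
def score (S Ω : Matrix (Idx d) (Idx d) ℝ) : Matrix (Idx d) (Idx d) ℝ →ₗ[ℝ] ℝ where
  toFun M := (S.transpose * M).trace - (Ω⁻¹ * M).trace
  map_add' A B := by simp only [mul_add, Matrix.trace_add]; ring
  map_smul' c A := by
    simp only [Matrix.mul_smul, Matrix.trace_smul, smul_eq_mul, RingHom.id_apply]; ring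

lemma score_apply (S Ω M : Matrix (Idx d) (Idx d) ℝ) :
    score S Ω M = (S.transpose * M).trace - (Ω⁻¹ * M).trace := rfl

/-- The event on which the estimator is analysed: the centered likelihood is small on diagonal
Kronecker sums and on the off-diagonal coordinates of the factors. -/
structure ScoreBound (f : Matrix (Idx d) (Idx d) ℝ →ₗ[ℝ] ℝ) (α : ℝ) (δ : Fin L → ℝ) : Prop where
  diag : ∀ w : DiagIdx d → ℝ, |f (diagKron d w)| ≤ α * Real.sqrt (∑ o, w o ^ 2)
  off : ∀ k (a b : Fin (d k)), a ≠ b →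
    |f (embed k (Matrix.single a b (1 : ℝ)))| ≤ coDim d k * δ k

/-- The penalty absorbs the off-diagonal score entry by entry because δ_k ≤ ρ_k, and what remains is
twice the penalty on the support. The unpenalized diagonal costs α. -/
lemma ScoreBound.score_add_penalty_ge (hd : ∀ k, 0 < d k)
    {f : Matrix (Idx d) (Idx d) ℝ →ₗ[ℝ] ℝ} {α β : ℝ} {δ ρ : Fin L → ℝ} (h : ScoreBound f α δ)
    (hα : 0 ≤ α) (hβ : 0 ≤ β) (hδρ : ∀ k, δ k ≤ ρ k) (hρ : ∀ k, 0 ≤ ρ k)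
    (hρβ : ∀ k, (coDim d k : ℝ) * ρ k ^ 2 ≤ β ^ 2) (Ψ A : Factors d) :
    -((α + 2 * β * Real.sqrt (∑ k, (offSupportCard (Ψ k) : ℝ))) * frobNorm (kronSum A))
      ≤ f (kronSum A)
        + ∑ k, (coDim d k : ℝ) * ρ k * (offOne (Ψ k + A k) - offOne (Ψ k)) := by
  have hF := frobNorm_kronSum_sq hd A
  set W := ∑ o, diagCoord A o ^ 2 with hW
  set V := ∑ k, (coDim d k : ℝ) * offSq (A k) with hV
  have hV0 : 0 ≤ V := Finset.sum_nonneg fun k _ => mul_nonneg (Nat.cast_nonneg _) (offSq_nonneg _)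
  have hW0 : 0 ≤ W := Finset.sum_nonneg fun o _ => sq_nonneg _
  have hWF : Real.sqrt W ≤ frobNorm (kronSum A) :=
    Real.sqrt_le_iff.2 ⟨frobNorm_nonneg _, by linarith⟩
  have hVF : Real.sqrt V ≤ frobNorm (kronSum A) :=
    Real.sqrt_le_iff.2 ⟨frobNorm_nonneg _, by linarith⟩
  have h1 : f (kronSum A) = f (diagKron d (diagCoord A)) + ∑ k, ∑ a, ∑ b,
      (if a = b then 0 else A k a b) * f (embed k (Matrix.single a b (1 : ℝ))) := by
    rw [kronSum_eq_diag_add_off hd A]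
    simp only [map_add, map_sum, map_smul, smul_eq_mul]
  have h2 : -(α * frobNorm (kronSum A)) ≤ f (diagKron d (diagCoord A)) := by
    have := (abs_le.1 (h.diag (diagCoord A))).1
    have := mul_le_mul_of_nonneg_left hWF hα
    linarith
  have h3 : ∀ k, -((coDim d k : ℝ) * ρ k * offOne (A k)) ≤ ∑ a, ∑ b,
      (if a = b then 0 else A k a b) * f (embed k (Matrix.single a b (1 : ℝ))) := fun k => by
    unfold offOne
    simp only [Finset.mul_sum, ← Finset.sum_neg_distrib]
    refine Finset.sum_le_sum fun a _ => Finset.sum_le_sum fun b _ => ?_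
    split_ifs with hab
    · simp
    · have e1 := h.off k a b hab
      have e2 : |f (embed k (Matrix.single a b (1 : ℝ)))| ≤ coDim d k * ρ k :=
        e1.trans (mul_le_mul_of_nonneg_left (hδρ k) (Nat.cast_nonneg _))
      have e3 := neg_abs_le (A k a b * f (embed k (Matrix.single a b (1 : ℝ))))
      rw [abs_mul] at e3
      have e4 := mul_le_mul_of_nonneg_left e2 (abs_nonneg (A k a b))
      linarith
  -- Since m_kρ_k² ≤ β², m_kρ_k ≤ β√m_k. The factor √m_k is the weight of mode k in the Frobenius
  -- norm, so Cauchy–Schwarz over modes produces √(∑ s_k).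
  have h4 : ∀ k, (coDim d k : ℝ) * ρ k * supportOne (Ψ k) (A k)
      ≤ β * (Real.sqrt (offSupportCard (Ψ k)) * Real.sqrt (coDim d k * offSq (A k))) := fun k => by
    have e1 : (coDim d k : ℝ) * ρ k ≤ β * Real.sqrt (coDim d k) := by
      refine abs_le_of_sq_le_sq' ?_ (by positivity) |>.2
      rw [mul_pow, mul_pow, Real.sq_sqrt (Nat.cast_nonneg _)]
      have := mul_le_mul_of_nonneg_left (hρβ k) (Nat.cast_nonneg (α := ℝ) (coDim d k))
      linarith
    have e2 : supportOne (Ψ k) (A k)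
        ≤ Real.sqrt (offSupportCard (Ψ k)) * Real.sqrt (offSq (A k)) := by
      rw [← Real.sqrt_mul (Nat.cast_nonneg _)]
      exact Real.le_sqrt_of_sq_le (supportOne_sq_le _ _)
    calc _ ≤ (β * Real.sqrt (coDim d k)) *
          (Real.sqrt (offSupportCard (Ψ k)) * Real.sqrt (offSq (A k))) :=
          mul_le_mul e1 e2 (supportOne_nonneg _ _) (by positivity)
      _ = _ := by rw [Real.sqrt_mul (Nat.cast_nonneg _)]; ring
  have h5 : ∑ k, (coDim d k : ℝ) * ρ k * supportOne (Ψ k) (A k)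
      ≤ β * (Real.sqrt (∑ k, (offSupportCard (Ψ k) : ℝ)) * frobNorm (kronSum A)) := by
    refine (Finset.sum_le_sum fun k _ => h4 k).trans ?_
    rw [← Finset.mul_sum]
    refine mul_le_mul_of_nonneg_left ?_ hβ
    refine (Real.sum_sqrt_mul_sqrt_le _ (fun k => Nat.cast_nonneg _)
      (fun k => mul_nonneg (Nat.cast_nonneg _) (offSq_nonneg _))).trans ?_
    exact mul_le_mul_of_nonneg_left hVF (Real.sqrt_nonneg _)
  have h6 : ∀ k, -(2 * ((coDim d k : ℝ) * ρ k * supportOne (Ψ k) (A k)))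
      + (coDim d k : ℝ) * ρ k * offOne (A k)
      ≤ (coDim d k : ℝ) * ρ k * (offOne (Ψ k + A k) - offOne (Ψ k)) := fun k => by
    have := mul_le_mul_of_nonneg_left (offOne_add_sub_ge (Ψ k) (A k))
      (mul_nonneg (Nat.cast_nonneg (α := ℝ) (coDim d k)) (hρ k))
    linarith
  have h7 := Finset.sum_le_sum (s := Finset.univ) fun k _ => h3 k
  have h8 := Finset.sum_le_sum (s := Finset.univ) fun k _ => h6 k
  rw [Finset.sum_add_distrib, Finset.sum_neg_distrib, ← Finset.mul_sum] at h8
  rw [Finset.sum_neg_distrib] at h7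
  rw [h1]
  linarith

variable {Ψ : Factors d} {S : Matrix (Idx d) (Idx d) ℝ} {ρ : Fin L → ℝ}

lemma objective_add_sub (A : Factors d) :
    objective S ρ (Ψ + A) - objective S ρ Ψ
      = -Real.log (kronSum Ψ + kronSum A).det + Real.log (kronSum Ψ).det
        + (S.transpose * kronSum A).trace
        + ∑ k, (coDim d k : ℝ) * ρ k * (offOne (Ψ k + A k) - offOne (Ψ k)) := by
  unfold objective
  rw [kronSum_add, mul_add, Matrix.trace_add]
  simp only [mul_sub, Finset.sum_sub_distrib, Pi.add_apply]
  ring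

lemma offOne_add_smul_le {n : Type*} [Fintype n] [DecidableEq n] (Ψ A : Matrix n n ℝ) {t : ℝ}
    (h0 : 0 ≤ t) (h1 : t ≤ 1) :
    offOne (Ψ + t • A) - offOne Ψ ≤ t * (offOne (Ψ + A) - offOne Ψ) := by
  unfold offOne
  simp only [← Finset.sum_sub_distrib, Finset.mul_sum]
  refine Finset.sum_le_sum fun i _ => Finset.sum_le_sum fun j _ => ?_
  split_ifs
  · simp
  · simp only [Matrix.add_apply, Matrix.smul_apply, smul_eq_mul]
    have e : Ψ i j + t * A i j = (1 - t) * Ψ i j + t * (Ψ i j + A i j) := by ring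
    rw [e]
    have := abs_add_le ((1 - t) * Ψ i j) (t * (Ψ i j + A i j))
    rw [abs_mul, abs_mul, abs_of_nonneg h0, abs_of_nonneg (sub_nonneg.2 h1)] at this
    linarith

/-- Convexity of the objective along segments starting at `Ψ`. -/
lemma objective_segment_le (hΨ : (kronSum Ψ).PosDef) (hρ : ∀ k, 0 ≤ ρ k) {A : Factors d}
    (hA : (kronSum Ψ + kronSum A).PosDef) {t : ℝ} (h0 : 0 ≤ t) (h1 : t ≤ 1) :
    objective S ρ (Ψ + t • A) - objective S ρ Ψ
      ≤ t * (objective S ρ (Ψ + A) - objective S ρ Ψ) := by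
  rw [objective_add_sub, objective_add_sub, kronSum_smul]
  have h2 := logDet_segment_ge hΨ hA h0 h1
  have h3 : ∑ k, (coDim d k : ℝ) * ρ k * (offOne (Ψ k + (t • A) k) - offOne (Ψ k))
      ≤ t * ∑ k, (coDim d k : ℝ) * ρ k * (offOne (Ψ k + A k) - offOne (Ψ k)) := by
    rw [Finset.mul_sum]
    refine Finset.sum_le_sum fun k _ => ?_
    have := mul_le_mul_of_nonneg_left (offOne_add_smul_le (Ψ k) (A k) h0 h1)
      (mul_nonneg (Nat.cast_nonneg (α := ℝ) (coDim d k)) (hρ k))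
    rw [Pi.smul_apply]
    linarith
  rw [Matrix.mul_smul, Matrix.trace_smul, smul_eq_mul]
  linarith

/-- Radius conditions for the localization argument. -/
structure RadiusBound (Ψ : Factors d) (m α β r : ℝ) : Prop where
  m_pos : 0 < m
  m_le : ∀ k, m ≤ coDim d k
  m_le_prod : m ≤ ((∏ l, d l : ℕ) : ℝ)
  r_pos : 0 < r
  small : 25 * opNorm (kronSum Ψ)⁻¹ ^ 2 * ((L + 1) * r ^ 2) ≤ m
  large : 4 * opNorm (kronSum Ψ) ^ 2 *
    (α + 2 * β * Real.sqrt (∑ k, (offSupportCard (Ψ k) : ℝ))) < r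

variable {m α β r : ℝ} {δ : Fin L → ℝ}

/-- The field `small` is designed for this: 25 = 5² matches the threshold 1/5 of the log-determinant
expansion, and (L+1)/m is the norm comparison for Kronecker sums. -/
lemma RadiusBound.opNorm_le (hR : RadiusBound Ψ m α β r) (hd : ∀ k, 0 < d k) {A : Factors d}
    (hA : frobNorm (kronSum A) ≤ r) :
    opNorm (kronSum Ψ)⁻¹ * opNorm (kronSum A) ≤ 1 / 5 := by
  have h1 := opNorm_kronSum_sq_le hd A hR.m_pos.le hR.m_le hR.m_le_prod
  have h2 := pow_le_pow_left₀ (frobNorm_nonneg _) hA 2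
  refine abs_le_of_sq_le_sq' ?_ (by norm_num) |>.2
  have h3 : m * (25 * (opNorm (kronSum Ψ)⁻¹ * opNorm (kronSum A)) ^ 2) ≤ m * 1 := by
    calc _ = 25 * opNorm (kronSum Ψ)⁻¹ ^ 2 * (m * opNorm (kronSum A) ^ 2) := by ring
      _ ≤ 25 * opNorm (kronSum Ψ)⁻¹ ^ 2 * ((L + 1) * r ^ 2) := by
        refine mul_le_mul_of_nonneg_left (h1.trans ?_) (by positivity)
        gcongr
      _ ≤ m * 1 := by rw [mul_one]; exact hR.small
  have := le_of_mul_le_mul_left h3 hR.m_pos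
  linarith

lemma RadiusBound.posDef (hR : RadiusBound Ψ m α β r) (hd : ∀ k, 0 < d k)
    (hΨ : (kronSum Ψ).PosDef) {A : Factors d} (hA : frobNorm (kronSum A) ≤ r)
    (hAh : (kronSum A).IsHermitian) : (kronSum Ψ + kronSum A).PosDef :=
  (posDef_add_and_logDet_bound hΨ hAh (hR.opNorm_le hd hA)).1

/-- The objective is larger on the sphere of radius `r` than at the center. -/
lemma RadiusBound.objective_lt_on_sphere (hR : RadiusBound Ψ m α β r) (hd : ∀ k, 0 < d k)
    (hΨ : (kronSum Ψ).PosDef) (h : ScoreBound (score S (kronSum Ψ)) α δ)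
    (hα : 0 ≤ α) (hβ : 0 ≤ β) (hδρ : ∀ k, δ k ≤ ρ k) (hρ : ∀ k, 0 ≤ ρ k)
    (hρβ : ∀ k, (coDim d k : ℝ) * ρ k ^ 2 ≤ β ^ 2) {A : Factors d}
    (hA : frobNorm (kronSum A) = r) (hAh : (kronSum A).IsHermitian) :
    objective S ρ Ψ < objective S ρ (Ψ + A) := by
  have h1 := (posDef_add_and_logDet_bound hΨ hAh (hR.opNorm_le hd hA.le)).2
  have h2 := h.score_add_penalty_ge hd hα hβ hδρ hρ hρβ Ψ A
  rw [← sub_pos, objective_add_sub]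
  rw [score_apply, hA] at h2
  rw [hA] at h1
  set Q := 4 * opNorm (kronSum Ψ) ^ 2
  set c := α + 2 * β * Real.sqrt (∑ k, (offSupportCard (Ψ k) : ℝ))
  set pen := ∑ k, (coDim d k : ℝ) * ρ k * (offOne (Ψ k + A k) - offOne (Ψ k))
  have hQ : 0 ≤ Q := by positivity
  have h3 := hR.large
  -- Multiplied by r, the field `large` says that the quadratic gain r² exceeds the linear loss,
  -- both scaled by 4‖Ω₀‖² to avoid division.
  have h4 := mul_lt_mul_of_pos_right h3 hR.r_pos
  have h5 := mul_le_mul_of_nonneg_left h2 hQ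
  have h6 : 0 < Q * (-Real.log (kronSum Ψ + kronSum A).det + Real.log (kronSum Ψ).det
      + (S.transpose * kronSum A).trace + pen) := by nlinarith
  exact (pos_iff_pos_of_mul_pos h6).1 (lt_of_le_of_ne hQ (by rintro e; rw [← e, zero_mul] at h6; exact lt_irrefl _ h6))

/-- Convexity: the segment from Ψ to a far competitor crosses the sphere at parameter r/N, where the
objective is already above its value at Ψ. -/
lemma RadiusBound.objective_lt_outside (hR : RadiusBound Ψ m α β r) (hd : ∀ k, 0 < d k)
    (hΨ : (kronSum Ψ).PosDef) (h : ScoreBound (score S (kronSum Ψ)) α δ)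
    (hα : 0 ≤ α) (hβ : 0 ≤ β) (hδρ : ∀ k, δ k ≤ ρ k) (hρ : ∀ k, 0 ≤ ρ k)
    (hρβ : ∀ k, (coDim d k : ℝ) * ρ k ^ 2 ≤ β ^ 2) {B : Factors d}
    (hB : (kronSum B).PosDef) (hr : r < frobNorm (kronSum B - kronSum Ψ)) :
    objective S ρ Ψ < objective S ρ B := by
  obtain ⟨A, rfl⟩ : ∃ A, B = Ψ + A := ⟨B - Ψ, by abel⟩
  rw [kronSum_add, add_sub_cancel_left] at hr
  rw [kronSum_add] at hB
  have hAh : (kronSum A).IsHermitian := by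
    have := hB.1.sub hΨ.1
    rwa [add_sub_cancel_left] at this
  set N := frobNorm (kronSum A)
  have hN : 0 < N := hR.r_pos.trans hr
  have ht0 : 0 < r / N := div_pos hR.r_pos hN
  have ht1 : r / N ≤ 1 := (div_le_one hN).2 hr.le
  have h1 := hR.objective_lt_on_sphere (A := (r / N) • A) hd hΨ h hα hβ hδρ hρ hρβ
    (by rw [kronSum_smul, frobNorm_smul, abs_of_pos ht0]; exact div_mul_cancel₀ r hN.ne')
    (by
      rw [kronSum_smul]
      unfold Matrix.IsHermitian
      rw [Matrix.conjTranspose_smul, hAh.eq, star_trivial])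
  have h2 := objective_segment_le (S := S) hΨ hρ hB ht0.le ht1
  have h3 : 0 < r / N * (objective S ρ (Ψ + A) - objective S ρ Ψ) := by linarith
  have := (mul_pos_iff_of_pos_left ht0).1 h3
  linarith

/-- The Kronecker sum as a linear map. -/
def kronSumLin (d : Fin L → ℕ) : Factors d →ₗ[ℝ] Matrix (Idx d) (Idx d) ℝ where
  toFun := kronSum
  map_add' := kronSum_add
  map_smul' := kronSum_smul

/-- As factors are not unique, compactness is applied to the matrices. A linear section supplies
factors that depend continuously on the matrix. -/
lemma exists_kronSum_section (d : Fin L → ℕ) :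
    ∃ g : Matrix (Idx d) (Idx d) ℝ →ₗ[ℝ] Factors d, ∀ B, kronSum (g (kronSum B)) = kronSum B := by
  obtain ⟨g₀, hg₀⟩ := (kronSumLin d).rangeRestrict.exists_rightInverse_of_surjective
    (LinearMap.range_rangeRestrict _)
  obtain ⟨g, hg⟩ := g₀.exists_extend
  refine ⟨g, fun B => ?_⟩
  have h1 : g (kronSum B) = g₀ ⟨kronSum B, ⟨B, rfl⟩⟩ := by
    rw [← hg]; rfl
  have h2 := LinearMap.congr_fun hg₀ ⟨kronSum B, ⟨B, rfl⟩⟩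
  rw [h1]
  exact congrArg Subtype.val h2

lemma continuous_frobNorm {n : Type*} [Fintype n] :
    Continuous (frobNorm : Matrix n n ℝ → ℝ) := by
  unfold frobNorm
  refine Real.continuous_sqrt.comp ?_
  exact continuous_finsetSum _ fun i _ => continuous_finsetSum _ fun j _ =>
    ((continuous_id.matrix_elem i j).pow 2)

lemma continuous_offOne {n : Type*} [Fintype n] [DecidableEq n] :
    Continuous (offOne : Matrix n n ℝ → ℝ) := by
  unfold offOne
  refine continuous_finsetSum _ fun i _ => continuous_finsetSum _ fun j _ => ?_
  split_ifs
  · exact continuous_const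
  · exact (continuous_id.matrix_elem i j).abs

lemma abs_apply_le_frobNorm {n : Type*} [Fintype n] [DecidableEq n] (A : Matrix n n ℝ) (i j : n) :
    |A i j| ≤ frobNorm A := by
  refine abs_le_of_sq_le_sq ?_ (frobNorm_nonneg A)
  rw [frobNorm_sq]
  exact (Finset.single_le_sum (f := fun j => A i j ^ 2) (fun _ _ => sq_nonneg _)
    (Finset.mem_univ j)).trans (Finset.single_le_sum (f := fun i => ∑ j, A i j ^ 2)
    (fun _ _ => by positivity) (Finset.mem_univ i))

/-- Under the score bound the TeraLasso estimator exists, and every TeraLasso estimator is within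
Frobenius distance `r` of the truth. -/
lemma RadiusBound.exists_and_frobNorm_le (hR : RadiusBound Ψ m α β r) (hd : ∀ k, 0 < d k)
    (hΨ : (kronSum Ψ).PosDef) (h : ScoreBound (score S (kronSum Ψ)) α δ)
    (hα : 0 ≤ α) (hβ : 0 ≤ β) (hδρ : ∀ k, δ k ≤ ρ k) (hρ : ∀ k, 0 ≤ ρ k)
    (hρβ : ∀ k, (coDim d k : ℝ) * ρ k ^ 2 ≤ β ^ 2) :
    (∃ A, IsTeraLasso S ρ A) ∧
      ∀ A, IsTeraLasso S ρ A → ∃ B : Factors d, A - kronSum Ψ = kronSum B ∧ frobNorm (kronSum B) ≤ r := by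
  refine ⟨?_, ?_⟩
  · obtain ⟨g, hg⟩ := exists_kronSum_section d
    set K : Set (Matrix (Idx d) (Idx d) ℝ) :=
      (LinearMap.range (kronSumLin d) : Set (Matrix (Idx d) (Idx d) ℝ))
        ∩ ({M | M.transpose = M} ∩ {M | frobNorm (M - kronSum Ψ) ≤ r}) with hK
    have hclosed : IsClosed K := by
      refine (Submodule.closed_of_finiteDimensional _).inter (IsClosed.inter ?_ ?_)
      · exact isClosed_eq continuous_id.matrix_transpose continuous_id
      · exact isClosed_le (continuous_frobNorm.comp (continuous_id.sub continuous_const))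
          continuous_const
    have hcompact : IsCompact K := by
      have hbox : IsCompact (Set.univ.pi fun i : Idx d => Set.univ.pi fun j : Idx d =>
          Set.Icc (kronSum Ψ i j - r) (kronSum Ψ i j + r)) :=
        isCompact_univ_pi fun i => isCompact_univ_pi fun j => isCompact_Icc
      refine IsCompact.of_isClosed_subset hbox hclosed fun M hM i _ j _ => ?_
      have := abs_le.1 ((abs_apply_le_frobNorm (M - kronSum Ψ) i j).trans hM.2.2)
      rw [Matrix.sub_apply] at this
      exact ⟨by linarith [this.1], by linarith [this.2]⟩
    have hmem : ∀ M ∈ K, kronSum (g M) = M := by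
      rintro M ⟨⟨B, rfl⟩, -⟩
      exact hg B
    -- Positive definiteness need not be imposed on K: it follows from the smallness of the radius.
    -- So K is closed and the logarithm of the determinant is continuous on it.
    have hpd : ∀ M ∈ K, M.PosDef := by
      rintro M ⟨⟨B, hB⟩, hM1, hM2⟩
      have e : M - kronSum Ψ = kronSum (B - Ψ) := by
        rw [← hB]; exact ((kronSumLin d).map_sub B Ψ).symm
      have hMh : M.IsHermitian := by
        unfold Matrix.IsHermitian
        rw [Matrix.conjTranspose_eq_transpose_of_trivial]; exact hM1
      have := hR.posDef hd hΨ (A := B - Ψ) (by rw [← e]; exact hM2) (by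
        rw [← e]; exact hMh.sub hΨ.1)
      rwa [← e, add_sub_cancel] at this
    have hΨK : kronSum Ψ ∈ K := by
      refine ⟨⟨Ψ, rfl⟩, transpose_eq_of_isHermitian hΨ.1, ?_⟩
      simp only [Set.mem_ofPred_eq, sub_self]
      have : frobNorm (0 : Matrix (Idx d) (Idx d) ℝ) = 0 := by simp [frobNorm]
      rw [this]
      exact hR.r_pos.le
    have hcont : ContinuousOn (fun M => objective S ρ (g M)) K := by
      have hgc : Continuous g := g.continuous_of_finiteDimensional
      have hkc : Continuous (kronSumLin d) := (kronSumLin d).continuous_of_finiteDimensional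
      have hkg : Continuous fun M => kronSum (g M) := hkc.comp hgc
      unfold objective
      refine ContinuousOn.add (ContinuousOn.add (ContinuousOn.neg (ContinuousOn.log ?_ ?_)) ?_) ?_
      · exact hkg.matrix_det.continuousOn
      · intro M hM
        rw [hmem M hM]
        exact (hpd M hM).det_pos.ne'
      · exact (continuous_const.matrix_mul hkg).matrix_trace.continuousOn
      · refine Continuous.continuousOn (continuous_finsetSum _ fun k _ => ?_)
        exact continuous_const.mul
          (continuous_offOne.comp ((continuous_apply k).comp hgc))
    obtain ⟨M, hM, hmin⟩ := hcompact.exists_isMinOn ⟨_, hΨK⟩ hcont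
    refine ⟨M, hpd M hM, g M, (hmem M hM).symm, fun B' hB' => ?_⟩
    -- The minimum over K is global: a competitor outside the ball is worse than Ψ, which belongs to
    -- K.
    rcases le_or_gt (frobNorm (kronSum B' - kronSum Ψ)) r with hle | hgt
    · have hB'K : kronSum B' ∈ K :=
        ⟨⟨B', rfl⟩, transpose_eq_of_isHermitian hB'.1, hle⟩
      refine (hmin hB'K).trans (le_of_eq ?_)
      exact objective_congr hd S ρ (hg B')
    · have h1 := hR.objective_lt_outside hd hΨ h hα hβ hδρ hρ hρβ hB' hgt
      refine le_trans ((hmin hΨK).trans (le_of_eq ?_)) h1.le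
      exact objective_congr hd S ρ (hg Ψ)
  · rintro A ⟨hA, B, rfl, hmin⟩
    have e : kronSum B - kronSum Ψ = kronSum (B - Ψ) := ((kronSumLin d).map_sub B Ψ).symm
    refine ⟨B - Ψ, e, ?_⟩
    rw [← e]
    by_contra hlt
    have h1 := hR.objective_lt_outside hd hΨ h hα hβ hδρ hρ hρβ hA (not_le.1 hlt)
    exact absurd (hmin Ψ hΨ) (not_le.2 h1)

end Deterministic


/-! ### A lattice net -/

section Net

variable (I : Type*) [Fintype I] [DecidableEq I]

/-- Integer points in the ball of squared radius `card I`. -/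
def latticeNet : Finset (I → ℤ) :=
  (Fintype.piFinset fun _ => Finset.Icc (-(Fintype.card I : ℤ)) (Fintype.card I)).filter
    fun z => ∑ i, z i ^ 2 ≤ (Fintype.card I : ℤ)

variable {I}

lemma natAbs_le_sq (z : ℤ) : (z.natAbs : ℤ) ≤ z ^ 2 := by
  rw [← Int.natAbs_sq]
  exact_mod_cast Nat.le_self_pow two_ne_zero _

lemma mem_latticeNet {z : I → ℤ} :
    z ∈ latticeNet I ↔ ∑ i, z i ^ 2 ≤ (Fintype.card I : ℤ) := by
  unfold latticeNet
  rw [Finset.mem_filter, and_iff_right_iff_imp, Fintype.mem_piFinset]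
  intro h i
  have h1 : z i ^ 2 ≤ ∑ j, z j ^ 2 :=
    Finset.single_le_sum (f := fun j => z j ^ 2) (fun _ _ => sq_nonneg _) (Finset.mem_univ i)
  have h2 := natAbs_le_sq (z i)
  rw [Finset.mem_Icc]
  omega

lemma sum_Icc_half_pow_natAbs (D : ℕ) :
    ∑ z ∈ Finset.Icc (-(D : ℤ)) D, ((1 : ℝ) / 2) ^ z.natAbs = 3 - 2 * (1 / 2) ^ D := by
  induction D with
  | zero => norm_num
  | succ D ih =>
    have h : Finset.Icc (-((D + 1 : ℕ) : ℤ)) ((D + 1 : ℕ) : ℤ)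
        = insert (-((D + 1 : ℕ) : ℤ)) (insert (((D + 1 : ℕ) : ℤ))
          (Finset.Icc (-(D : ℤ)) D)) := by
      ext z
      simp only [Finset.mem_Icc, Finset.mem_insert]
      omega
    rw [h, Finset.sum_insert, Finset.sum_insert, ih, Int.natAbs_neg, Int.natAbs_natCast]
    · ring
    · simp only [Finset.mem_Icc]; omega
    · simp only [Finset.mem_insert, Finset.mem_Icc]; omega

/-- For integers |z| ≤ z², so net points satisfy ∑|z_i| ≤ D and carry weight 2^{D − ∑|z_i|} ≥ 1. The
weights factor over coordinates and sum over the whole box to at most (2·3)^D. -/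
lemma card_latticeNet_le : ((latticeNet I).card : ℝ) ≤ 6 ^ Fintype.card I := by
  set D := Fintype.card I
  have h1 : ∀ z ∈ latticeNet I, (1 : ℝ) ≤ 2 ^ D * ∏ i, (1 / 2) ^ (z i).natAbs := fun z hz => by
    rw [Finset.prod_pow_eq_pow_sum, one_div, inv_pow, ← div_eq_mul_inv,
      one_le_div (by positivity)]
    refine pow_le_pow_right₀ one_le_two ?_
    have h2 := mem_latticeNet.1 hz
    have h3 : ((∑ i, (z i).natAbs : ℕ) : ℤ) ≤ ∑ i, z i ^ 2 := by
      rw [Nat.cast_sum]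
      exact Finset.sum_le_sum fun i _ => natAbs_le_sq (z i)
    exact_mod_cast h3.trans h2
  calc ((latticeNet I).card : ℝ) = ∑ _z ∈ latticeNet I, (1 : ℝ) := by simp
    _ ≤ ∑ z ∈ latticeNet I, 2 ^ D * ∏ i, ((1 : ℝ) / 2) ^ (z i).natAbs := Finset.sum_le_sum h1
    _ ≤ ∑ z ∈ Fintype.piFinset fun _ : I => Finset.Icc (-(D : ℤ)) D,
          2 ^ D * ∏ i, ((1 : ℝ) / 2) ^ (z i).natAbs :=
        Finset.sum_le_sum_of_subset_of_nonneg (Finset.filter_subset _ _)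
          fun _ _ _ => by positivity
    _ = 2 ^ D * ∏ _i : I, ∑ z ∈ Finset.Icc (-(D : ℤ)) D, ((1 : ℝ) / 2) ^ z.natAbs := by
        rw [← Finset.mul_sum, Finset.prod_univ_sum]
    _ ≤ 2 ^ D * 3 ^ D := by
        rw [sum_Icc_half_pow_natAbs, Finset.prod_const, Finset.card_univ]
        have h0 : ((1 : ℝ) / 2) ^ D ≤ 1 := pow_le_one₀ (by norm_num) (by norm_num)
        have h5 : (0 : ℝ) < (1 / 2) ^ D := by positivity
        gcongr
        · linarith
        · linarith
    _ = 6 ^ D := by rw [← mul_pow]; norm_num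

/-- Rounding towards zero, so that rounding every coordinate does not leave the ball. -/
lemma exists_int_abs_le (x : ℝ) : ∃ z : ℤ, |(z : ℝ)| ≤ |x| ∧ |x - z| ≤ 1 := by
  rcases le_total 0 x with h | h
  · refine ⟨⌊x⌋, ?_, ?_⟩
    · have h1 : (0 : ℝ) ≤ ⌊x⌋ := by exact_mod_cast Int.floor_nonneg.2 h
      rw [abs_of_nonneg h, abs_of_nonneg h1]
      exact Int.floor_le x
    · rw [abs_le]
      constructor <;> linarith [Int.floor_le x, Int.lt_floor_add_one x]
  · refine ⟨⌈x⌉, ?_, ?_⟩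
    · have h1 : (⌈x⌉ : ℝ) ≤ 0 := by exact_mod_cast Int.ceil_nonpos.2 h
      rw [abs_of_nonpos h, abs_of_nonpos h1]
      linarith [Int.le_ceil x]
    · rw [abs_le]
      constructor <;> linarith [Int.le_ceil x, Int.ceil_lt_add_one x]

lemma linear_eq_sum_single (f : (I → ℝ) →ₗ[ℝ] ℝ) (w : I → ℝ) :
    f w = ∑ i, w i * f (Pi.single i 1) := by
  conv_lhs => rw [pi_eq_sum_univ' w]
  simp [map_sum, map_smul]

/-- Write w as its rounding plus a remainder in the unit cube. On the cube a linear functional is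
maximal at a sign vector, which is a net point too. -/
lemma abs_le_two_mul_of_latticeNet {f : (I → ℝ) →ₗ[ℝ] ℝ} {t : ℝ}
    (h : ∀ z ∈ latticeNet I, |f fun i => (z i : ℝ)| ≤ t) {w : I → ℝ}
    (hw : ∑ i, w i ^ 2 ≤ Fintype.card I) : |f w| ≤ 2 * t := by
  choose z hz1 hz2 using fun i => exists_int_abs_le (w i)
  have hz : z ∈ latticeNet I := mem_latticeNet.2 (by
    have : (∑ i, (z i : ℝ) ^ 2) ≤ Fintype.card I :=
      (Finset.sum_le_sum fun i _ => sq_le_sq.2 (hz1 i)).trans hw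
    exact_mod_cast this)
  set σ : I → ℤ := fun i => if 0 ≤ f (Pi.single i 1) then 1 else -1 with hσdef
  have hσ : σ ∈ latticeNet I := mem_latticeNet.2 (by
    have : ∀ i, σ i ^ 2 = 1 := fun i => by simp only [σ]; split_ifs <;> norm_num
    simp [this])
  have h1 : f w = f (fun i => (z i : ℝ)) + f (fun i => w i - z i) := by
    rw [← map_add]
    congr 1
    ext i
    simp
  have h2 : |f (fun i => w i - z i)| ≤ f (fun i => (σ i : ℝ)) := by
    rw [linear_eq_sum_single f, linear_eq_sum_single f]
    refine (Finset.abs_sum_le_sum_abs _ _).trans (Finset.sum_le_sum fun i _ => ?_)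
    rw [abs_mul]
    have h3 : (σ i : ℝ) * f (Pi.single i 1) = |f (Pi.single i 1)| := by
      simp only [σ]
      split_ifs with hs
      · simp [abs_of_nonneg hs]
      · simp [abs_of_neg (not_le.1 hs)]
    rw [h3]
    exact mul_le_of_le_one_left (abs_nonneg _) (hz2 i)
  have h4 := (le_abs_self _).trans (h σ hσ)
  have h5 := h z hz
  rw [h1]
  exact (abs_add_le _ _).trans (by linarith)

lemma sqrt_card_mul_abs_le_of_latticeNet {f : (I → ℝ) →ₗ[ℝ] ℝ} {t : ℝ}
    (h : ∀ z ∈ latticeNet I, |f fun i => (z i : ℝ)| ≤ t) (w : I → ℝ) :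
    Real.sqrt (Fintype.card I) * |f w| ≤ 2 * t * Real.sqrt (∑ i, w i ^ 2) := by
  have hs0 : 0 ≤ ∑ i, w i ^ 2 := Finset.sum_nonneg fun _ _ => sq_nonneg _
  rcases hs0.eq_or_lt with hs | hs
  · have hw : w = 0 := by
      ext i
      have := (Finset.sum_eq_zero_iff_of_nonneg fun i _ => sq_nonneg (w i)).1 hs.symm i
        (Finset.mem_univ i)
      simpa using this
    rw [← hs]
    simp [hw]
  · set N := Real.sqrt (∑ i, w i ^ 2) with hN
    have hN0 : 0 < N := Real.sqrt_pos.2 hs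
    have h1 := abs_le_two_mul_of_latticeNet h
      (w := (Real.sqrt (Fintype.card I) / N) • w) (by
        simp only [Pi.smul_apply, smul_eq_mul, mul_pow]
        rw [← Finset.mul_sum, div_pow, Real.sq_sqrt (Nat.cast_nonneg _), hN, Real.sq_sqrt hs0,
          div_mul_cancel₀ _ hs.ne'])
    rw [map_smul, smul_eq_mul, abs_mul, abs_of_nonneg (by positivity), div_mul_eq_mul_div,
      div_le_iff₀ hN0] at h1
    exact h1

end Net

/-! ### The score bound holds with high probability -/

lemma exp_neg_four_mul_card_le (D : ℕ) :
    (6 : ℝ) ^ D * (2 * Real.exp (-(4 * D))) ≤ 2 * Real.exp (-(2 * D)) := by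
  have h1 : (6 : ℝ) ≤ Real.exp 2 := by
    have := Real.exp_one_gt_d9
    have h2 : Real.exp 2 = Real.exp 1 * Real.exp 1 := by rw [← Real.exp_add]; norm_num
    rw [h2]
    nlinarith
  have h3 : (6 : ℝ) ^ D ≤ Real.exp (2 * D) := by
    calc (6 : ℝ) ^ D ≤ Real.exp 2 ^ D := pow_le_pow_left₀ (by norm_num) h1 D
      _ = Real.exp (2 * D) := by rw [← Real.exp_nat_mul]; ring_nf
  calc _ ≤ Real.exp (2 * D) * (2 * Real.exp (-(4 * D))) := by gcongr
    _ = 2 * (Real.exp (2 * D) * Real.exp (-(4 * D))) := by ring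
    _ = _ := by rw [← Real.exp_add]; ring_nf

/-- The exponent for which the variables have bounded exponential square moments. -/
def subExp (C₀ : ℝ) : ℝ := 1 / (4 * C₀ ^ 2)

lemma subExp_pos {C₀ : ℝ} (h : 0 < C₀) : 0 < subExp C₀ := by unfold subExp; positivity

/-- The variance constant for quadratic forms. -/
def quadConst (C₀ : ℝ) : ℝ := hwConst (subExp C₀)

lemma quadConst_pos {C₀ : ℝ} (h : 0 < C₀) : 0 < quadConst C₀ := hwConst_pos (subExp_pos h)

/-- The deviation level, in units of the standard deviation, used for all quadratic forms. -/
def devConst (C₀ : ℝ) : ℝ := 4 * Real.sqrt (quadConst C₀)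

lemma devConst_pos {C₀ : ℝ} (h : 0 < C₀) : 0 < devConst C₀ := by
  have := Real.sqrt_pos.2 (quadConst_pos h)
  unfold devConst; positivity

lemma devConst_sq {C₀ : ℝ} (h : 0 < C₀) : devConst C₀ ^ 2 = 16 * quadConst C₀ := by
  unfold devConst
  rw [mul_pow, Real.sq_sqrt (quadConst_pos h).le]; norm_num

namespace TensorModel

variable {C₀ : ℝ} (T : TensorModel.{u} C₀)

lemma isSubgaussianLaw (hC₀ : 0 < C₀) (j : Idx T.d) :
    IsSubgaussianLaw (subExp C₀) (T.P.map (T.Z j)) where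
  isProb := Measure.isProbabilityMeasure_map (T.measurable_Z j).aemeasurable
  mean := by
    rw [integral_map (T.measurable_Z j).aemeasurable (by fun_prop)]; exact T.mean_Z j
  var := by
    rw [integral_map (T.measurable_Z j).aemeasurable (by fun_prop)]; exact T.var_Z j
  exp_sq := by
    rw [lintegral_map (by fun_prop) (T.measurable_Z j)]
    -- Doubling C₀ yields an admissible t < 2C₀ without the infimum being attained; hence the
    -- exponent 1/(4C₀²).
    have h1 : psi2Norm T.P (T.Z j) < ENNReal.ofReal (2 * C₀) :=
      (T.psi2_Z j).trans_lt ((ENNReal.ofReal_lt_ofReal_iff (by linarith)).2 (by linarith))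
    unfold psi2Norm at h1
    simp only [iInf_lt_iff] at h1
    obtain ⟨t, ht, h2, h3⟩ := h1
    refine le_trans (lintegral_mono fun ω => ENNReal.ofReal_le_ofReal (Real.exp_le_exp.2 ?_)) h2
    have h4 : t < 2 * C₀ := (ENNReal.ofReal_lt_ofReal_iff (by linarith)).1 h3
    rw [subExp, div_mul_eq_mul_div, one_mul]
    refine div_le_div_of_nonneg_left (sq_nonneg _) (by positivity) ?_
    nlinarith

lemma map_Z_eq_pi :
    T.P.map (fun ω j => T.Z j ω) = Measure.pi fun j => T.P.map (T.Z j) :=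
  (iIndepFun_iff_map_fun_eq_pi_map fun j => (T.measurable_Z j).aemeasurable).1 T.indep_Z

/-- With x = Σ₀^{1/2}Z the score is the quadratic form of Σ₀^{1/2}MΣ₀^{1/2} in Z, and its centring
is the trace because tr(Σ₀^{1/2}MΣ₀^{1/2}) = tr(Ω₀⁻¹M). -/
lemma score_Shat_eq (ω : T.S) (M : Matrix (Idx T.d) (Idx T.d) ℝ) :
    score (T.Shat ω) (kronSum T.Ψ) M
      = ∑ i, ∑ j, T.Z i ω * (matSqrt T.Sigma0 * M * matSqrt T.Sigma0) i j * T.Z j ω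
        - (matSqrt T.Sigma0 * M * matSqrt T.Sigma0).trace := by
  rw [score_apply]
  congr 1
  · have h1 : ((T.Shat ω).transpose * M).trace = T.X ω ⬝ᵥ M.mulVec (T.X ω) := by
      simp only [Matrix.trace, Matrix.diag_apply, Matrix.mul_apply, Matrix.transpose_apply, Shat,
        Matrix.vecMulVec_apply, dotProduct, Matrix.mulVec, Finset.mul_sum]
      rw [Finset.sum_comm]
      exact Finset.sum_congr rfl fun i _ => Finset.sum_congr rfl fun j _ => by ring
    have h2 : T.X ω ⬝ᵥ M.mulVec (T.X ω) = (fun j => T.Z j ω) ⬝ᵥ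
        (matSqrt T.Sigma0 * M * matSqrt T.Sigma0).mulVec (fun j => T.Z j ω) := by
      unfold X
      rw [Matrix.mulVec_mulVec, dotProduct_comm, Matrix.dotProduct_mulVec,
        ← Matrix.mulVec_transpose, transpose_matSqrt, Matrix.mulVec_mulVec,
        dotProduct_comm, ← mul_assoc]
    rw [h1, h2]
    simp only [dotProduct, Matrix.mulVec, Finset.mul_sum, mul_assoc]
  · exact (trace_conj_matSqrt T.posDef M).symm

lemma idx_nonempty : Nonempty (Idx T.d) := ⟨fun k => ⟨0, T.d_pos k⟩⟩

lemma opNorm_Sigma0_pos : 0 < opNorm T.Sigma0 := by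
  have := T.idx_nonempty
  exact opNorm_pos T.posDef.inv

/-- Conjugation by Σ₀^{1/2} costs ‖Σ₀‖ in both norms, so deviations are measured in units of ‖Σ₀‖
and the conditions involve M alone. -/
lemma measure_score_ge_le (hC₀ : 0 < C₀) (M : Matrix (Idx T.d) (Idx T.d) ℝ) {s F : ℝ}
    (hs : 0 ≤ s) (hF : 0 < F) (hMF : frobNorm M ^ 2 ≤ F)
    (hM : 16 * s * opNorm M ≤ subExp C₀ * quadConst C₀ * F) :
    T.P {ω | s * opNorm T.Sigma0 ≤ |score (T.Shat ω) (kronSum T.Ψ) M|}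
      ≤ ENNReal.ofReal (2 * Real.exp (-(s ^ 2 / (4 * quadConst C₀ * F)))) := by
  have hσ := T.opNorm_Sigma0_pos
  set A := matSqrt T.Sigma0 * M * matSqrt T.Sigma0 with hA
  have hAop : opNorm A ≤ opNorm T.Sigma0 * opNorm M :=
    opNorm_conj_matSqrt_le T.posDef.inv.posSemidef M
  have hAf : frobNorm A ≤ opNorm T.Sigma0 * frobNorm M :=
    frobNorm_conj_matSqrt_le T.posDef.inv.posSemidef M
  have h1 := measure_quadForm_ge_le (subExp_pos hC₀) (T.isSubgaussianLaw hC₀) A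
    (s := s * opNorm T.Sigma0) (F := opNorm T.Sigma0 ^ 2 * F) (by positivity) (by positivity)
    (by
      refine (pow_le_pow_left₀ (frobNorm_nonneg _) hAf 2).trans ?_
      rw [mul_pow]
      gcongr)
    (by
      calc _ ≤ 16 * (s * opNorm T.Sigma0) * (opNorm T.Sigma0 * opNorm M) := by gcongr
        _ = opNorm T.Sigma0 ^ 2 * (16 * s * opNorm M) := by ring
        _ ≤ opNorm T.Sigma0 ^ 2 * (subExp C₀ * quadConst C₀ * F) := by gcongr
        _ = _ := by rw [quadConst]; ring)
  rw [← T.map_Z_eq_pi, Measure.map_apply (measurable_pi_lambda _ T.measurable_Z)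
    (measurableSet_le measurable_const (by fun_prop))] at h1
  refine le_trans (le_of_eq ?_) (h1.trans (le_of_eq ?_))
  · congr 1
    ext ω
    simp only [Set.mem_ofPred_eq, Set.mem_preimage, T.score_Shat_eq]
    exact Iff.rfl
  · congr 3
    rw [quadConst]
    field_simp

/-- The level of the score on diagonal Kronecker sums. -/
def diagLevel : ℝ :=
  2 * devConst C₀ * Real.sqrt (Fintype.card (DiagIdx T.d)) * opNorm T.Sigma0

/-- The level of the score on the off-diagonal coordinates of mode `k`. -/
def offLevel (k : Fin T.L) : ℝ :=
  devConst C₀ * (opNorm T.Sigma0 * Real.sqrt (Real.log T.p / T.m k))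

lemma card_diagIdx : Fintype.card (DiagIdx T.d) = ∑ k, T.d k + 1 := by
  simp [DiagIdx]

lemma frobNorm_single_sq {n : Type*} [Fintype n] [DecidableEq n] (a b : n) :
    frobNorm (Matrix.single a b (1 : ℝ)) ^ 2 = 1 := by
  rw [frobNorm_sq, Finset.sum_eq_single a, Finset.sum_eq_single b]
  · simp
  · intro c _ hc; simp [hc.symm]
  · simp
  · intro c _ hc; simp [hc.symm]
  · simp

/-- A union bound over at most 6^D net points, each failing with probability at most 2e^{-4D}. The
last hypothesis keeps the net directions in the sub-gaussian range, since their squared operator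
norm is at most (L+1)D/m. -/
lemma measure_not_diag_le (hC₀ : 0 < C₀) {m : ℝ} (hm0 : 0 < m) (hm : ∀ k, m ≤ coDim T.d k)
    (hmp : m ≤ ((∏ l, T.d l : ℕ) : ℝ))
    (h : (16 * devConst C₀) ^ 2 * ((T.L + 1) * Fintype.card (DiagIdx T.d))
      ≤ (subExp C₀ * quadConst C₀) ^ 2 * m) :
    T.P {ω | ¬ ∀ w : DiagIdx T.d → ℝ, |score (T.Shat ω) (kronSum T.Ψ) (diagKron T.d w)|
        ≤ T.diagLevel * Real.sqrt (∑ o, w o ^ 2)}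
      ≤ ENNReal.ofReal (2 * Real.exp (-(2 * Fintype.card (DiagIdx T.d)))) := by
  set D := Fintype.card (DiagIdx T.d) with hDdef
  have hD : 0 < (D : ℝ) := by exact_mod_cast Fintype.card_pos
  have hc := devConst_pos hC₀
  have ha := subExp_pos hC₀
  have hK := quadConst_pos hC₀
  set c := devConst C₀
  have hsub : {ω | ¬ ∀ w : DiagIdx T.d → ℝ,
        |score (T.Shat ω) (kronSum T.Ψ) (diagKron T.d w)|
          ≤ T.diagLevel * Real.sqrt (∑ o, w o ^ 2)}
      ⊆ ⋃ z ∈ latticeNet (DiagIdx T.d), {ω | (c * D) * opNorm T.Sigma0 ≤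
        |score (T.Shat ω) (kronSum T.Ψ) (diagKron T.d fun o => (z o : ℝ))|} := fun ω hω => by
    by_contra hcon
    simp only [Set.mem_iUnion, Set.mem_ofPred_eq, exists_prop, not_exists, not_and,
      not_le] at hcon
    refine hω fun w => ?_
    have h1 := sqrt_card_mul_abs_le_of_latticeNet
      (f := (score (T.Shat ω) (kronSum T.Ψ)).comp (diagKron T.d))
      (t := (c * D) * opNorm T.Sigma0) (fun z hz => (hcon z hz).le) w
    have hsD : 0 < Real.sqrt D := Real.sqrt_pos.2 hD
    refine le_of_mul_le_mul_left (h1.trans (le_of_eq ?_)) hsD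
    rw [diagLevel]
    have h2 := Real.mul_self_sqrt hD.le
    linear_combination (-(2 * c * opNorm T.Sigma0 * Real.sqrt (∑ o, w o ^ 2))) * h2
  have hz : ∀ z ∈ latticeNet (DiagIdx T.d), T.P {ω | (c * D) * opNorm T.Sigma0 ≤
      |score (T.Shat ω) (kronSum T.Ψ) (diagKron T.d fun o => (z o : ℝ))|}
        ≤ ENNReal.ofReal (2 * Real.exp (-(4 * D))) := fun z hz => by
    have hzD : ∑ o, (z o : ℝ) ^ 2 ≤ D := by exact_mod_cast mem_latticeNet.1 hz
    have h1 := opNorm_diagKron_sq_le T.d_pos (fun o => (z o : ℝ)) hm0.le hm hmp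
    refine (T.measure_score_ge_le hC₀ _ (by positivity) hD
      ((frobNorm_diagKron_sq_le T.d_pos _).trans hzD) ?_).trans (le_of_eq ?_)
    · have h2 : 16 * c * opNorm (diagKron T.d fun o => (z o : ℝ))
          ≤ subExp C₀ * quadConst C₀ := by
        refine abs_le_of_sq_le_sq' ?_ (by positivity) |>.2
        refine le_of_mul_le_mul_left ?_ hm0
        calc m * (16 * c * opNorm (diagKron T.d fun o => (z o : ℝ))) ^ 2
            = (16 * c) ^ 2 * (m * opNorm (diagKron T.d fun o => (z o : ℝ)) ^ 2) := by ring
          _ ≤ (16 * c) ^ 2 * ((T.L + 1) * D) := by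
            refine mul_le_mul_of_nonneg_left (h1.trans ?_) (by positivity)
            gcongr
          _ ≤ m * (subExp C₀ * quadConst C₀) ^ 2 := by rw [mul_comm m]; exact h
      calc _ = (16 * c * opNorm (diagKron T.d fun o => (z o : ℝ))) * D := by ring
        _ ≤ _ := mul_le_mul_of_nonneg_right h2 hD.le
    -- The factor 4 in `devConst` is chosen so that s²/(4KF) equals 4D at s = cD and F = D.
    · congr 3
      rw [mul_pow, devConst_sq hC₀]
      field_simp
      norm_num
  refine (measure_mono hsub).trans ((measure_biUnion_finset_le _ _).trans ?_)
  refine (Finset.sum_le_sum hz).trans ?_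
  rw [Finset.sum_const, nsmul_eq_mul, ← ENNReal.ofReal_natCast, ← ENNReal.ofReal_mul (by positivity)]
  refine ENNReal.ofReal_le_ofReal (le_trans ?_ (exp_neg_four_mul_card_le D))
  exact mul_le_mul_of_nonneg_right card_latticeNet_le (by positivity)

/-- An embedded unit has squared Frobenius norm m_k but operator norm at most 1, so its score
deviates by order √(m_k log p). The union bound runs over ∑ d_k² ≤ (∑ d_k)² units. -/
lemma measure_not_off_le (hC₀ : 0 < C₀) {m : ℝ} (hm : ∀ k, m ≤ coDim T.d k)
    (hp : 1 < T.p) (h : (16 * devConst C₀) ^ 2 * Real.log T.p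
      ≤ (subExp C₀ * quadConst C₀) ^ 2 * m) :
    T.P {ω | ¬ ∀ k (a b : Fin (T.d k)), a ≠ b →
        |score (T.Shat ω) (kronSum T.Ψ) (embed k (Matrix.single a b (1 : ℝ)))|
          ≤ coDim T.d k * T.offLevel k}
      ≤ ENNReal.ofReal ((∑ k, (T.d k : ℝ)) ^ 2 * (2 * Real.exp (-(4 * Real.log T.p)))) := by
  have hc := devConst_pos hC₀
  have ha := subExp_pos hC₀
  have hK := quadConst_pos hC₀
  set c := devConst C₀
  have hlog : 0 < Real.log T.p := Real.log_pos (by exact_mod_cast hp)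
  have hmk : ∀ k, 0 < (coDim T.d k : ℝ) := fun k => by exact_mod_cast coDim_pos T.d_pos k
  have hsub : {ω | ¬ ∀ k (a b : Fin (T.d k)), a ≠ b →
        |score (T.Shat ω) (kronSum T.Ψ) (embed k (Matrix.single a b (1 : ℝ)))|
          ≤ coDim T.d k * T.offLevel k}
      ⊆ ⋃ e ∈ (Finset.univ : Finset (Σ k, Fin (T.d k) × Fin (T.d k))),
        {ω | (c * Real.sqrt (coDim T.d e.1 * Real.log T.p)) * opNorm T.Sigma0 ≤
        |score (T.Shat ω) (kronSum T.Ψ)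
          (embed e.1 (Matrix.single e.2.1 e.2.2 (1 : ℝ)))|} := fun ω hω => by
    by_contra hcon
    simp only [Set.mem_iUnion, Set.mem_ofPred_eq, exists_prop, not_exists, not_and,
      not_le] at hcon
    refine hω fun k a b _ => ?_
    refine (hcon ⟨k, a, b⟩ (Finset.mem_univ _)).le.trans (le_of_eq ?_)
    simp only [offLevel, TensorModel.m]
    have h1 : (coDim T.d k : ℝ) * Real.sqrt (Real.log T.p / coDim T.d k)
        = Real.sqrt (coDim T.d k * Real.log T.p) := by
      rw [Real.sqrt_div hlog.le, Real.sqrt_mul (hmk k).le, mul_div_assoc',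
        div_eq_iff (Real.sqrt_pos.2 (hmk k)).ne']
      linear_combination (-Real.sqrt (Real.log T.p)) * Real.mul_self_sqrt (hmk k).le
    rw [← h1]
    ring
  have he : ∀ e ∈ (Finset.univ : Finset (Σ k, Fin (T.d k) × Fin (T.d k))),
      T.P {ω | (c * Real.sqrt (coDim T.d e.1 * Real.log T.p)) * opNorm T.Sigma0 ≤
        |score (T.Shat ω) (kronSum T.Ψ)
          (embed e.1 (Matrix.single e.2.1 e.2.2 (1 : ℝ)))|}
        ≤ ENNReal.ofReal (2 * Real.exp (-(4 * Real.log T.p))) := fun e _ => by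
    have hop : opNorm (embed e.1 (Matrix.single e.2.1 e.2.2 (1 : ℝ))) ≤ 1 := by
      refine (opNorm_embed_le _ _).trans ?_
      exact ((pow_eq_one_iff_of_nonneg (frobNorm_nonneg _) two_ne_zero).1 (frobNorm_single_sq _ _)).le
    refine (T.measure_score_ge_le hC₀ _ (by positivity) (hmk e.1) (by
      rw [frobNorm_embed_sq, frobNorm_single_sq, mul_one]) ?_).trans (le_of_eq ?_)
    · have h2 : 16 * (c * Real.sqrt (coDim T.d e.1 * Real.log T.p))
          ≤ subExp C₀ * quadConst C₀ * coDim T.d e.1 := by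
        have := (hmk e.1).le
        refine abs_le_of_sq_le_sq' ?_ (by positivity) |>.2
        rw [mul_pow, mul_pow, Real.sq_sqrt (by positivity)]
        calc _ = (16 * c) ^ 2 * Real.log T.p * coDim T.d e.1 := by ring
          _ ≤ ((subExp C₀ * quadConst C₀) ^ 2 * m) * coDim T.d e.1 := by gcongr
          _ ≤ ((subExp C₀ * quadConst C₀) ^ 2 * coDim T.d e.1) * coDim T.d e.1 := by
            gcongr
            exact hm e.1
          _ = _ := by ring
      refine le_trans (mul_le_of_le_one_right (by positivity) hop) h2
    · congr 3
      have := hmk e.1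
      rw [mul_pow, devConst_sq hC₀, Real.sq_sqrt (by positivity)]
      field_simp
      norm_num
  refine (measure_mono hsub).trans ((measure_biUnion_finset_le _ _).trans ?_)
  refine (Finset.sum_le_sum he).trans ?_
  rw [Finset.sum_const, nsmul_eq_mul, ← ENNReal.ofReal_natCast, ← ENNReal.ofReal_mul (by positivity)]
  refine ENNReal.ofReal_le_ofReal (mul_le_mul_of_nonneg_right ?_ (by positivity))
  rw [Finset.card_univ, Fintype.card_sigma]
  push_cast [Fintype.card_prod, Fintype.card_fin]
  simp only [← sq]
  exact Finset.sum_sq_le_sq_sum_of_nonneg fun k _ => Nat.cast_nonneg _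

/-- It turns the failure probability e^{-2D} of the diagonal bound into at most 1/p. -/
lemma log_p_le_sum : Real.log T.p ≤ ∑ k, (T.d k : ℝ) := by
  unfold p
  rw [Nat.cast_prod, Real.log_prod fun k _ => by exact_mod_cast (T.d_pos k).ne']
  exact Finset.sum_le_sum fun k _ =>
    (Real.log_le_sub_one_of_pos (by exact_mod_cast T.d_pos k)).trans (by linarith)

/-- The score bound fails with probability at most `4 / p`. -/
lemma measure_not_scoreBound_le (hC₀ : 0 < C₀) {m : ℝ} (hm0 : 0 < m) (hm : ∀ k, m ≤ coDim T.d k)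
    (hmp : m ≤ ((∏ l, T.d l : ℕ) : ℝ)) (hp : 1 < T.p) (hdp : ∑ k, (T.d k : ℝ) ≤ T.p)
    (h : (16 * devConst C₀) ^ 2 * ((T.L + 1) * Fintype.card (DiagIdx T.d))
      ≤ (subExp C₀ * quadConst C₀) ^ 2 * m) :
    T.P {ω | ¬ ScoreBound (score (T.Shat ω) (kronSum T.Ψ)) T.diagLevel T.offLevel}
      ≤ ENNReal.ofReal (4 / T.p) := by
  have hp0 : (1 : ℝ) < T.p := by exact_mod_cast hp
  have hlogD : Real.log T.p ≤ Fintype.card (DiagIdx T.d) := by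
    rw [T.card_diagIdx]
    push_cast
    have := T.log_p_le_sum
    linarith
  have h1 := T.measure_not_diag_le hC₀ hm0 hm hmp h
  have h2 := T.measure_not_off_le hC₀ hm hp (by
    refine le_trans (mul_le_mul_of_nonneg_left ?_ (by positivity)) h
    have : (0 : ℝ) ≤ T.L := Nat.cast_nonneg _
    have h0 : (0 : ℝ) ≤ Fintype.card (DiagIdx T.d) := Nat.cast_nonneg _
    nlinarith)
  have hsub : {ω | ¬ ScoreBound (score (T.Shat ω) (kronSum T.Ψ)) T.diagLevel T.offLevel}
      ⊆ {ω | ¬ ∀ w : DiagIdx T.d → ℝ, |score (T.Shat ω) (kronSum T.Ψ) (diagKron T.d w)|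
        ≤ T.diagLevel * Real.sqrt (∑ o, w o ^ 2)}
      ∪ {ω | ¬ ∀ k (a b : Fin (T.d k)), a ≠ b →
        |score (T.Shat ω) (kronSum T.Ψ) (embed k (Matrix.single a b (1 : ℝ)))|
          ≤ coDim T.d k * T.offLevel k} := fun ω hω => by
    by_contra hcon
    rw [Set.mem_union, not_or] at hcon
    exact hω ⟨not_not.1 hcon.1, not_not.1 hcon.2⟩
  refine (measure_mono hsub).trans ((measure_union_le _ _).trans ((add_le_add h1 h2).trans ?_))
  rw [← ENNReal.ofReal_add (by positivity) (by positivity)]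
  refine ENNReal.ofReal_le_ofReal ?_
  have e1 : Real.exp (-(2 * Fintype.card (DiagIdx T.d))) ≤ 1 / T.p := by
    rw [one_div, ← Real.exp_log (show (0 : ℝ) < T.p by linarith), ← Real.exp_neg, Real.exp_le_exp]
    have : 0 ≤ Real.log T.p := (Real.log_pos hp0).le
    linarith
  have e2 : Real.exp (-(4 * Real.log T.p)) = 1 / (T.p : ℝ) ^ 4 := by
    rw [Real.exp_neg, one_div, show (4 : ℝ) * Real.log T.p = ((4 : ℕ) : ℝ) * Real.log T.p by norm_num,
      Real.exp_nat_mul, Real.exp_log (by linarith)]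
  have e3 : (∑ k, (T.d k : ℝ)) ^ 2 * (2 * (1 / (T.p : ℝ) ^ 4)) ≤ 2 * (1 / T.p) := by
    calc _ ≤ (T.p : ℝ) ^ 2 * (2 * (1 / (T.p : ℝ) ^ 4)) := by gcongr
      _ = 2 * (1 / T.p) * (1 / T.p) := by field_simp
      _ ≤ 2 * (1 / T.p) * 1 := by
        gcongr
        rw [div_le_one (by linarith)]
        exact hp0.le
      _ = _ := mul_one _
  rw [e2]
  calc _ ≤ 2 * (1 / T.p) + 2 * (1 / T.p : ℝ) := by gcongr
    _ = 4 / T.p := by ring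

end TensorModel


/-! ### Constants, dimension counts and the deduction of the rates -/

lemma ScoreBound.mono {L : ℕ} {d : Fin L → ℕ} {f : Matrix (Idx d) (Idx d) ℝ →ₗ[ℝ] ℝ} {α : ℝ}
    {δ δ' : Fin L → ℝ} (h : ScoreBound f α δ) (hδ : ∀ k, δ k ≤ δ' k) : ScoreBound f α δ' :=
  ⟨h.diag, fun k a b hab =>
    (h.off k a b hab).trans (mul_le_mul_of_nonneg_left (hδ k) (Nat.cast_nonneg _))⟩

/-- The constant in the error bounds. -/
def errConst (C₀ Cδ ε₀ : ℝ) : ℝ := 4 * (4 * devConst C₀ + 2 * (Cδ / ε₀)) + 1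

/-- The constant in the sample size condition. -/
def sampleConst (C₀ Cδ ε₀ : ℝ) : ℝ :=
  5 * errConst C₀ Cδ ε₀ + 32 * devConst C₀ / (subExp C₀ * quadConst C₀) + 1

namespace TensorModel

variable {C₀ : ℝ} (T : TensorModel.{u} C₀)

/-! ### Dimensions -/

/-- An empty product would give p = 1. For p > 1 the extrema `mMin` and `dMax` are therefore over a
nonempty family and are attained. -/
lemma L_pos (hp : 1 < T.p) : 0 < T.L := by
  rcases Nat.eq_zero_or_pos T.L with h | h
  · exfalso
    have hempty : IsEmpty (Fin T.L) := by rw [h]; infer_instance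
    have : T.p = 1 := by simp [p]
    omega
  · exact h

lemma mMin_le (k : Fin T.L) : T.mMin ≤ T.m k := ciInf_le (OrderBot.bddBelow _) k

lemma exists_mMin_eq (hp : 1 < T.p) : ∃ k, T.mMin = T.m k := by
  have : Nonempty (Fin T.L) := ⟨⟨0, T.L_pos hp⟩⟩
  obtain ⟨k, hk⟩ := ciInf_mem T.m
  exact ⟨k, hk.symm⟩

lemma d_le_dMax (k : Fin T.L) : T.d k ≤ T.dMax := le_ciSup (Set.finite_range _).bddAbove k

lemma exists_dMax_eq (hp : 1 < T.p) : ∃ k, T.dMax = T.d k := by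
  have : Nonempty (Fin T.L) := ⟨⟨0, T.L_pos hp⟩⟩
  obtain ⟨k, hk⟩ := exists_eq_ciSup_of_finite (f := T.d)
  exact ⟨k, hk.symm⟩

lemma m_pos (k : Fin T.L) : 0 < T.m k := coDim_pos T.d_pos k

lemma p_eq (k : Fin T.L) : T.p = T.m k * T.d k := prod_eq_coDim_mul T.d k

lemma mMin_pos (hp : 1 < T.p) : 0 < T.mMin := by
  obtain ⟨k, hk⟩ := T.exists_mMin_eq hp
  rw [hk]; exact T.m_pos k

lemma one_le_dMax (hp : 1 < T.p) : 1 ≤ T.dMax :=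
  (T.d_pos ⟨0, T.L_pos hp⟩).trans_le (T.d_le_dMax _)

/-- With `p_le_mMin_mul_dMax` this is m_min d_max = p: the largest mode has the smallest
complementary product. -/
lemma mMin_mul_dMax_le (hp : 1 < T.p) : T.mMin * T.dMax ≤ T.p := by
  obtain ⟨k, hk⟩ := T.exists_dMax_eq hp
  rw [hk, T.p_eq k]
  exact Nat.mul_le_mul_right _ (T.mMin_le k)

lemma p_le_mMin_mul_dMax (hp : 1 < T.p) : T.p ≤ T.mMin * T.dMax := by
  obtain ⟨k, hk⟩ := T.exists_mMin_eq hp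
  rw [hk, T.p_eq k]
  exact Nat.mul_le_mul_left _ (T.d_le_dMax k)

lemma mMin_le_p (hp : 1 < T.p) : T.mMin ≤ T.p :=
  (Nat.le_mul_of_pos_right _ (T.one_le_dMax hp)).trans (T.mMin_mul_dMax_le hp)

lemma sum_d_le : ∑ k, (T.d k : ℝ) ≤ T.L * T.dMax := by
  calc ∑ k, (T.d k : ℝ) ≤ ∑ _k : Fin T.L, (T.dMax : ℝ) :=
        Finset.sum_le_sum fun k _ => by exact_mod_cast T.d_le_dMax k
    _ = _ := by simp

lemma mMin_mul_sSum_le : T.mMin * T.sSum ≤ T.sTot := by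
  unfold sSum sTot
  rw [Finset.mul_sum]
  exact Finset.sum_le_sum fun k _ => Nat.mul_le_mul_right _ (T.mMin_le k)

lemma log_p_nonneg : 0 ≤ Real.log T.p := Real.log_natCast_nonneg _

/-- The rate of convergence in Frobenius norm. -/
def rate : ℝ := Real.sqrt (T.sSum * Real.log T.p + T.L * T.dMax)

lemma rate_sq : T.rate ^ 2 = T.sSum * Real.log T.p + T.L * T.dMax := by
  have := T.log_p_nonneg
  exact Real.sq_sqrt (by positivity)

lemma one_le_L_mul_dMax (hp : 1 < T.p) : (1 : ℝ) ≤ T.L * T.dMax := by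
  exact_mod_cast Nat.mul_pos (T.L_pos hp) (T.one_le_dMax hp)

lemma L_mul_dMax_le_rate_sq : (T.L * T.dMax : ℝ) ≤ T.rate ^ 2 := by
  have := mul_nonneg (Nat.cast_nonneg (α := ℝ) T.sSum) T.log_p_nonneg
  rw [rate_sq]
  linarith

lemma rate_pos (hp : 1 < T.p) : 0 < T.rate := by
  have h1 := T.one_le_L_mul_dMax hp
  have h2 := T.L_mul_dMax_le_rate_sq
  have h3 : 0 ≤ T.rate := Real.sqrt_nonneg _
  nlinarith

lemma card_diagIdx_le (hp : 1 < T.p) :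
    (Fintype.card (DiagIdx T.d) : ℝ) ≤ 2 * (T.L * T.dMax) := by
  rw [T.card_diagIdx]
  push_cast
  have h1 := T.sum_d_le
  have h2 := T.one_le_L_mul_dMax hp
  linarith

/-! ### The sample size condition -/

lemma opNorm_mul_le_condNum : opNorm T.Sigma0 * opNorm T.Omega0 ≤ condNum T.Sigma0 := by
  have := T.idx_nonempty
  exact opNorm_mul_opNorm_inv_le_condNum T.posDef

lemma one_le_condNum : 1 ≤ condNum T.Sigma0 := by
  have := T.idx_nonempty
  exact (one_le_opNorm_inv_mul_opNorm T.posDef).trans T.opNorm_mul_le_condNum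

lemma opNorm_Omega0_pos : 0 < opNorm T.Omega0 := by
  have := T.idx_nonempty
  exact opNorm_pos T.posDef

/-- (A3) divided by m_min, using m_min ∑ s_k ≤ s and m_min d_max ≤ p. -/
lemma A3.rate_le {T : TensorModel.{u} C₀} {C : ℝ} (h : T.A3 C) (hp : 1 < T.p) :
    C ^ 2 * (T.L + 1) * condNum T.Sigma0 ^ 4 * T.rate ^ 2 ≤ T.mMin := by
  have hm : (0 : ℝ) < T.mMin := by exact_mod_cast T.mMin_pos hp
  have h1 : (T.mMin : ℝ) * T.sSum ≤ T.sTot := by exact_mod_cast T.mMin_mul_sSum_le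
  have h2 : (T.mMin : ℝ) * T.dMax ≤ T.p := by exact_mod_cast T.mMin_mul_dMax_le hp
  have h3 : T.rate ^ 2 * T.mMin ≤ T.sTot * Real.log T.p + T.L * T.p := by
    rw [rate_sq]
    have e1 := mul_le_mul_of_nonneg_right h1 T.log_p_nonneg
    have e2 := mul_le_mul_of_nonneg_left h2 (Nat.cast_nonneg (α := ℝ) T.L)
    linarith
  refine le_of_mul_le_mul_right ?_ hm
  calc _ = C ^ 2 * (T.L + 1) * condNum T.Sigma0 ^ 4 * (T.rate ^ 2 * T.mMin) := by ring
    _ ≤ C ^ 2 * (T.L + 1) * condNum T.Sigma0 ^ 4 *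
        (T.sTot * Real.log T.p + T.L * T.p) := by gcongr
    _ ≤ (T.mMin : ℝ) ^ 2 := h
    _ = _ := sq _

lemma A3.rate_le' {T : TensorModel.{u} C₀} {C : ℝ} (h : T.A3 C) (hp : 1 < T.p) :
    C ^ 2 * ((T.L + 1) * T.rate ^ 2) ≤ T.mMin := by
  refine le_trans ?_ (h.rate_le hp)
  have h1 : 1 ≤ condNum T.Sigma0 ^ 4 := one_le_pow₀ T.one_le_condNum
  calc _ = C ^ 2 * ((T.L + 1) * T.rate ^ 2) * 1 := (mul_one _).symm
    _ ≤ C ^ 2 * ((T.L + 1) * T.rate ^ 2) * condNum T.Sigma0 ^ 4 := by gcongr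
    _ = _ := by ring

variable {Cδ ε₀ : ℝ}

lemma measure_not_scoreBound_le_of_A3 (hC₀ : 0 < C₀) (hM : 1 ≤ errConst C₀ Cδ ε₀)
    (h3 : T.A3 (sampleConst C₀ Cδ ε₀)) (hp : 1 < T.p) :
    T.P {ω | ¬ ScoreBound (score (T.Shat ω) (kronSum T.Ψ)) T.diagLevel T.offLevel}
      ≤ ENNReal.ofReal (4 / T.p) := by
  have hc := devConst_pos hC₀
  have ha := subExp_pos hC₀
  have hK := quadConst_pos hC₀
  have hrate := h3.rate_le' hp
  have hLd := T.L_mul_dMax_le_rate_sq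
  set C := sampleConst C₀ Cδ ε₀ with hC
  have hq : 0 ≤ 32 * devConst C₀ / (subExp C₀ * quadConst C₀) := by positivity
  have hC1 : 1 ≤ C := by rw [hC, sampleConst]; linarith
  have hC2 : 32 * devConst C₀ ≤ C * (subExp C₀ * quadConst C₀) := by
    rw [← div_le_iff₀ (by positivity), hC, sampleConst]
    linarith
  have hL0 : (0 : ℝ) ≤ T.L := Nat.cast_nonneg _
  refine T.measure_not_scoreBound_le hC₀ (m := T.mMin) (by exact_mod_cast T.mMin_pos hp)
    (fun k => by exact_mod_cast T.mMin_le k) (by exact_mod_cast T.mMin_le_p hp) hp ?_ ?_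
  -- (A3) gives ∑ d_k ≤ rate² ≤ m_min ≤ p, so the union bound over units is affordable.
  · refine T.sum_d_le.trans (hLd.trans ?_)
    refine le_trans ?_ (show (T.mMin : ℝ) ≤ T.p by exact_mod_cast T.mMin_le_p hp)
    refine le_trans ?_ hrate
    have h1 : 1 ≤ C ^ 2 := one_le_pow₀ hC1
    have h2 : T.rate ^ 2 ≤ (T.L + 1) * T.rate ^ 2 :=
      le_mul_of_one_le_left (sq_nonneg _) (by linarith)
    exact h2.trans (le_mul_of_one_le_left (by positivity) h1)
  · have h1 := T.card_diagIdx_le hp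
    have h2 : (32 * devConst C₀) ^ 2 ≤ (C * (subExp C₀ * quadConst C₀)) ^ 2 :=
      pow_le_pow_left₀ (by positivity) hC2 2
    -- A bound 4·rate² on the number of diagonal parameters turns 16 into the 32 of `sampleConst`.
    calc _ ≤ (16 * devConst C₀) ^ 2 * ((T.L + 1) * (4 * T.rate ^ 2)) := by
          gcongr
          nlinarith [sq_nonneg T.rate]
      _ = (32 * devConst C₀) ^ 2 * ((T.L + 1) * T.rate ^ 2) := by ring
      _ ≤ (C * (subExp C₀ * quadConst C₀)) ^ 2 * ((T.L + 1) * T.rate ^ 2) := by gcongr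
      _ = (subExp C₀ * quadConst C₀) ^ 2 * (C ^ 2 * ((T.L + 1) * T.rate ^ 2)) := by ring
      _ ≤ _ := by gcongr

/-- The total noise level of the score over the model's support. -/
lemma score_level_le (hC₀ : 0 < C₀) {q : ℝ} (hq : 0 ≤ q) (hp : 1 < T.p) :
    T.diagLevel + 2 * (q * (opNorm T.Sigma0 * Real.sqrt (Real.log T.p))) *
        Real.sqrt (∑ k, (offSupportCard (T.Ψ k) : ℝ))
      ≤ (4 * devConst C₀ + 2 * q) * (opNorm T.Sigma0 * T.rate) := by
  have hc := devConst_pos hC₀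
  have hSig := T.opNorm_Sigma0_pos
  have hr := T.rate_pos hp
  have hD : Real.sqrt (Fintype.card (DiagIdx T.d)) ≤ 2 * T.rate := by
    rw [Real.sqrt_le_iff]
    refine ⟨by positivity, ?_⟩
    have h1 := T.card_diagIdx_le hp
    have h2 := T.L_mul_dMax_le_rate_sq
    nlinarith [sq_nonneg T.rate]
  have hα : T.diagLevel ≤ 4 * devConst C₀ * opNorm T.Sigma0 * T.rate := by
    unfold diagLevel
    calc _ ≤ 2 * devConst C₀ * (2 * T.rate) * opNorm T.Sigma0 := by gcongr
      _ = _ := by ring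
  have hs : Real.sqrt (Real.log T.p) * Real.sqrt (∑ k, (offSupportCard (T.Ψ k) : ℝ))
      ≤ T.rate := by
    rw [← Real.sqrt_mul T.log_p_nonneg]
    refine Real.sqrt_le_sqrt ?_
    have h1 : ∑ k, (offSupportCard (T.Ψ k) : ℝ) = T.sSum := by
      unfold sSum s; push_cast; rfl
    have h2 : (0 : ℝ) ≤ T.L * T.dMax := by positivity
    rw [h1]
    linarith
  have h1 : 2 * (q * (opNorm T.Sigma0 * Real.sqrt (Real.log T.p))) *
      Real.sqrt (∑ k, (offSupportCard (T.Ψ k) : ℝ)) ≤ 2 * q * opNorm T.Sigma0 * T.rate := by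
    calc _ = 2 * q * opNorm T.Sigma0 * (Real.sqrt (Real.log T.p) *
            Real.sqrt (∑ k, (offSupportCard (T.Ψ k) : ℝ))) := by ring
      _ ≤ _ := by gcongr
  linarith

/-- The localization radius. -/
def radius (Cδ ε₀ : ℝ) : ℝ :=
  errConst C₀ Cδ ε₀ * (condNum T.Sigma0 * opNorm T.Omega0) * T.rate

/-- For `small`, ‖Σ₀‖²r² contains κ²(‖Σ₀‖‖Ω₀‖)² ≤ κ⁴, the power in (A3). For `large`, ‖Ω₀‖²‖Σ₀‖ ≤
κ‖Ω₀‖. -/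
lemma radiusBound (hC₀ : 0 < C₀) (hCδ : 0 ≤ Cδ) (hε₀ : 0 < ε₀)
    (h3 : T.A3 (sampleConst C₀ Cδ ε₀)) (hp : 1 < T.p) :
    RadiusBound T.Ψ T.mMin T.diagLevel (Cδ / ε₀ * (opNorm T.Sigma0 * Real.sqrt (Real.log T.p)))
      (T.radius Cδ ε₀) := by
  have hc := devConst_pos hC₀
  have ha := subExp_pos hC₀
  have hK := quadConst_pos hC₀
  have hκ := T.one_le_condNum
  have hΩ := T.opNorm_Omega0_pos
  have hSig := T.opNorm_Sigma0_pos
  have hκΩ := T.opNorm_mul_le_condNum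
  have hr := T.rate_pos hp
  have hq : 0 ≤ Cδ / ε₀ := by positivity
  set M := errConst C₀ Cδ ε₀ with hMdef
  have hM : 0 < M := by rw [hMdef, errConst]; positivity
  refine ⟨by exact_mod_cast T.mMin_pos hp, fun k => by exact_mod_cast T.mMin_le k,
    by exact_mod_cast T.mMin_le_p hp, ?_, ?_, ?_⟩
  · unfold radius; positivity
  · have h1 : 5 * M ≤ sampleConst C₀ Cδ ε₀ := by
      have : 0 ≤ 32 * devConst C₀ / (subExp C₀ * quadConst C₀) := by positivity
      rw [sampleConst]; linarith
    have h2 := pow_le_pow_left₀ (by positivity) h1 2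
    have h4 := pow_le_pow_left₀ (by positivity) hκΩ 2
    refine le_trans ?_ (h3.rate_le hp)
    calc 25 * opNorm T.Sigma0 ^ 2 * ((T.L + 1) * (M * (condNum T.Sigma0 * opNorm T.Omega0) *
          T.rate) ^ 2)
        = (5 * M) ^ 2 * (T.L + 1) * (condNum T.Sigma0 ^ 2 *
          (opNorm T.Sigma0 * opNorm T.Omega0) ^ 2) * T.rate ^ 2 := by ring
      _ ≤ sampleConst C₀ Cδ ε₀ ^ 2 * (T.L + 1) * (condNum T.Sigma0 ^ 2 *
          condNum T.Sigma0 ^ 2) * T.rate ^ 2 := by gcongr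
      _ = _ := by ring
  · have hsum := T.score_level_le hC₀ hq hp
    -- The final +1 in `errConst` supplies the strict inequality.
    have hM1 : 4 * (4 * devConst C₀ + 2 * (Cδ / ε₀)) < M := by
      rw [hMdef, errConst]; linarith
    have hκΩ0 : 0 < condNum T.Sigma0 * opNorm T.Omega0 := by positivity
    calc 4 * opNorm T.Omega0 ^ 2 * _
        ≤ 4 * opNorm T.Omega0 ^ 2 *
          ((4 * devConst C₀ + 2 * (Cδ / ε₀)) * (opNorm T.Sigma0 * T.rate)) := by gcongr
      _ = (4 * (4 * devConst C₀ + 2 * (Cδ / ε₀))) *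
          ((opNorm T.Sigma0 * opNorm T.Omega0) * opNorm T.Omega0) * T.rate := by ring
      _ ≤ (4 * (4 * devConst C₀ + 2 * (Cδ / ε₀))) *
          (condNum T.Sigma0 * opNorm T.Omega0) * T.rate := by gcongr
      _ < M * (condNum T.Sigma0 * opNorm T.Omega0) * T.rate :=
          mul_lt_mul_of_pos_right (mul_lt_mul_of_pos_right hM1 hκΩ0) hr
      _ = _ := rfl

/-- On the score event, any choice of TeraLasso estimator differs from the truth by a Kronecker sum
of Frobenius norm at most `radius`. -/
lemma exists_kronSum_error (hC₀ : 0 < C₀) (hCδ : 0 ≤ Cδ) (hε₀ : 0 < ε₀)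
    (h3 : T.A3 (sampleConst C₀ Cδ ε₀)) (hp : 1 < T.p) {δ ε ρ : Fin T.L → ℝ}
    (h1 : T.A1 (devConst C₀) Cδ ε₀ δ ε ρ) {ω : T.S}
    (hω : ScoreBound (score (T.Shat ω) (kronSum T.Ψ)) T.diagLevel T.offLevel)
    {A : Matrix (Idx T.d) (Idx T.d) ℝ}
    (hA : (∃ A, IsTeraLasso (T.Shat ω) ρ A) → IsTeraLasso (T.Shat ω) ρ A) :
    ∃ B : Factors T.d, A - T.Omega0 = kronSum B ∧ frobNorm (kronSum B) ≤ T.radius Cδ ε₀ := by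
  have hc := devConst_pos hC₀
  have hSig := T.opNorm_Sigma0_pos
  have hδ0 : ∀ k, 0 ≤ δ k := fun k => le_trans (by positivity) (h1.2 k).1
  have hε : ∀ k, 0 < ε k := fun k => hε₀.trans_le (h1.2 k).2.2.1
  have hδρ : ∀ k, δ k ≤ ρ k := fun k => by
    rw [(h1.2 k).2.2.2.2]
    exact le_div_self (hδ0 k) (hε k) (h1.2 k).2.2.2.1.le
  have hρ0 : ∀ k, 0 ≤ ρ k := fun k => (hδ0 k).trans (hδρ k)
  have hα : 0 ≤ T.diagLevel := by unfold diagLevel; positivity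
  have hρβ : ∀ k, (coDim T.d k : ℝ) * ρ k ^ 2
      ≤ (Cδ / ε₀ * (opNorm T.Sigma0 * Real.sqrt (Real.log T.p))) ^ 2 := fun k => by
    have hm : (0 : ℝ) < coDim T.d k := by exact_mod_cast T.m_pos k
    -- Each ρ_k scales like m_k^{-1/2}, so m_kρ_k² is bounded by a quantity free of k, which serves
    -- as β².
    have e1 : ρ k ≤ Cδ * (opNorm T.Sigma0 * Real.sqrt (Real.log T.p / T.m k)) / ε₀ := by
      rw [(h1.2 k).2.2.2.2]
      exact div_le_div₀ (by positivity) (h1.2 k).2.1 hε₀ (h1.2 k).2.2.1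
    have e2 := pow_le_pow_left₀ (hρ0 k) e1 2
    refine (mul_le_mul_of_nonneg_left e2 hm.le).trans (le_of_eq ?_)
    simp only [m, div_pow, mul_pow]
    rw [Real.sq_sqrt (div_nonneg T.log_p_nonneg hm.le), Real.sq_sqrt T.log_p_nonneg]
    field_simp
  obtain ⟨hex, hall⟩ := (T.radiusBound hC₀ hCδ hε₀ h3 hp).exists_and_frobNorm_le T.d_pos T.posDef
    (hω.mono fun k => (h1.2 k).1) hα (by positivity) hδρ hρ0 hρβ
  exact hall A (hA hex)

/-- Used for the error and for Ω₀ itself. The factor 2 is generous: L + 1 ≤ 4L. -/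
lemma opNorm_kronSum_le (hp : 1 < T.p) (B : Factors T.d) :
    opNorm (kronSum B)
      ≤ 2 * (Real.sqrt T.L / Real.sqrt T.mMin) * frobNorm (kronSum B) := by
  have hm : (0 : ℝ) < T.mMin := by exact_mod_cast T.mMin_pos hp
  have hL : (1 : ℝ) ≤ T.L := by exact_mod_cast T.L_pos hp
  have h1 := opNorm_kronSum_sq_le T.d_pos B hm.le (fun k => by exact_mod_cast T.mMin_le k)
    (by exact_mod_cast T.mMin_le_p hp)
  refine abs_le_of_sq_le_sq' ?_ (mul_nonneg (by positivity) (frobNorm_nonneg _)) |>.2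
  rw [mul_pow, mul_pow, div_pow, Real.sq_sqrt (by linarith), Real.sq_sqrt hm.le]
  refine le_of_mul_le_mul_left (h1.trans ?_) hm
  have e : (T.mMin : ℝ) * (2 ^ 2 * (T.L / T.mMin) * frobNorm (kronSum B) ^ 2)
      = 4 * T.L * frobNorm (kronSum B) ^ 2 := by field_simp; ring
  rw [e]
  exact mul_le_mul_of_nonneg_right (by linarith) (sq_nonneg _)

lemma rate_two_eq :
    Real.sqrt (T.L * T.sSum * Real.log T.p + (T.L : ℝ) ^ 2 * T.dMax) / Real.sqrt T.mMin
      = Real.sqrt T.L / Real.sqrt T.mMin * T.rate := by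
  rw [rate, div_mul_eq_mul_div, ← Real.sqrt_mul (Nat.cast_nonneg _)]
  congr 2
  ring

/-- In the balanced regime the spectral rate is at most of order `L p^{1/L - 1/2}`. -/
lemma balanced_rate_le (hp : 1 < T.p) {K₁ K₂ : ℝ}
    (h1 : ∀ k k', (T.d k : ℝ) ≤ K₁ * T.d k')
    (h2 : ∀ k, Real.log T.p / T.L * T.sSum ≤ K₂ * T.d k) :
    Real.sqrt T.L / Real.sqrt T.mMin * T.rate
      ≤ Real.sqrt (1 + |K₂|) * |K₁| * (T.L * (T.p : ℝ) ^ ((1 : ℝ) / T.L - 1 / 2)) := by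
  have hm : (0 : ℝ) < T.mMin := by exact_mod_cast T.mMin_pos hp
  have hL : (0 : ℝ) < T.L := by exact_mod_cast T.L_pos hp
  have hp0 : (0 : ℝ) < T.p := by exact_mod_cast (zero_lt_one.trans hp)
  obtain ⟨k₀, hk₀⟩ := T.exists_dMax_eq hp
  have hd0 : (0 : ℝ) < T.dMax := by exact_mod_cast T.one_le_dMax hp
  -- The lower bound on the dimensions lets L d_max absorb the sparsity term.
  have hr : T.rate ^ 2 ≤ (1 + |K₂|) * (T.L * T.dMax) := by
    rw [rate_sq]
    have e1 := h2 k₀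
    rw [← hk₀, div_mul_eq_mul_div, div_le_iff₀ hL] at e1
    have e2 : K₂ * T.dMax * T.L ≤ |K₂| * T.dMax * T.L := by
      gcongr; exact le_abs_self _
    linarith
  have hdp : (T.dMax : ℝ) ≤ |K₁| * (T.p : ℝ) ^ ((1 : ℝ) / T.L) := by
    -- Comparing d_max with each d_k and multiplying over modes compares d_max^L with p.
    have e1 : (T.dMax : ℝ) ^ T.L ≤ |K₁| ^ T.L * T.p := by
      have : (T.dMax : ℝ) ^ T.L = ∏ _k : Fin T.L, (T.dMax : ℝ) := by simp
      rw [this]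
      calc _ ≤ ∏ k : Fin T.L, (|K₁| * T.d k) := by
            refine Finset.prod_le_prod (fun _ _ => hd0.le) fun k _ => ?_
            rw [hk₀]
            refine (h1 k₀ k).trans ?_
            gcongr
            exact le_abs_self _
        _ = _ := by rw [Finset.prod_mul_distrib]; simp [p]
    refine le_of_pow_le_pow_left₀ (T.L_pos hp).ne' (by positivity) (e1.trans (le_of_eq ?_))
    rw [mul_pow, ← Real.rpow_natCast ((T.p : ℝ) ^ ((1 : ℝ) / T.L)), ← Real.rpow_mul hp0.le,
      one_div, inv_mul_cancel₀ hL.ne', Real.rpow_one]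
  have hpm : (T.p : ℝ) ≤ T.mMin * T.dMax := by exact_mod_cast T.p_le_mMin_mul_dMax hp
  have hr0 := T.rate_pos hp
  have h4 : Real.sqrt T.L / Real.sqrt T.mMin * T.rate
      ≤ Real.sqrt (1 + |K₂|) * (T.L * (T.dMax / Real.sqrt T.p)) := by
    refine abs_le_of_sq_le_sq' ?_ (by positivity) |>.2
    simp only [mul_pow, div_pow]
    rw [Real.sq_sqrt hL.le, Real.sq_sqrt hm.le, Real.sq_sqrt hp0.le, Real.sq_sqrt (by positivity)]
    have e1 : (T.dMax : ℝ) / T.mMin ≤ T.dMax ^ 2 / T.p := by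
      rw [div_le_div_iff₀ hm hp0]
      calc _ ≤ (T.dMax : ℝ) * (T.mMin * T.dMax) := by gcongr
        _ = _ := by ring
    calc (T.L : ℝ) / T.mMin * T.rate ^ 2
        ≤ T.L / T.mMin * ((1 + |K₂|) * (T.L * T.dMax)) := by gcongr
      _ = (1 + |K₂|) * (T.L ^ 2 * (T.dMax / T.mMin)) := by ring
      _ ≤ _ := by gcongr
  refine h4.trans ?_
  have h5 : (T.dMax : ℝ) / Real.sqrt T.p ≤ |K₁| * (T.p : ℝ) ^ ((1 : ℝ) / T.L - 1 / 2) := by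
    rw [Real.rpow_sub hp0, ← Real.sqrt_eq_rpow, ← mul_div_assoc]
    gcongr
  calc _ ≤ Real.sqrt (1 + |K₂|) *
        (T.L * (|K₁| * (T.p : ℝ) ^ ((1 : ℝ) / T.L - 1 / 2))) := by gcongr
    _ = _ := by ring

lemma frobNorm_Omega0_pos : 0 < frobNorm T.Omega0 :=
  T.opNorm_Omega0_pos.trans_le (opNorm_le_frobNorm _)

end TensorModel

/-- A ratio that is bounded outside events of vanishing probability is bounded in probability. -/
lemma isBigOP_of_bound {ι : Type*} {l : Filter ι} {C₀ : ℝ} {T : ι → TensorModel.{u} C₀}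
    (hT : Tendsto (fun i => (T i).p) l atTop) (E : ∀ i, Set (T i).S)
    (hE : ∀ i, 1 < (T i).p → (T i).P (E i)ᶜ ≤ ENNReal.ofReal (4 / (T i).p))
    {X : ∀ i, (T i).S → ℝ} {a : ι → ℝ} {M : ℝ} (hM : 0 < M)
    (h : ∀ i, 1 < (T i).p → ∀ ω ∈ E i, |X i ω| ≤ M * a i) :
    IsBigOP l (fun i => (T i).P) X a := by
  intro η hη
  refine ⟨M, hM, ?_⟩
  have h1 := hT.eventually_gt_atTop 1
  have h2 : ∀ᶠ i in l, 4 / η ≤ ((T i).p : ℝ) :=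
    (tendsto_natCast_atTop_atTop.comp hT).eventually_ge_atTop _
  filter_upwards [h1, h2] with i hi1 hi2
  -- Only monotonicity of the outer measure is needed, so the estimator need not be measurable.
  refine (measure_mono fun ω hω => ?_).trans ((hE i hi1).trans (ENNReal.ofReal_le_ofReal ?_))
  · exact fun hωE => absurd (h i hi1 ω hωE) (not_le.2 hω)
  · have : (0 : ℝ) < (T i).p := by exact_mod_cast (zero_lt_one.trans hi1)
    rw [div_le_iff₀ hη] at hi2
    rw [div_le_iff₀ this]
    linarith

end TeraLasso

end

/-! ### Assembly of the three rates -/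

open TeraLasso in
theorem mainTheorem4 (C₀ : ℝ) (hC₀ : 0 < C₀) :
    ∃ cδ : ℝ, 0 < cδ ∧ ∀ Cδ ε₀ : ℝ, cδ ≤ Cδ → 0 < ε₀ → ε₀ < 1 →
    ∃ C : ℝ, 0 < C ∧
    ∀ {ι : Type v} (l : Filter ι) (T : ι → TeraLasso.TensorModel.{u} C₀)
      (δ ε ρ : ∀ i, Fin (T i).L → ℝ) (klow kup : ι → ℝ)
      (Ωhat : ∀ i, (T i).S →
        Matrix (TeraLasso.Idx (T i).d) (TeraLasso.Idx (T i).d) ℝ),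
      Tendsto (fun i => (T i).p) l atTop →
      (∀ i, (T i).A1 cδ Cδ ε₀ (δ i) (ε i) (ρ i)) →
      (∀ i, (T i).A2 (klow i) (kup i)) →
      (∀ i, (T i).A3 C) →
      -- the estimator is a minimizer whenever there is one
      (∀ i ω, (∃ A, TeraLasso.IsTeraLasso ((T i).Shat ω) (ρ i) A) →
        TeraLasso.IsTeraLasso ((T i).Shat ω) (ρ i) (Ωhat i ω)) →
      -- `d k = O(m k)`
      (∃ K : ℝ, ∀ i k, ((T i).d k : ℝ) ≤ K * (T i).m k) →
      -- all `m k` are of the same order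
      (∃ K : ℝ, ∀ i k k', ((T i).m k : ℝ) ≤ K * (T i).m k') →
      TeraLasso.IsBigOP l (fun i => (T i).P)
          (fun i ω => TeraLasso.frobNorm (Ωhat i ω - (T i).Omega0) /
            (TeraLasso.condNum (T i).Sigma0 * TeraLasso.opNorm (T i).Omega0))
          (fun i => Real.sqrt ((T i).sSum * Real.log (T i).p + (T i).L * (T i).dMax)) ∧
      TeraLasso.IsBigOP l (fun i => (T i).P)
          (fun i ω => TeraLasso.opNorm (Ωhat i ω - (T i).Omega0) /
            (TeraLasso.condNum (T i).Sigma0 * TeraLasso.opNorm (T i).Omega0))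
          (fun i => Real.sqrt ((T i).L * (T i).sSum * Real.log (T i).p
              + ((T i).L : ℝ) ^ 2 * (T i).dMax) / Real.sqrt (T i).mMin) ∧
      -- all `d k` are of the same order and `d k = Ω((log p / L) * ∑ j, s j)`
      ((∃ K : ℝ, ∀ i k k', ((T i).d k : ℝ) ≤ K * (T i).d k') →
        (∃ K : ℝ, ∀ i k,
          Real.log (T i).p / (T i).L * (T i).sSum ≤ K * (T i).d k) →
        TeraLasso.IsBigOP l (fun i => (T i).P)
          (fun i ω => max
            (TeraLasso.opNorm (Ωhat i ω - (T i).Omega0) / TeraLasso.opNorm (T i).Omega0)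
            (TeraLasso.frobNorm (Ωhat i ω - (T i).Omega0) / TeraLasso.frobNorm (T i).Omega0))
          (fun i => (T i).L * TeraLasso.condNum (T i).Sigma0 *
            ((T i).p : ℝ) ^ ((1 : ℝ) / (T i).L - 1 / 2))) := by
  refine ⟨devConst C₀, devConst_pos hC₀, fun Cδ ε₀ hCδ hε₀ _ => ?_⟩
  have hc := devConst_pos hC₀
  have hCδ0 : 0 ≤ Cδ := hc.le.trans hCδ
  have hM : 1 ≤ errConst C₀ Cδ ε₀ := by
    have : 0 ≤ 4 * (4 * devConst C₀ + 2 * (Cδ / ε₀)) := by positivity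
    unfold errConst
    linarith
  have hM0 : 0 < errConst C₀ Cδ ε₀ := zero_lt_one.trans_le hM
  refine ⟨sampleConst C₀ Cδ ε₀, ?_, ?_⟩
  · have := subExp_pos hC₀
    have := quadConst_pos hC₀
    unfold sampleConst
    positivity
  intro ι l T δ ε ρ klow kup Ωhat hT h1 _ h3 hΩhat _ _
  set E : ∀ i, Set (T i).S := fun i =>
    {ω | ScoreBound (score ((T i).Shat ω) (kronSum (T i).Ψ)) (T i).diagLevel (T i).offLevel}
  have hE : ∀ i, 1 < (T i).p → (T i).P (E i)ᶜ ≤ ENNReal.ofReal (4 / (T i).p) := fun i hp =>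
    (T i).measure_not_scoreBound_le_of_A3 hC₀ hM (h3 i) hp
  have herr : ∀ i, 1 < (T i).p → ∀ ω ∈ E i, ∃ B : Factors (T i).d,
      Ωhat i ω - (T i).Omega0 = kronSum B ∧ frobNorm (kronSum B) ≤ (T i).radius Cδ ε₀ :=
    fun i hp ω hω => (T i).exists_kronSum_error hC₀ hCδ0 hε₀ (h3 i) hp (h1 i) hω (hΩhat i ω)
  have hfrob : ∀ i, 1 < (T i).p → ∀ ω ∈ E i,
      frobNorm (Ωhat i ω - (T i).Omega0) ≤ (T i).radius Cδ ε₀ := fun i hp ω hω => by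
    obtain ⟨B, hB, hBr⟩ := herr i hp ω hω
    rw [hB]; exact hBr
  have hop : ∀ i, 1 < (T i).p → ∀ ω ∈ E i, opNorm (Ωhat i ω - (T i).Omega0)
      ≤ 2 * (Real.sqrt (T i).L / Real.sqrt (T i).mMin) * (T i).radius Cδ ε₀ :=
    fun i hp ω hω => by
      obtain ⟨B, hB, hBr⟩ := herr i hp ω hω
      rw [hB]
      refine ((T i).opNorm_kronSum_le hp B).trans ?_
      gcongr
  have hκ : ∀ i, 0 < condNum (T i).Sigma0 := fun i =>
    zero_lt_one.trans_le (T i).one_le_condNum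
  have hΩ : ∀ i, 0 < opNorm (T i).Omega0 := fun i => (T i).opNorm_Omega0_pos
  refine ⟨isBigOP_of_bound hT E hE hM0 fun i hp ω hω => ?_,
    isBigOP_of_bound hT E hE (M := 2 * errConst C₀ Cδ ε₀) (by positivity) fun i hp ω hω => ?_,
    ?_⟩
  · have := hκ i
    have := hΩ i
    rw [abs_of_nonneg (div_nonneg (frobNorm_nonneg _) (by positivity)),
      div_le_iff₀ (by positivity)]
    refine (hfrob i hp ω hω).trans (le_of_eq ?_)
    rw [TensorModel.radius, TensorModel.rate]
    ring
  · have := hκ i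
    have := hΩ i
    rw [abs_of_nonneg (div_nonneg (opNorm_nonneg _) (by positivity)),
      div_le_iff₀ (by positivity), (T i).rate_two_eq]
    refine (hop i hp ω hω).trans (le_of_eq ?_)
    rw [TensorModel.radius]
    ring
  · rintro ⟨K₁, hK₁⟩ ⟨K₂, hK₂⟩
    set Q := Real.sqrt (1 + |K₂|) * |K₁| with hQ
    have hQ0 : 0 ≤ Q := by positivity
    -- Q may vanish, so Q + 1 keeps the constant positive.
    refine isBigOP_of_bound hT E hE (M := 2 * errConst C₀ Cδ ε₀ * (Q + 1)) (by positivity)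
      fun i hp ω hω => ?_
    have hb := (T i).balanced_rate_le hp (hK₁ i) (hK₂ i)
    rw [← hQ] at hb
    have hκi := hκ i
    have hΩi := hΩ i
    have hFi := (T i).frobNorm_Omega0_pos
    set a := ((T i).L : ℝ) * ((T i).p : ℝ) ^ ((1 : ℝ) / (T i).L - 1 / 2) with ha
    have ha0 : 0 ≤ a := by positivity
    set g := Real.sqrt (T i).L / Real.sqrt (T i).mMin
    have hg0 : 0 ≤ g := by positivity
    have hr0 := ((T i).rate_pos hp).le
    have htarget : 2 * errConst C₀ Cδ ε₀ * (Q + 1) * ((T i).L * condNum (T i).Sigma0 *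
        ((T i).p : ℝ) ^ ((1 : ℝ) / (T i).L - 1 / 2))
        = 2 * errConst C₀ Cδ ε₀ * condNum (T i).Sigma0 * ((Q + 1) * a) := by
      rw [ha]; ring
    have hmain : 2 * errConst C₀ Cδ ε₀ * condNum (T i).Sigma0 * (g * (T i).rate)
        ≤ 2 * errConst C₀ Cδ ε₀ * condNum (T i).Sigma0 * ((Q + 1) * a) := by
      refine mul_le_mul_of_nonneg_left (hb.trans ?_) (by positivity)
      exact mul_le_mul_of_nonneg_right (by linarith) ha0
    rw [htarget, abs_of_nonneg (le_max_of_le_left (div_nonneg (opNorm_nonneg _) hΩi.le))]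
    refine max_le ?_ ?_
    · refine le_trans ?_ hmain
      rw [div_le_iff₀ hΩi]
      refine (hop i hp ω hω).trans (le_of_eq ?_)
      rw [TensorModel.radius]
      ring
    · refine le_trans ?_ hmain
      rw [div_le_iff₀ hFi]
      refine (hfrob i hp ω hω).trans ?_
      -- The truth is a Kronecker sum too, so ‖Ω₀‖ ≤ 2g‖Ω₀‖_F; the relative Frobenius error gains
      -- the same factor g as the spectral one.
      have hΩF := (T i).opNorm_kronSum_le hp (T i).Ψ
      calc (T i).radius Cδ ε₀
          = errConst C₀ Cδ ε₀ * condNum (T i).Sigma0 * (T i).rate * opNorm (T i).Omega0 := by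
            rw [TensorModel.radius]; ring
        _ ≤ errConst C₀ Cδ ε₀ * condNum (T i).Sigma0 * (T i).rate *
            (2 * g * frobNorm (T i).Omega0) := by
            gcongr
            exact hΩF
        _ = _ := by ring
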